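/- **Theorem.** Consider the problem $1|er|\sum w_jC_j$: given $n$ jobs $j$ with integer processing times $p_j\ge 1$ and integer weights $w_j\ge 0$ whose sum $W=\sum_j w_j$ is at least $1$, a set $J^r$ of jobs that require an external resource, and a budget $K^r\in\mathbb{N}$, find a sequence (permutation) of the jobs, processed one after another from time $0$ on without idle time, that minimizes the total weighted completion time $\sum_j w_jC_j$ among all sequences whose renting period satisfies $$er=\max_{j\in J^r}C_j-\min_{j\in J^r}(C_j-p_j)\le K^r$$ (where $er=0$ if $J^r=\emptyset$), or report that no such sequence exists. Here $C_j$ is the completion time of job $j$. Let $P=\sum_j p_j$. Then this problem can be solved in $\mathrm{O}(nP\min\{P,W\})$ time. That is, there are a single program for a unit-cost word RAM and constants $c,k$ such that on every such instance, using only words with values at most $(n+P+W+K^r+2)^k$, the program halts with a correct answer after at most $c\cdot nP\min\{P,W\}$ steps. -/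

import Mathlib

/-! ### A word RAM with unit-cost steps

Programs are while-programs over scalar variables and unbounded arrays of natural-number words.
A program names only finitely many variables and arrays, each by a fixed number.
Words hold the natural numbers at most `B`; a run that would use or produce a larger number is
stuck, i.e. it has no final state.  Every operation, literal, variable access, array access,
assignment and test costs one step. -/

namespace WordRAM

/-- Expressions.  `arr A i` reads the cell of array `A` at the computed index `i`. -/
inductive Expr where
  | lit (m : ℕ) : Expr
  | var (x : ℕ) : Expr
  | arr (A : ℕ) (i : Expr) : Expr
  | add (a b : Expr) : Expr
  | sub (a b : Expr) : Expr
  | mul (a b : Expr) : Expr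
  | lt (a b : Expr) : Expr
  | eq (a b : Expr) : Expr

/-- Programs.  In `cond` and `loop` the test succeeds if the expression is nonzero. -/
inductive Cmd where
  | skip : Cmd
  | assign (x : ℕ) (e : Expr) : Cmd
  | store (A : ℕ) (i e : Expr) : Cmd
  | seq (c₁ c₂ : Cmd) : Cmd
  | cond (e : Expr) (c₁ c₂ : Cmd) : Cmd
  | loop (e : Expr) (c : Cmd) : Cmd

/-- The contents of the scalar variables and of the arrays. -/
structure State where
  var : ℕ → ℕ
  arr : ℕ → ℕ → ℕ

/-- Change the variable `x` to `v`. -/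
def State.setVar (s : State) (x v : ℕ) : State :=
  { s with var := Function.update s.var x v }

/-- Change the cell `i` of the array `A` to `v`. -/
def State.setArr (s : State) (A i v : ℕ) : State :=
  { s with arr := Function.update s.arr A (Function.update (s.arr A) i v) }

/-- The number `v` as a word, if it fits. -/
def word (B v : ℕ) : Option ℕ := if v ≤ B then some v else none

/-- Value of an expression; `none` if some intermediate value does not fit into a word.
Subtraction is truncated at zero; comparisons return `1` for true and `0` for false. -/
def Expr.eval (B : ℕ) (s : State) : Expr → Option ℕ
  | .lit m => word B m
  | .var x => word B (s.var x)
  | .arr A i => (i.eval B s).bind fun a => word B (s.arr A a)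
  | .add a b => (a.eval B s).bind fun x => (b.eval B s).bind fun y => word B (x + y)
  | .sub a b => (a.eval B s).bind fun x => (b.eval B s).bind fun y => word B (x - y)
  | .mul a b => (a.eval B s).bind fun x => (b.eval B s).bind fun y => word B (x * y)
  | .lt a b => (a.eval B s).bind fun x => (b.eval B s).bind fun y =>
      word B (if x < y then 1 else 0)
  | .eq a b => (a.eval B s).bind fun x => (b.eval B s).bind fun y =>
      word B (if x = y then 1 else 0)

/-- Number of steps for evaluating an expression: one per node. -/
def Expr.cost : Expr → ℕ
  | .lit _ => 1
  | .var _ => 1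
  | .arr _ i => i.cost + 1
  | .add a b => a.cost + b.cost + 1
  | .sub a b => a.cost + b.cost + 1
  | .mul a b => a.cost + b.cost + 1
  | .lt a b => a.cost + b.cost + 1
  | .eq a b => a.cost + b.cost + 1

/-- `Exec B c s t s'`: on words bounded by `B`, the program `c` started in state `s` halts after
exactly `t` steps in state `s'`. -/
inductive Exec (B : ℕ) : Cmd → State → ℕ → State → Prop where
  | skip {s : State} : Exec B .skip s 1 s
  | assign {s : State} {x v : ℕ} {e : Expr} (he : e.eval B s = some v) :
      Exec B (.assign x e) s (e.cost + 1) (s.setVar x v)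
  | store {s : State} {A a v : ℕ} {i e : Expr}
      (hi : i.eval B s = some a) (he : e.eval B s = some v) :
      Exec B (.store A i e) s (i.cost + e.cost + 1) (s.setArr A a v)
  | seq {s s' s'' : State} {t t' : ℕ} {c₁ c₂ : Cmd}
      (h₁ : Exec B c₁ s t s') (h₂ : Exec B c₂ s' t' s'') :
      Exec B (.seq c₁ c₂) s (t + t') s''
  | condTrue {s s' : State} {t v : ℕ} {e : Expr} {c₁ c₂ : Cmd}
      (he : e.eval B s = some v) (hv : v ≠ 0) (h : Exec B c₁ s t s') :
      Exec B (.cond e c₁ c₂) s (e.cost + 1 + t) s'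
  | condFalse {s s' : State} {t : ℕ} {e : Expr} {c₁ c₂ : Cmd}
      (he : e.eval B s = some 0) (h : Exec B c₂ s t s') :
      Exec B (.cond e c₁ c₂) s (e.cost + 1 + t) s'
  | loopFalse {s : State} {e : Expr} {c : Cmd} (he : e.eval B s = some 0) :
      Exec B (.loop e c) s (e.cost + 1) s
  | loopTrue {s s' s'' : State} {t t' v : ℕ} {e : Expr} {c : Cmd}
      (he : e.eval B s = some v) (hv : v ≠ 0)
      (h : Exec B c s t s') (h' : Exec B (.loop e c) s' t' s'') :
      Exec B (.loop e c) s (e.cost + 1 + t + t') s''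

end WordRAM

/-! ### Single-machine scheduling with an external resource -/

/-- Input data of `1|er|∑ w_j C_j`: `n` jobs (numbered from `0`, in no particular order) with
processing times `p` and weights `w`, the set `R` of jobs that need the external resource, and the
budget `K` for the length of the renting period. -/
structure ERInstance where
  n : ℕ
  p : Fin n → ℕ
  w : Fin n → ℕ
  R : Finset (Fin n)
  K : ℕ

namespace ERInstance

variable (I : ERInstance)

/-- Total processing time. -/
def P : ℕ := ∑ j, I.p j

/-- Total weight. -/
def W : ℕ := ∑ j, I.w j

/-- Completion time of job `j` under the sequence `σ`, where `σ i` is the job in position `i`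
and jobs are processed from time `0` on without idle time. -/
def completion (σ : Equiv.Perm (Fin I.n)) (j : Fin I.n) : ℕ :=
  ∑ i ∈ Finset.univ.filter (fun i => i ≤ σ.symm j), I.p (σ i)

/-- Length of the renting period: `max_{j ∈ R} C_j - min_{j ∈ R} (C_j - p_j)`, and `0` if no job
needs the resource.  Neither subtraction is ever truncated. -/
def rentLength (σ : Equiv.Perm (Fin I.n)) : ℕ :=
  if h : I.R.Nonempty then
    I.R.sup' h (fun j => I.completion σ j) - I.R.inf' h (fun j => I.completion σ j - I.p j)
  else 0

/-- Total weighted completion time. -/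
def twc (σ : Equiv.Perm (Fin I.n)) : ℕ := ∑ j, I.w j * I.completion σ j

/-- The sequence respects the renting budget. -/
def Feasible (σ : Equiv.Perm (Fin I.n)) : Prop := I.rentLength σ ≤ I.K

/-- The sequence minimizes the total weighted completion time among all feasible ones. -/
def Optimal (σ : Equiv.Perm (Fin I.n)) : Prop :=
  I.Feasible σ ∧ ∀ τ : Equiv.Perm (Fin I.n), I.Feasible τ → I.twc σ ≤ I.twc τ

/-- Input convention: variables `0` and `1` hold `n` and `K`; cell `j < n` of the arrays `0`, `1`
and `2` holds `p_j`, `w_j` and the indicator of `j ∈ R`.  Everything else is `0`. -/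
def input : WordRAM.State where
  var x := if x = 0 then I.n else if x = 1 then I.K else 0
  arr A j :=
    if h : j < I.n then
      if A = 0 then I.p ⟨j, h⟩
      else if A = 1 then I.w ⟨j, h⟩
      else if A = 2 then (if (⟨j, h⟩ : Fin I.n) ∈ I.R then 1 else 0)
      else 0
    else 0

/-- Output convention: if there is a feasible sequence, then variable `2` is `1` and the cells
`0, …, n - 1` of array `3` list the jobs of an optimal sequence in order; otherwise variable `2`
is `0`. -/
def Solved (s : WordRAM.State) : Prop :=
  (s.var 2 = 1 ∧ ∃ σ : Equiv.Perm (Fin I.n), I.Optimal σ ∧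
      ∀ i : Fin I.n, s.arr 3 (i : ℕ) = (σ i : ℕ)) ∨
  (s.var 2 = 0 ∧ ¬ ∃ σ : Equiv.Perm (Fin I.n), I.Feasible σ)

end ERInstance

/-!
Let the jobs be numbered in Smith's order, by nonincreasing ratio `w / p`.  A sequence splits into
the jobs before, in and after its renting period; let `M` be the jobs in the middle.  Its cost
exceeds that of Smith's order by `p j * w i - p i * w j ≥ 0` for every inverted pair `i < j`.  If
`M` is kept together as one block, then nothing is lost by sorting each of the three parts and by
moving every other job before or after the block according to how its ratio compares with that of
the block.  Hence some optimal sequence is given by `M` and a threshold `k`: jobs outside `M` come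
first if their number is below `k` and last otherwise (`exists_thresholdPen_le`), and only
inversions between `M` and its complement cost anything.  Feasibility means that `M` contains all
jobs that need the resource and that its total processing time is at most `K`.

For fixed `k`, the inversions on the two sides of the threshold are independent
(`thresholdPen_eq`), so there is one dynamic program per side; it walks over the jobs from the
outside inwards and decides which of them join `M` (`sideDP`).  An inverted pair consists of an
inner job left out and an outer job in `M`.  Its charge therefore needs the total processing time
`m` and the total weight of the jobs put in so far.  If `W < P`, both are kept in the state
`(m, q)`.  Otherwise the weight is avoided: a job put in pays its weight times the processing time
that is still to be left out after it, and this time is `Q - q` for a guess made at the start, to be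
confirmed at the end.  In both cases there are `O(P * min P W)` states per layer.  Since a single
charge can be negative while words cannot, every item also costs the constant `W * P * p j`; these
constants add up to `W * P * P` on every path that is compared, so they do not affect the minimum
(`sideDP_cS`, `Prepared.cS_add`).  One table per side serves all thresholds, because a table holds
the values for all prefixes of its side.  `Prepared.exists_entries` and
`Prepared.feasible_of_attains` say that the best combination of two entries is the optimum.

For each threshold, the two tables are combined, with `K` replaced by `min K P`, by a single pass
over the budget `c` of the far side, which maintains the best far-side entry with `m ≤ c` and
pairs it with the near-side entries of `m = K - c`; the whole search thus takes time linear in the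
size of the tables (`combineC_tri`).

The program is verified with the triples `Tri X F c s Q`, in which a run of `c` takes at most `F`
steps per node of `c` and leaves all numbers at most `X`.  The loop rule `Tri.for` multiplies `F`
by the number of iterations, and the variables and arrays that a program does not write are kept
automatically (`Exec.frame`).
-/

/-! ### A program logic for the word RAM -/

namespace WordRAM

/-- Value of an expression when words are unbounded. -/
def Expr.val (s : State) : Expr → ℕ
  | .lit m => m
  | .var x => s.var x
  | .arr A i => s.arr A (i.val s)
  | .add a b => a.val s + b.val s
  | .sub a b => a.val s - b.val s
  | .mul a b => a.val s * b.val s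
  | .lt a b => if a.val s < b.val s then 1 else 0
  | .eq a b => if a.val s = b.val s then 1 else 0

/-- An exponent `d` such that every value met while evaluating the expression is at most `X ^ d`
if the state holds only numbers up to `X`. -/
def Expr.deg : Expr → ℕ
  | .lit m => m
  | .var _ => 1
  | .arr _ i => max 1 i.deg
  | .add a b => max a.deg b.deg + 1
  | .sub a b => max a.deg b.deg
  | .mul a b => a.deg + b.deg
  | .lt a b => max a.deg b.deg
  | .eq a b => max a.deg b.deg

/-- All variables and array cells are at most `X`. -/
def State.Bounded (X : ℕ) (s : State) : Prop := (∀ x, s.var x ≤ X) ∧ ∀ A i, s.arr A i ≤ X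

theorem Expr.val_le {X : ℕ} (hX : 2 ≤ X) {s : State} (hs : s.Bounded X) (e : Expr) :
    e.val s ≤ X ^ e.deg := by
  have mono : ∀ {a b : ℕ}, a ≤ b → X ^ a ≤ X ^ b := fun h => Nat.pow_le_pow_right (by omega) h
  have one : ∀ a : ℕ, 1 ≤ X ^ a := fun a => Nat.one_le_pow _ _ (by omega)
  induction e with
  | lit m => exact (Nat.lt_two_pow_self).le.trans (Nat.pow_le_pow_left hX m)
  | var x => simpa [Expr.val, Expr.deg] using hs.1 x
  | arr A i ih =>
    have h := mono (le_max_left 1 i.deg)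
    rw [pow_one] at h
    exact (hs.2 A _).trans h
  | add a b iha ihb =>
    have h1 := iha.trans (mono (le_max_left a.deg b.deg))
    have h2 := ihb.trans (mono (le_max_right a.deg b.deg))
    simp only [Expr.val, Expr.deg, pow_succ]
    nlinarith [one (max a.deg b.deg)]
  | sub a b iha ihb =>
    exact (Nat.sub_le _ _).trans (iha.trans (mono (le_max_left a.deg b.deg)))
  | mul a b iha ihb =>
    simp only [Expr.val, Expr.deg, pow_add]
    exact Nat.mul_le_mul iha ihb
  | lt a b => simp only [Expr.val]; split <;> first | exact one _ | exact Nat.zero_le _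
  | eq a b => simp only [Expr.val]; split <;> first | exact one _ | exact Nat.zero_le _

theorem Expr.eval_eq {X D : ℕ} (hX : 2 ≤ X) {s : State} (hs : s.Bounded X) (e : Expr)
    (he : e.deg ≤ D) : e.eval (X ^ D) s = some (e.val s) := by
  have key : ∀ e : Expr, e.deg ≤ D → word (X ^ D) (e.val s) = some (e.val s) := fun e h => by
    rw [word, if_pos ((e.val_le hX hs).trans (Nat.pow_le_pow_right (by omega) h))]
  have hw := key e he
  induction e with
  | lit m => exact hw
  | var x => exact hw
  | arr A i ih =>
    have hi : i.deg ≤ D := (le_max_right _ _).trans he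
    simp only [Expr.eval, ih hi (key i hi), Option.bind_some]
    exact hw
  | mul a b iha ihb =>
    have ha : a.deg ≤ D := (Nat.le_add_right _ _).trans he
    have hb : b.deg ≤ D := (Nat.le_add_left _ _).trans he
    simp only [Expr.eval, iha ha (key a ha), ihb hb (key b hb), Option.bind_some]
    exact hw
  | add a b iha ihb =>
    have ha : a.deg ≤ D := (le_max_left a.deg b.deg).trans ((Nat.le_succ _).trans he)
    have hb : b.deg ≤ D := (le_max_right a.deg b.deg).trans ((Nat.le_succ _).trans he)
    simp only [Expr.eval, iha ha (key a ha), ihb hb (key b hb), Option.bind_some]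
    exact hw
  | sub a b iha ihb | lt a b iha ihb | eq a b iha ihb =>
    have ha : a.deg ≤ D := (le_max_left a.deg b.deg).trans he
    have hb : b.deg ≤ D := (le_max_right a.deg b.deg).trans he
    simp only [Expr.eval, iha ha (key a ha), ihb hb (key b hb), Option.bind_some]
    exact hw

/-- Number of steps of a run in which every node of the program is visited once. -/
def Cmd.size : Cmd → ℕ
  | .skip => 1
  | .assign _ e => e.cost + 1
  | .store _ i e => i.cost + e.cost + 1
  | .seq a b => a.size + b.size
  | .cond e a b => e.cost + 1 + (a.size + b.size)
  | .loop e a => e.cost + 1 + a.size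

/-- The variables a program assigns to. -/
def Cmd.wv : Cmd → List ℕ
  | .skip => []
  | .assign x _ => [x]
  | .store _ _ _ => []
  | .seq a b => a.wv ++ b.wv
  | .cond _ a b => a.wv ++ b.wv
  | .loop _ a => a.wv

/-- The arrays a program stores into. -/
def Cmd.wa : Cmd → List ℕ
  | .skip => []
  | .assign _ _ => []
  | .store A _ _ => [A]
  | .seq a b => a.wa ++ b.wa
  | .cond _ a b => a.wa ++ b.wa
  | .loop _ a => a.wa

/-- `s'` differs from `s` at most in the variables `xs` and the arrays `As`. -/
def Frame (xs As : List ℕ) (s s' : State) : Prop :=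
  (∀ x, x ∉ xs → s'.var x = s.var x) ∧ ∀ A, A ∉ As → s'.arr A = s.arr A

theorem Frame.refl (xs As : List ℕ) (s : State) : Frame xs As s s :=
  ⟨fun _ _ => rfl, fun _ _ => rfl⟩

theorem Frame.trans {xs As : List ℕ} {s s' s'' : State} (h : Frame xs As s s')
    (h' : Frame xs As s' s'') : Frame xs As s s'' :=
  ⟨fun x hx => (h'.1 x hx).trans (h.1 x hx), fun A hA => (h'.2 A hA).trans (h.2 A hA)⟩

theorem Frame.mono {xs As ys Bs : List ℕ} {s s' : State} (h : Frame xs As s s')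
    (hx : xs ⊆ ys) (hA : As ⊆ Bs) : Frame ys Bs s s' :=
  ⟨fun x hx' => h.1 x fun m => hx' (hx m), fun A hA' => h.2 A fun m => hA' (hA m)⟩

theorem Frame.below {xs As : List ℕ} {s s' : State} (h : Frame xs As s s') {a b : ℕ}
    (hx : ∀ x ∈ xs, a ≤ x) (hA : ∀ A ∈ As, b ≤ A) :
    (∀ x < a, s'.var x = s.var x) ∧ ∀ A < b, s'.arr A = s.arr A :=
  ⟨fun x hlt => h.1 x fun hm => (hx x hm).not_gt hlt,
    fun A hlt => h.2 A fun hm => (hA A hm).not_gt hlt⟩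

theorem Exec.frame {B t : ℕ} {c : Cmd} {s s' : State} (h : Exec B c s t s') :
    Frame c.wv c.wa s s' := by
  induction h with
  | skip => exact Frame.refl _ _ _
  | assign _ =>
    refine ⟨fun x hx => ?_, fun _ _ => rfl⟩
    simp only [Cmd.wv, List.mem_singleton] at hx
    simp [State.setVar, Function.update_of_ne hx]
  | store _ _ =>
    refine ⟨fun _ _ => rfl, fun A hA => ?_⟩
    simp only [Cmd.wa, List.mem_singleton] at hA
    simp [State.setArr, Function.update_of_ne hA]
  | seq _ _ ih ih' =>
    exact (ih.mono (by simp [Cmd.wv]) (by simp [Cmd.wa])).trans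
      (ih'.mono (by simp [Cmd.wv]) (by simp [Cmd.wa]))
  | condTrue _ _ _ ih => exact ih.mono (by simp [Cmd.wv]) (by simp [Cmd.wa])
  | condFalse _ _ ih => exact ih.mono (by simp [Cmd.wv]) (by simp [Cmd.wa])
  | loopFalse _ => exact Frame.refl _ _ _
  | loopTrue _ _ _ _ ih ih' => exact ih.trans ih'

/-- Total correctness with a time bound: started in a state with numbers up to `X`, the program
halts in a state that again holds only numbers up to `X` and satisfies `Q`; it uses words up to
`X ^ 20` and visits each of its nodes at most `F` times on average. -/
def Tri (X F : ℕ) (c : Cmd) (s : State) (Q : State → Prop) : Prop :=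
  s.Bounded X → ∃ t s', Exec (X ^ 20) c s t s' ∧ t ≤ c.size * F ∧ s'.Bounded X ∧ Q s'

theorem State.Bounded.setVar {X x v : ℕ} {s : State} (h : s.Bounded X) (hv : v ≤ X) :
    (s.setVar x v).Bounded X := by
  refine ⟨fun y => ?_, h.2⟩
  by_cases hy : y = x
  · subst hy; simpa [State.setVar] using hv
  · simpa [State.setVar, Function.update_of_ne hy] using h.1 y

theorem State.Bounded.setArr {X A a v : ℕ} {s : State} (h : s.Bounded X) (hv : v ≤ X) :
    (s.setArr A a v).Bounded X := by
  refine ⟨h.1, fun A' i => ?_⟩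
  by_cases hA : A' = A
  · subst hA
    by_cases hi : i = a
    · subst hi; simpa [State.setArr] using hv
    · simpa [State.setArr, Function.update_of_ne hi] using h.2 A' i
  · simpa [State.setArr, Function.update_of_ne hA] using h.2 A' i

@[simp] theorem State.setVar_var (s : State) (x v y : ℕ) :
    (s.setVar x v).var y = if y = x then v else s.var y := by
  simp [State.setVar, Function.update_apply]

@[simp] theorem State.setVar_arr (s : State) (x v : ℕ) : (s.setVar x v).arr = s.arr := rfl

@[simp] theorem State.setArr_var (s : State) (A a v : ℕ) : (s.setArr A a v).var = s.var := rfl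

@[simp] theorem State.setArr_arr (s : State) (A a v A' : ℕ) :
    (s.setArr A a v).arr A' = if A' = A then Function.update (s.arr A) a v else s.arr A' := by
  by_cases h : A' = A
  · subst h; simp [State.setArr]
  · simp [State.setArr, h]

theorem Tri.mono {X F F' : ℕ} {c : Cmd} {s : State} {Q Q' : State → Prop}
    (h : Tri X F c s Q) (hF : F ≤ F') (hQ : ∀ s', Q s' → Q' s') : Tri X F' c s Q' := by
  intro hs
  obtain ⟨t, s', h1, h2, h3, h4⟩ := h hs
  exact ⟨t, s', h1, h2.trans (Nat.mul_le_mul_left _ hF), h3, hQ s' h4⟩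

theorem Tri.framed {X F : ℕ} {c : Cmd} {s : State} {Q : State → Prop}
    (h : Tri X F c s Q) : Tri X F c s (fun s' => Q s' ∧ Frame c.wv c.wa s s') := by
  intro hs
  obtain ⟨t, s', h1, h2, h3, h4⟩ := h hs
  exact ⟨t, s', h1, h2, h3, h4, h1.frame⟩

theorem Tri.seq {X F : ℕ} {c c' : Cmd} {s : State} {Q : State → Prop}
    (h : Tri X F c s (fun s' => Tri X F c' s' Q)) : Tri X F (.seq c c') s Q := by
  intro hs
  obtain ⟨t, s', h1, h2, h3, h4⟩ := h hs
  obtain ⟨t', s'', k1, k2, k3, k4⟩ := h4 h3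
  exact ⟨t + t', s'', .seq h1 k1, by simp only [Cmd.size, add_mul]; omega, k3, k4⟩

/-- Every expression of the program stays below `X ^ 20` on states with numbers up to `X`. -/
def Cmd.degOK : Cmd → Bool
  | .skip => true
  | .assign _ e => e.deg ≤ 20
  | .store _ i e => i.deg ≤ 20 && e.deg ≤ 20
  | .seq a b => a.degOK && b.degOK
  | .cond e a b => e.deg ≤ 20 && a.degOK && b.degOK
  | .loop e a => e.deg ≤ 20 && a.degOK

/-- Weakest precondition of a loop-free program. -/
def Cmd.wp (X : ℕ) : Cmd → (State → Prop) → State → Prop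
  | .skip, Q, s => Q s
  | .assign x e, Q, s => e.val s ≤ X ∧ Q (s.setVar x (e.val s))
  | .store A i e, Q, s => e.val s ≤ X ∧ Q (s.setArr A (i.val s) (e.val s))
  | .seq a b, Q, s => a.wp X (b.wp X Q) s
  | .cond e a b, Q, s => if e.val s ≠ 0 then a.wp X Q s else b.wp X Q s
  | .loop _ _, _, _ => False

/-- A loop-free program with small expressions meets its weakest precondition, each node being
visited at most once. -/
theorem Tri.of_wp {X : ℕ} (hX : 2 ≤ X) {c : Cmd} {s : State} {Q : State → Prop}
    (hc : c.degOK = true) (h : s.Bounded X → c.wp X Q s) : Tri X 1 c s Q := by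
  induction c generalizing s Q with
  | skip => exact fun hs => ⟨1, s, .skip, le_rfl, hs, h hs⟩
  | assign x e =>
    intro hs
    simp only [Cmd.degOK, decide_eq_true_eq] at hc
    exact ⟨_, _, .assign (e.eval_eq hX hs hc), by simp [Cmd.size], hs.setVar (h hs).1, (h hs).2⟩
  | store A i e =>
    intro hs
    simp only [Cmd.degOK, Bool.and_eq_true, decide_eq_true_eq] at hc
    exact ⟨_, _, .store (i.eval_eq hX hs hc.1) (e.eval_eq hX hs hc.2), by simp [Cmd.size],
      hs.setArr (h hs).1, (h hs).2⟩
  | seq a b iha ihb =>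
    simp only [Cmd.degOK, Bool.and_eq_true] at hc
    refine Tri.seq (iha hc.1 fun hs => ?_)
    have h' := h hs
    simp only [Cmd.wp] at h'
    have mono : ∀ (c : Cmd) (Q Q' : State → Prop) (s : State), (∀ s, Q s → Q' s) →
        c.wp X Q s → c.wp X Q' s := by
      intro c
      induction c with
      | skip => exact fun Q Q' s hQ h => hQ _ h
      | assign x e => exact fun Q Q' s hQ h => ⟨h.1, hQ _ h.2⟩
      | store A i e => exact fun Q Q' s hQ h => ⟨h.1, hQ _ h.2⟩
      | seq a b iha ihb => exact fun Q Q' s hQ h => iha _ _ _ (fun s => ihb _ _ _ hQ) h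
      | cond e a b iha ihb =>
        intro Q Q' s hQ h
        simp only [Cmd.wp] at h ⊢
        split at h
        · rename_i h0; rw [if_pos h0]; exact iha _ _ _ hQ h
        · rename_i h0; rw [if_neg h0]; exact ihb _ _ _ hQ h
      | loop e a => exact fun Q Q' s hQ h => h.elim
    exact mono a _ _ s (fun s' h => ihb hc.2 fun _ => h) h'
  | cond e a b iha ihb =>
    intro hs
    have h' := h hs
    simp only [Cmd.degOK, Bool.and_eq_true, decide_eq_true_eq] at hc
    simp only [Cmd.wp] at h'
    split at h'
    · rename_i h0
      obtain ⟨t, s', h1, h2, h3, h4⟩ := iha hc.1.2 (fun _ => h') hs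
      exact ⟨_, s', .condTrue (e.eval_eq hX hs hc.1.1) h0 h1,
        by simp only [Cmd.size]; omega, h3, h4⟩
    · rename_i h0
      obtain ⟨t, s', h1, h2, h3, h4⟩ := ihb hc.2 (fun _ => h') hs
      have := e.eval_eq hX hs hc.1.1
      rw [not_not.mp h0] at this
      exact ⟨_, s', .condFalse this h1, by simp only [Cmd.size]; omega, h3, h4⟩
  | loop e a => exact fun hs => (h hs).elim

theorem Tri.wp {X F : ℕ} (hX : 2 ≤ X) (hF : 1 ≤ F) {c : Cmd} {s : State} {Q : State → Prop}
    (hc : c.degOK = true) (h : s.Bounded X → c.wp X Q s) : Tri X F c s Q :=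
  (Tri.of_wp hX hc h).mono hF fun _ h => h

/-- A branch whose alternatives may contain loops. -/
theorem Tri.cond {X F : ℕ} (hX : 2 ≤ X) (hF : 1 ≤ F) {e : Expr} {a b : Cmd} {s : State}
    {Q : State → Prop} (he : e.deg ≤ 20) (h1 : e.val s ≠ 0 → Tri X F a s Q)
    (h0 : e.val s = 0 → Tri X F b s Q) : Tri X F (.cond e a b) s Q := by
  intro hs
  by_cases h : e.val s = 0
  · obtain ⟨t, s', k1, k2, k3, k4⟩ := h0 h hs
    have := e.eval_eq hX hs he
    rw [h] at this
    refine ⟨_, s', .condFalse this k1, ?_, k3, k4⟩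
    simp only [Cmd.size]; nlinarith
  · obtain ⟨t, s', k1, k2, k3, k4⟩ := h1 h hs
    refine ⟨_, s', .condTrue (e.eval_eq hX hs he) h k1, ?_, k3, k4⟩
    simp only [Cmd.size]; nlinarith

/-- `for x = 0, …, h - 1 do c`, where `h` is a variable. -/
def forC (x h : ℕ) (c : Cmd) : Cmd :=
  .seq (.assign x (.lit 0))
    (.loop (.lt (.var x) (.var h)) (.seq c (.assign x (.add (.var x) (.lit 1)))))

/-- Rule for counting loops.  What the body does not write is kept automatically. -/
theorem Tri.for {X F H x h : ℕ} (hX : 2 ≤ X) {c : Cmd} {s : State} {Q : State → Prop}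
    (Inv : ℕ → State → Prop) (hx : x ∉ c.wv) (hh : h ∉ c.wv) (hxh : h ≠ x) (hH : s.var h = H)
    (hF : 1 ≤ F) (h0 : Inv 0 (s.setVar x 0))
    (hs : ∀ i s', i < H → Frame (x :: c.wv) c.wa s s' → s'.var x = i → Inv i s' →
      Tri X F c s' (fun s'' => Inv (i + 1) (s''.setVar x (i + 1))))
    (hq : ∀ s', Frame (x :: c.wv) c.wa s s' → Inv H s' → Q s') :
    Tri X (F * (H + 1)) (forC x h c) s Q := by
  intro hb
  have hHX : H ≤ X := hH ▸ hb.1 h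
  have hfr : ∀ s' : State, ∀ v, Frame (x :: c.wv) c.wa s s' →
      Frame (x :: c.wv) c.wa s (s'.setVar x v) := fun s' v hf => by
    refine hf.trans ⟨fun y hy => ?_, fun _ _ => rfl⟩
    simp only [List.mem_cons, not_or] at hy
    simp [hy.1]
  have hxH : ∀ s', Frame (x :: c.wv) c.wa s s' → s'.var h = H := fun s' hf => by
    rw [hf.1 h (by simp [hh, hxh]), hH]
  -- `d` iterations are left; each costs `c.size * F` for the body and `8` for test and count.
  have main : ∀ d i s', i + d = H → s'.Bounded X → Frame (x :: c.wv) c.wa s s' →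
      s'.var x = i → Inv i s' → ∃ t s'', Exec (X ^ 20)
        (.loop (.lt (.var x) (.var h)) (.seq c (.assign x (.add (.var x) (.lit 1))))) s' t s'' ∧
        t ≤ d * (8 + c.size * F) + 4 ∧ s''.Bounded X ∧ Q s'' := by
    intro d
    induction d with
    | zero =>
      intro i s' hi hb' hf hxi hI
      have he := Expr.eval_eq (D := 20) hX hb' (.lt (.var x) (.var h)) (by simp [Expr.deg])
      obtain rfl : i = H := by omega
      simp only [Expr.val, hxH s' hf, hxi, lt_irrefl, if_false] at he
      exact ⟨_, s', .loopFalse he, by simp [Expr.cost], hb', hq s' hf hI⟩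
    | succ d ih =>
      intro i s' hi hb' hf hxi hI
      have he := Expr.eval_eq (D := 20) hX hb' (.lt (.var x) (.var h)) (by simp [Expr.deg])
      simp only [Expr.val, hxH s' hf, hxi, if_pos (show i < H by omega)] at he
      obtain ⟨t, s1, h1, h2, h3, h4⟩ := hs i s' (by omega) hf hxi hI hb'
      have hf1 := h1.frame
      have hx1 : s1.var x = i := by rw [hf1.1 x hx, hxi]
      have he1 := Expr.eval_eq (D := 20) hX h3 (.add (.var x) (.lit 1)) (by simp [Expr.deg])
      simp only [Expr.val, hx1] at he1
      have hf2 : Frame (x :: c.wv) c.wa s s1 :=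
        hf.trans (hf1.mono (List.subset_cons_self _ _) (List.Subset.refl _))
      obtain ⟨t', s2, k1, k2, k3, k4⟩ := ih (i + 1) (s1.setVar x (i + 1)) (by omega)
        (h3.setVar (by omega)) (hfr _ _ hf2) (by simp) h4
      refine ⟨_, s2, .loopTrue he one_ne_zero (.seq h1 (.assign he1)) k1, ?_, k3, k4⟩
      simp only [Expr.cost, add_mul]
      omega
  obtain ⟨t, s', h1, h2, h3, h4⟩ := main H 0 (s.setVar x 0) (by omega)
    (hb.setVar (Nat.zero_le _)) (hfr s 0 (Frame.refl _ _ _)) (by simp) h0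
  have he := Expr.eval_eq (D := 20) hX hb (.lit 0) (by simp [Expr.deg])
  refine ⟨_, s', .seq (.assign he) h1, ?_, h3, h4⟩
  simp only [forC, Cmd.size, Expr.cost]
  have h5 : H * 1 ≤ H * F := Nat.mul_le_mul_left _ hF
  have e1 : H * (8 + c.size * F) = 8 * H + H * F * c.size := by ring
  have e2 : (1 + 1 + (1 + 1 + 1 + 1 + (c.size + (1 + 1 + 1 + 1)))) * (F * (H + 1))
      = 10 * (H * F) + 10 * F + H * F * c.size + c.size * F := by ring
  rw [e1] at h2
  rw [e2]
  have : 0 ≤ c.size * F := Nat.zero_le _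
  omega

/-- A loop inside a longer program: the loop rule with a looser time bound. -/
theorem Tri.for_le {X F G H x h : ℕ} (hX : 2 ≤ X) {c : Cmd} {s : State} {Q : State → Prop}
    (Inv : ℕ → State → Prop) (hx : x ∉ c.wv) (hh : h ∉ c.wv) (hxh : h ≠ x) (hH : s.var h = H)
    (hF : 1 ≤ F) (hG : F * (H + 1) ≤ G) (h0 : Inv 0 (s.setVar x 0))
    (hs : ∀ i s', i < H → Frame (x :: c.wv) c.wa s s' → s'.var x = i → Inv i s' →
      Tri X F c s' (fun s'' => Inv (i + 1) (s''.setVar x (i + 1))))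
    (hq : ∀ s', Frame (x :: c.wv) c.wa s s' → Inv H s' → Q s') :
    Tri X G (forC x h c) s Q :=
  (Tri.for hX Inv hx hh hxh hH hF h0 hs hq).mono hG fun _ h => h

end WordRAM

/-! ### The dynamic program -/

/-- A dynamic program over in-or-out decisions for the items `0, 1, …`.  Its states are pairs
`(m, q)`: an item `j` that is put in adds `p j` to `m` and `din j` to `q` and costs `cin j m q`; an
item that is left out adds `dout j` to `q` and costs `cout j m q`.  Items with `r j ≠ 0` must be put
in.  The start states are `(0, q)` with `q ≤ e`. -/
structure DP where
  p : ℕ → ℕ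
  din : ℕ → ℕ
  dout : ℕ → ℕ
  r : ℕ → ℕ
  cin : ℕ → ℕ → ℕ → ℕ
  cout : ℕ → ℕ → ℕ → ℕ
  e : ℕ

namespace DP

variable (D : DP)

/-- The minimum of two numbers, where `0` stands for infinity. -/
def better (a b : ℕ) : ℕ := if b ≠ 0 ∧ (a = 0 ∨ b < a) then b else a

/-- The value of leaving item `j` out and thereby reaching `(m, q)`, from the values `t` of the
previous layer. -/
def outVal (t : ℕ → ℕ → ℕ) (j m q : ℕ) : ℕ :=
  if D.r j = 0 ∧ D.dout j ≤ q ∧ t m (q - D.dout j) ≠ 0 then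
    t m (q - D.dout j) + D.cout j m (q - D.dout j) else 0

/-- The value of putting item `j` in and thereby reaching `(m, q)`. -/
def inVal (t : ℕ → ℕ → ℕ) (j m q : ℕ) : ℕ :=
  if D.p j ≤ m ∧ D.din j ≤ q ∧ t (m - D.p j) (q - D.din j) ≠ 0 then
    t (m - D.p j) (q - D.din j) + D.cin j (m - D.p j) (q - D.din j) else 0

/-- `T j m q` is `0` if no admissible decisions for the first `j` items lead to the state `(m, q)`,
and one more than the least cost of such decisions otherwise. -/
def T : ℕ → ℕ → ℕ → ℕ
  | 0, m, q => if m = 0 ∧ q ≤ D.e then 1 else 0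
  | j + 1, m, q => better (D.outVal (T j) j m q) (D.inVal (T j) j m q)

/-- First state component after the decisions `M` (`true` for in) on the first `k` items. -/
def mS (M : ℕ → Bool) (k : ℕ) : ℕ := ∑ i ∈ Finset.range k, if M i then D.p i else 0

/-- Second state component after the decisions `M` on the first `k` items, from `q₀` on. -/
def qS (M : ℕ → Bool) (q₀ k : ℕ) : ℕ :=
  q₀ + ∑ i ∈ Finset.range k, if M i then D.din i else D.dout i

/-- Cost of the decisions `M` on the first `k` items. -/
def cS (M : ℕ → Bool) (q₀ k : ℕ) : ℕ :=
  ∑ i ∈ Finset.range k,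
    if M i then D.cin i (D.mS M i) (D.qS M q₀ i) else D.cout i (D.mS M i) (D.qS M q₀ i)

theorem mS_succ (M : ℕ → Bool) (k : ℕ) :
    D.mS M (k + 1) = D.mS M k + if M k then D.p k else 0 := Finset.sum_range_succ _ _

theorem qS_succ (M : ℕ → Bool) (q₀ k : ℕ) :
    D.qS M q₀ (k + 1) = D.qS M q₀ k + if M k then D.din k else D.dout k := by
  rw [qS, Finset.sum_range_succ, ← add_assoc]; rfl

theorem cS_succ (M : ℕ → Bool) (q₀ k : ℕ) :
    D.cS M q₀ (k + 1) = D.cS M q₀ k +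
      if M k then D.cin k (D.mS M k) (D.qS M q₀ k) else D.cout k (D.mS M k) (D.qS M q₀ k) :=
  Finset.sum_range_succ _ _

theorem mS_mono (M : ℕ → Bool) {j k : ℕ} (h : j ≤ k) : D.mS M j ≤ D.mS M k :=
  Finset.sum_le_sum_of_subset (Finset.range_subset_range.2 h)

theorem qS_mono (M : ℕ → Bool) (q₀ : ℕ) {j k : ℕ} (h : j ≤ k) : D.qS M q₀ j ≤ D.qS M q₀ k :=
  Nat.add_le_add_left (Finset.sum_le_sum_of_subset (Finset.range_subset_range.2 h)) _

theorem better_le_left {a b : ℕ} (h : a ≠ 0) : better a b ≠ 0 ∧ better a b ≤ a := by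
  unfold better; split <;> omega

theorem better_le_right {a b : ℕ} (h : b ≠ 0) : better a b ≠ 0 ∧ better a b ≤ b := by
  unfold better; split <;> omega

theorem better_eq (a b : ℕ) : better a b = a ∨ better a b = b := by
  unfold better; split <;> simp

/-- The table is a lower bound for the cost of all admissible decisions. -/
theorem T_le {M : ℕ → Bool} {q₀ : ℕ} (hq : q₀ ≤ D.e) {k : ℕ}
    (hM : ∀ i < k, D.r i ≠ 0 → M i = true) :
    D.T k (D.mS M k) (D.qS M q₀ k) ≠ 0 ∧ D.T k (D.mS M k) (D.qS M q₀ k) ≤ D.cS M q₀ k + 1 := by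
  induction k with
  | zero => simp [T, mS, qS, cS, hq]
  | succ k ih =>
    obtain ⟨h1, h2⟩ := ih fun i hi => hM i (by omega)
    rw [mS_succ, qS_succ, cS_succ, T]
    by_cases hk : M k
    · simp only [hk, if_true]
      have : D.inVal (D.T k) k (D.mS M k + D.p k) (D.qS M q₀ k + D.din k) =
          D.T k (D.mS M k) (D.qS M q₀ k) + D.cin k (D.mS M k) (D.qS M q₀ k) := by
        simp [inVal, h1]
      rw [this]
      obtain ⟨h3, h4⟩ := better_le_right
        (a := D.outVal (D.T k) k (D.mS M k + D.p k) (D.qS M q₀ k + D.din k))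
        (b := D.T k (D.mS M k) (D.qS M q₀ k) + D.cin k (D.mS M k) (D.qS M q₀ k)) (by omega)
      exact ⟨h3, by omega⟩
    · have hr : D.r k = 0 := by
        by_contra h; exact hk (hM k (by omega) h)
      simp only [hk, Bool.false_eq_true, if_false, add_zero]
      have : D.outVal (D.T k) k (D.mS M k) (D.qS M q₀ k + D.dout k) =
          D.T k (D.mS M k) (D.qS M q₀ k) + D.cout k (D.mS M k) (D.qS M q₀ k) := by
        simp [outVal, h1, hr]
      rw [this]
      obtain ⟨h3, h4⟩ := better_le_left
        (b := D.inVal (D.T k) k (D.mS M k) (D.qS M q₀ k + D.dout k))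
        (a := D.T k (D.mS M k) (D.qS M q₀ k) + D.cout k (D.mS M k) (D.qS M q₀ k)) (by omega)
      exact ⟨h3, by omega⟩

/-- The decisions `M` are admissible for the first `k` items and attain the table entry at
`(m, q)`. -/
def Attains (M : ℕ → Bool) (q₀ k m q : ℕ) : Prop :=
  q₀ ≤ D.e ∧ D.mS M k = m ∧ D.qS M q₀ k = q ∧ D.cS M q₀ k + 1 = D.T k m q ∧
    ∀ i < k, D.r i ≠ 0 → M i = true

/-- Leaving item `j` out attains the entry of layer `j + 1` at `(m, q)`. -/
def OutOK (j m q : ℕ) : Prop :=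
  D.r j = 0 ∧ D.dout j ≤ q ∧ D.T j m (q - D.dout j) ≠ 0 ∧
    D.T j m (q - D.dout j) + D.cout j m (q - D.dout j) = D.T (j + 1) m q

variable {D}

theorem Attains.zero {M : ℕ → Bool} {m q : ℕ} (h : D.T 0 m q ≠ 0) : D.Attains M q 0 m q := by
  have h' : m = 0 ∧ q ≤ D.e := by
    by_contra hc; exact h (by rw [T, if_neg hc])
  exact ⟨h'.2, by simp [mS, h'.1], by simp [qS], by simp [cS, T, h'], by simp⟩

theorem Attains.succ_out {M : ℕ → Bool} {q₀ j m q : ℕ} (ho : D.OutOK j m q) (hM : M j = false)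
    (h : D.Attains M q₀ j m (q - D.dout j)) : D.Attains M q₀ (j + 1) m q := by
  obtain ⟨h1, h2, h3, h4, h5⟩ := h
  obtain ⟨o1, o2, o3, o4⟩ := ho
  refine ⟨h1, by simp [mS_succ, hM, h2], by simp [qS_succ, hM, h3]; omega, ?_, fun i hi hr => ?_⟩
  · simp only [cS_succ, hM, Bool.false_eq_true, if_false, h2, h3]; omega
  · rcases Nat.lt_succ_iff_lt_or_eq.1 hi with hi | rfl
    · exact h5 i hi hr
    · exact absurd o1 hr

theorem in_of_not_outOK {j m q : ℕ} (ho : ¬ D.OutOK j m q) (hT : D.T (j + 1) m q ≠ 0) :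
    D.p j ≤ m ∧ D.din j ≤ q ∧ D.T j (m - D.p j) (q - D.din j) ≠ 0 ∧
    D.T j (m - D.p j) (q - D.din j) + D.cin j (m - D.p j) (q - D.din j) = D.T (j + 1) m q := by
  rcases better_eq (D.outVal (D.T j) j m q) (D.inVal (D.T j) j m q) with h | h
  · refine absurd ?_ ho
    have hT' : D.outVal (D.T j) j m q = D.T (j + 1) m q := h.symm
    rw [← hT', outVal] at hT
    split at hT
    · rename_i hc
      exact ⟨hc.1, hc.2.1, hc.2.2, by rw [← hT', outVal, if_pos hc]⟩
    · exact absurd rfl hT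
  · have hT' : D.inVal (D.T j) j m q = D.T (j + 1) m q := h.symm
    rw [← hT', inVal] at hT
    split at hT
    · rename_i hc
      exact ⟨hc.1, hc.2.1, hc.2.2, by rw [← hT', inVal, if_pos hc]⟩
    · exact absurd rfl hT

theorem Attains.succ_in {M : ℕ → Bool} {q₀ j m q : ℕ} (ho : ¬ D.OutOK j m q)
    (hT : D.T (j + 1) m q ≠ 0) (hM : M j = true)
    (h : D.Attains M q₀ j (m - D.p j) (q - D.din j)) : D.Attains M q₀ (j + 1) m q := by
  obtain ⟨h1, h2, h3, h4, h5⟩ := h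
  obtain ⟨o1, o2, o3, o4⟩ := in_of_not_outOK ho hT
  refine ⟨h1, by simp [mS_succ, hM, h2]; omega, by simp [qS_succ, hM, h3]; omega, ?_,
    fun i hi hr => ?_⟩
  · simp only [cS_succ, hM, if_true, h2, h3]; omega
  · rcases Nat.lt_succ_iff_lt_or_eq.1 hi with hi | rfl
    · exact h5 i hi hr
    · exact hM

theorem outVal_le {t : ℕ → ℕ → ℕ} {j m q B C : ℕ} (ht : ∀ q' ≤ q, t m q' ≤ B)
    (hC : ∀ q' ≤ q, D.cout j m q' ≤ C) : D.outVal t j m q ≤ B + C := by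
  unfold outVal; split
  · exact Nat.add_le_add (ht _ (Nat.sub_le _ _)) (hC _ (Nat.sub_le _ _))
  · exact Nat.zero_le _

theorem inVal_le {t : ℕ → ℕ → ℕ} {j m q B C : ℕ} (ht : ∀ m' ≤ m, ∀ q' ≤ q, t m' q' ≤ B)
    (hC : ∀ m' ≤ m, ∀ q' ≤ q, D.cin j m' q' ≤ C) : D.inVal t j m q ≤ B + C := by
  unfold inVal; split
  · exact Nat.add_le_add (ht _ (Nat.sub_le _ _) _ (Nat.sub_le _ _))
      (hC _ (Nat.sub_le _ _) _ (Nat.sub_le _ _))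
  · exact Nat.zero_le _

theorem T_bound {P Q C : ℕ} (hin : ∀ j, ∀ m ≤ P, ∀ q ≤ Q, D.cin j m q ≤ C)
    (hout : ∀ j, ∀ m ≤ P, ∀ q ≤ Q, D.cout j m q ≤ C) {j m q : ℕ} (hm : m ≤ P)
    (hq : q ≤ Q) : D.T j m q ≤ 1 + j * C := by
  induction j generalizing m q with
  | zero => simp only [T]; split <;> omega
  | succ j ih =>
    rw [add_mul, one_mul, ← add_assoc, T]
    rcases better_eq (D.outVal (D.T j) j m q) (D.inVal (D.T j) j m q) with h | h <;> rw [h]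
    · exact outVal_le (fun q' h' => ih hm (h'.trans hq)) fun q' h' => hout j m hm q' (h'.trans hq)
    · exact inVal_le (fun m' hm' q' hq' => ih (hm'.trans hm) (hq'.trans hq))
        fun m' hm' q' hq' => hin j m' (hm'.trans hm) q' (hq'.trans hq)

end DP

/-- The dynamic program for one side of the renting period.  The items are the jobs on that side
of the threshold, from the outermost one inwards, with processing times `p` and weights `w`; those
put in are processed within the renting period.  Up to the constant `Y * p j` per item, the cost is
what the choice adds to the cost of the list order if the side lies before the renting period
(`fwd = true`), and after it otherwise.  For `f = 0`, the component `q` is the total weight of the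
items put in so far.  For `f = 1`, it runs up to `Q`, and `Q - q` is the total processing time
of the items that are still to be left out. -/
def sideDP (fwd : Bool) (f Q Y : ℕ) (p w r : ℕ → ℕ) : DP where
  p := p
  din j := (1 - f) * w j
  dout j := f * p j
  r := r
  cin j _ q := if fwd then Y * p j + f * w j * (Q - q) else Y * p j - f * w j * (Q - q)
  cout j m q := if fwd then Y * p j + (1 - f) * p j * q - w j * m
    else Y * p j + w j * m - (1 - f) * p j * q
  e := f * Q

/-- Sum over the items left out, among the first `k`, of what they lose or gain against the earlier
items that are put in. -/
def sidePen (p w : ℕ → ℕ) (M : ℕ → Bool) (k : ℕ) : ℤ :=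
  ∑ j ∈ Finset.range k, if M j then 0 else
    ∑ i ∈ Finset.range j, if M i then (p j * w i - p i * w j : ℤ) else 0

theorem sidePen_succ (p w : ℕ → ℕ) (M : ℕ → Bool) (k : ℕ) :
    sidePen p w M (k + 1) = sidePen p w M k + if M k then 0 else
      ((p k : ℤ) * (∑ i ∈ Finset.range k, if M i then w i else 0 : ℕ)
        - w k * (∑ i ∈ Finset.range k, if M i then p i else 0 : ℕ)) := by
  rw [sidePen, Finset.sum_range_succ, ← sidePen]
  congr 2
  push_cast
  rw [Finset.mul_sum, Finset.mul_sum, ← Finset.sum_sub_distrib]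
  refine Finset.sum_congr rfl fun i _ => ?_
  split <;> simp [mul_comm]

section side

variable {fwd : Bool} {f Q P W n : ℕ} {p w r : ℕ → ℕ} {M : ℕ → Bool} {q₀ : ℕ}

/-- The running cost of the dynamic program.  The correction term with the factor `f` is the part of
the guessed processing time that is still to come; it vanishes at the end. -/
theorem sideDP_cS_aux (hf : f = 0 ∨ f = 1) (hq₀ : f = 0 → q₀ = 0) (hQP : Q ≤ P) (hQW : Q ≤ W)
    (hp : ∀ j < n, 0 < p j) (hw : ∀ j < n, w j ≤ W) {k : ℕ} (hk : k ≤ n)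
    (hm : (sideDP fwd f Q (W * P) p w r).mS M k ≤ P)
    (hq : (sideDP fwd f Q (W * P) p w r).qS M q₀ k ≤ Q) :
    ((sideDP fwd f Q (W * P) p w r).cS M q₀ k : ℤ) =
      W * P * ∑ i ∈ Finset.range k, (p i : ℤ) + (if fwd then 1 else -1) * (sidePen p w M k +
        f * (∑ i ∈ Finset.range k, if M i then w i else 0 : ℕ) *
          (Q - (sideDP fwd f Q (W * P) p w r).qS M q₀ k)) := by
  set D := sideDP fwd f Q (W * P) p w r with hD
  induction k with
  | zero => simp [DP.cS, sidePen]
  | succ k ih =>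
    have hm' := D.mS_mono M (Nat.le_succ k)
    have hq' := D.qS_mono M q₀ (Nat.le_succ k)
    rw [DP.cS_succ, sidePen_succ, DP.qS_succ, Finset.sum_range_succ, Finset.sum_range_succ]
    have hpk := hp k (by omega)
    have hwk := hw k (by omega)
    have hqW : f = 0 → D.qS M q₀ k = ∑ i ∈ Finset.range k, if M i then w i else 0 := by
      intro h0
      rw [DP.qS, hq₀ h0, zero_add]
      refine Finset.sum_congr rfl fun i _ => ?_
      simp [hD, sideDP, h0]
    have hmd : (∑ i ∈ Finset.range k, if M i then p i else 0) = D.mS M k := rfl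
    rw [hmd]
    generalize (∑ i ∈ Finset.range k, if M i then w i else 0) = v at *
    generalize hgq : D.qS M q₀ k = q at *
    generalize hgm : D.mS M k = m at *
    have hqQ : q ≤ Q := hq'.trans hq
    have hmP : m ≤ P := hm'.trans hm
    have b1 : w k * (Q - q) ≤ W * P * p k :=
      (Nat.mul_le_mul hwk ((Nat.sub_le _ _).trans hQP)).trans (Nat.le_mul_of_pos_right _ hpk)
    have b2 : w k * m ≤ W * P * p k :=
      (Nat.mul_le_mul hwk hmP).trans (Nat.le_mul_of_pos_right _ hpk)
    have b3 : p k * q ≤ W * P * p k := by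
      rw [mul_comm]
      refine Nat.mul_le_mul_right _ ?_
      rcases Nat.eq_zero_or_pos P with h | h
      · omega
      · exact (hqQ.trans hQW).trans (Nat.le_mul_of_pos_right _ h)
    push_cast
    rw [ih (by omega) hmP hqQ]
    clear_value D
    subst hD
    rcases hf with rfl | rfl <;> cases hMk : M k <;> cases fwd
    all_goals simp [sideDP]
    all_goals try simp at hqW
    all_goals try subst hqW
    · rw [Nat.cast_sub (b3.trans (Nat.le_add_right _ _))]; push_cast; ring
    · rw [Nat.cast_sub (b2.trans (Nat.le_add_right _ _))]; push_cast; ring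
    · ring
    · ring
    · ring
    · rw [Nat.cast_sub b2]; push_cast; ring
    · rw [Nat.cast_sub b1, Nat.cast_mul (w k), Nat.cast_sub hqQ]; push_cast; ring
    · rw [Nat.cast_sub hqQ]; ring

/-- On a path that ends with `q ≤ Q`, and with `q = Q` if `f = 1` (so that the processing time left
out was guessed correctly), the cost is what the decisions change against the list order, up to the
sign of the side and a constant. -/
theorem sideDP_cS (hf : f = 0 ∨ f = 1) (hq₀ : q₀ ≤ f * Q) (hQP : Q ≤ P) (hQW : Q ≤ W)
    (hp : ∀ j < n, 0 < p j) (hw : ∀ j < n, w j ≤ W) {k : ℕ} (hk : k ≤ n)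
    (hm : (sideDP fwd f Q (W * P) p w r).mS M k ≤ P)
    (hq : (sideDP fwd f Q (W * P) p w r).qS M q₀ k ≤ Q)
    (he : f * Q ≤ (sideDP fwd f Q (W * P) p w r).qS M q₀ k) :
    ((sideDP fwd f Q (W * P) p w r).cS M q₀ k : ℤ) =
      W * P * ∑ i ∈ Finset.range k, (p i : ℤ) + (if fwd then 1 else -1) * sidePen p w M k := by
  rw [sideDP_cS_aux hf (fun h => by simpa [h] using hq₀) hQP hQW hp hw hk hm hq]
  rcases hf with rfl | rfl
  · simp
  · have : (sideDP fwd 1 Q (W * P) p w r).qS M q₀ k = Q := le_antisymm hq (by simpa using he)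
    simp [this]

/-- Every choice is found from some start state: the right guess of the processing time left out
in the case `f = 1`. -/
theorem sideDP_exists_start (hf : f = 0 ∧ (∑ i ∈ Finset.range n, w i) ≤ Q ∨
      f = 1 ∧ (∑ i ∈ Finset.range n, p i) ≤ Q) {k : ℕ} (hk : k ≤ n) (Y : ℕ) :
    ∃ q₀ ≤ f * Q, (sideDP fwd f Q Y p w r).qS M q₀ k ≤ Q ∧
      f * Q ≤ (sideDP fwd f Q Y p w r).qS M q₀ k := by
  have sub : ∀ (g : ℕ → ℕ), ∑ i ∈ Finset.range k, g i ≤ ∑ i ∈ Finset.range n, g i := fun g =>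
    Finset.sum_le_sum_of_subset (Finset.range_subset_range.2 hk)
  rcases hf with ⟨rfl, h⟩ | ⟨rfl, h⟩
  · refine ⟨0, by simp, ?_, by simp⟩
    refine le_trans ?_ ((sub w).trans h)
    simp only [DP.qS, zero_add, sideDP]
    refine Finset.sum_le_sum fun i _ => ?_
    split <;> simp
  · set a := ∑ i ∈ Finset.range k, if M i then 0 else p i with ha
    have haQ : a ≤ Q := by
      refine le_trans ?_ ((sub p).trans h)
      refine Finset.sum_le_sum fun i _ => ?_
      split <;> simp
    have : (sideDP fwd 1 Q Y p w r).qS M (Q - a) k = Q := by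
      simp only [DP.qS, sideDP, Nat.sub_self, zero_mul, one_mul]
      omega
    exact ⟨Q - a, by simp, this.le, by simp [this]⟩

theorem sideDP_cin_le {C m q j Y : ℕ} (hf : f ≤ 1) (hp : p j ≤ P) (hw : w j ≤ W) (hQ : Q ≤ P)
    (hC : Y * P + W * P + P * P ≤ C) : (sideDP fwd f Q Y p w r).cin j m q ≤ C := by
  have h1 : Y * p j ≤ Y * P := Nat.mul_le_mul_left _ hp
  have h2 : f * w j * (Q - q) ≤ W * P :=
    Nat.mul_le_mul ((Nat.mul_le_mul hf hw).trans (one_mul W).le) ((Nat.sub_le _ _).trans hQ)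
  cases fwd <;> simp only [sideDP, if_true, Bool.false_eq_true, if_false] <;> omega

theorem sideDP_cout_le {C m q j Y : ℕ} (hp : p j ≤ P) (hw : w j ≤ W) (hq : q ≤ P)
    (hm : m ≤ P) (hC : Y * P + W * P + P * P ≤ C) :
    (sideDP fwd f Q Y p w r).cout j m q ≤ C := by
  have h1 : Y * p j ≤ Y * P := Nat.mul_le_mul_left _ hp
  have h2 : (1 - f) * p j * q ≤ P * P :=
    Nat.mul_le_mul ((Nat.mul_le_mul (Nat.sub_le 1 f) hp).trans (one_mul P).le) hq
  have h3 : w j * m ≤ W * P := Nat.mul_le_mul hw hm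
  cases fwd <;> simp only [sideDP, if_true, Bool.false_eq_true, if_false] <;> omega

end side

/-! ### Positions from a strict order -/

/-- The number of `i < n` that precede `j`. -/
def rankOf (lt : ℕ → ℕ → Prop) [DecidableRel lt] (n j : ℕ) : ℕ :=
  ((Finset.range n).filter fun i => lt i j).card

/-- `lt` is a strict linear order on the numbers below `n`. -/
structure StrictBelow (lt : ℕ → ℕ → Prop) (n : ℕ) : Prop where
  irrefl : ∀ i < n, ¬ lt i i
  trans : ∀ i < n, ∀ j < n, ∀ k < n, lt i j → lt j k → lt i k
  total : ∀ i < n, ∀ j < n, i ≠ j → lt i j ∨ lt j i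

section rank

variable {lt : ℕ → ℕ → Prop} [DecidableRel lt] {n : ℕ}

theorem rankOf_lt_rankOf (h : StrictBelow lt n) {i j : ℕ} (hi : i < n) (hj : j < n)
    (hij : lt i j) : rankOf lt n i < rankOf lt n j := by
  refine Finset.card_lt_card (Finset.ssubset_iff_of_subset ?_ |>.2 ⟨i, ?_, ?_⟩)
  · intro a ha
    simp only [Finset.mem_filter, Finset.mem_range] at ha ⊢
    exact ⟨ha.1, h.trans a ha.1 i hi j hj ha.2 hij⟩
  · simp [hi, hij]
  · simp [h.irrefl i hi]

theorem rankOf_lt_iff (h : StrictBelow lt n) {i j : ℕ} (hi : i < n) (hj : j < n) :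
    rankOf lt n i < rankOf lt n j ↔ lt i j := by
  refine ⟨fun hr => ?_, rankOf_lt_rankOf h hi hj⟩
  rcases eq_or_ne i j with rfl | hne
  · exact absurd hr (lt_irrefl _)
  · rcases h.total i hi j hj hne with h' | h'
    · exact h'
    · exact absurd (rankOf_lt_rankOf h hj hi h') hr.not_gt

theorem rankOf_lt (h : StrictBelow lt n) {i : ℕ} (hi : i < n) : rankOf lt n i < n := by
  have : rankOf lt n i < (Finset.range n).card :=
    Finset.card_lt_card (Finset.ssubset_iff_of_subset (Finset.filter_subset _ _) |>.2
      ⟨i, by simpa using hi, by simp [h.irrefl i hi]⟩)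
  simpa using this

theorem rankOf_inj (h : StrictBelow lt n) {i j : ℕ} (hi : i < n) (hj : j < n)
    (hij : rankOf lt n i = rankOf lt n j) : i = j := by
  by_contra hne
  rcases h.total i hi j hj hne with h' | h'
  · exact (rankOf_lt_rankOf h hi hj h').ne hij
  · exact (rankOf_lt_rankOf h hj hi h').ne' hij

/-- The permutation that sends a number to its position in the order `lt`. -/
noncomputable def rankEquiv (h : StrictBelow lt n) : Fin n ≃ Fin n :=
  Equiv.ofBijective (fun i => ⟨rankOf lt n i, rankOf_lt h i.2⟩)
    (Finite.injective_iff_bijective.1 fun i j hij =>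
      Fin.ext (rankOf_inj h i.2 j.2 (congrArg Fin.val hij)))

theorem rankEquiv_val (h : StrictBelow lt n) (i : Fin n) :
    (rankEquiv h i : ℕ) = rankOf lt n i := rfl

end rank

/-- Smith's order: nonincreasing ratio of weight to processing time, ties broken by number. -/
def smithLt (p w : ℕ → ℕ) (i j : ℕ) : Prop :=
  w j * p i < w i * p j ∨ (w j * p i = w i * p j ∧ i < j)

instance (p w : ℕ → ℕ) : DecidableRel (smithLt p w) := fun _ _ =>
  inferInstanceAs (Decidable (_ ∨ _))

theorem smith_trans {a b c x y z : ℕ} (hy : 0 < y) (h1 : b * x ≤ a * y) (h2 : c * y ≤ b * z) :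
    c * x ≤ a * z ∧ ((b * x < a * y ∨ c * y < b * z) → 0 < x → 0 < z → c * x < a * z) := by
  constructor
  · refine Nat.le_of_mul_le_mul_right (c := y) ?_ hy
    calc c * x * y = c * y * x := by ring
      _ ≤ b * z * x := Nat.mul_le_mul_right _ h2
      _ = b * x * z := by ring
      _ ≤ a * y * z := Nat.mul_le_mul_right _ h1
      _ = a * z * y := by ring
  · intro h hx hz
    refine Nat.lt_of_mul_lt_mul_right (a := y) ?_
    rcases h with h | h
    · calc c * x * y = c * y * x := by ring
        _ ≤ b * z * x := Nat.mul_le_mul_right _ h2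
        _ = b * x * z := by ring
        _ < a * y * z := Nat.mul_lt_mul_of_pos_right h hz
        _ = a * z * y := by ring
    · calc c * x * y = c * y * x := by ring
        _ < b * z * x := Nat.mul_lt_mul_of_pos_right h hx
        _ = b * x * z := by ring
        _ ≤ a * y * z := Nat.mul_le_mul_right _ h1
        _ = a * z * y := by ring

theorem smithLt_strictBelow {p w : ℕ → ℕ} {n : ℕ} (hp : ∀ i < n, 0 < p i) :
    StrictBelow (smithLt p w) n where
  irrefl i _ h := by unfold smithLt at h; omega
  trans i hi j hj k hk h1 h2 := by
    have key := smith_trans (a := w i) (b := w j) (c := w k) (x := p i) (z := p k) (hp j hj)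
      (by unfold smithLt at h1; omega) (by unfold smithLt at h2; omega)
    unfold smithLt at *
    by_cases hs : w j * p i < w i * p j ∨ w k * p j < w j * p k
    · exact Or.inl (key.2 hs (hp i hi) (hp k hk))
    · have := key.1
      omega
  total i _ j _ hne := by unfold smithLt; omega

/-- The order of the output: first by class, then by number. -/
def classLt (c : ℕ → ℕ) (i j : ℕ) : Prop := c i < c j ∨ (c i = c j ∧ i < j)

instance (c : ℕ → ℕ) : DecidableRel (classLt c) := fun _ _ =>
  inferInstanceAs (Decidable (_ ∨ _))

theorem classLt_strictBelow (c : ℕ → ℕ) (n : ℕ) : StrictBelow (classLt c) n where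
  irrefl i _ h := by unfold classLt at h; omega
  trans i _ j _ k _ h1 h2 := by unfold classLt at *; omega
  total i _ j _ hne := by unfold classLt; omega

/-! ### Cost of a sequence in terms of inversions -/

/-- Cost of processing the jobs in the order of their numbers. -/
def baseCost (p w : ℕ → ℕ) (n : ℕ) : ℤ :=
  ∑ i ∈ Finset.range n, ∑ j ∈ Finset.range n, if i ≤ j then (p i * w j : ℤ) else 0

open Classical in
/-- Additional cost of a sequence in which exactly those pairs `i < j` with `inv i j` are
inverted. -/
noncomputable def invCost (p w : ℕ → ℕ) (n : ℕ) (inv : ℕ → ℕ → Prop) : ℤ :=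
  ∑ i ∈ Finset.range n, ∑ j ∈ Finset.range n,
    if i < j ∧ inv i j then (p j * w i - p i * w j : ℤ) else 0

theorem sum_pairs_eq (p w ρ : ℕ → ℕ) (n : ℕ) (hρ : ∀ i < n, ∀ j < n, ρ i = ρ j → i = j) :
    (∑ i ∈ Finset.range n, ∑ j ∈ Finset.range n, if ρ i ≤ ρ j then (p i * w j : ℤ) else 0) =
      baseCost p w n + invCost p w n (fun i j => ρ j < ρ i) := by
  have h1 : invCost p w n (fun i j => ρ j < ρ i) =
      (∑ i ∈ Finset.range n, ∑ j ∈ Finset.range n,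
        if j < i ∧ ρ i < ρ j then (p i * w j : ℤ) else 0) -
      ∑ i ∈ Finset.range n, ∑ j ∈ Finset.range n,
        if i < j ∧ ρ j < ρ i then (p i * w j : ℤ) else 0 := by
    rw [Finset.sum_comm (s := Finset.range n) (t := Finset.range n)
      (f := fun i j => if j < i ∧ ρ i < ρ j then (p i * w j : ℤ) else 0)]
    simp only [invCost, ← Finset.sum_sub_distrib]
    refine Finset.sum_congr rfl fun i _ => Finset.sum_congr rfl fun j _ => ?_
    split <;> simp
  rw [h1, baseCost, ← Finset.sum_sub_distrib, ← Finset.sum_add_distrib]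
  refine Finset.sum_congr rfl fun i hi => ?_
  rw [← Finset.sum_sub_distrib, ← Finset.sum_add_distrib]
  refine Finset.sum_congr rfl fun j hj => ?_
  rcases lt_trichotomy i j with h | rfl | h
  · rcases lt_or_ge (ρ j) (ρ i) with h' | h'
    · simp [h, h', h.le, h.not_gt, h'.not_ge]
    · simp [h, h', h.le, h.not_gt, h'.not_gt]
  · simp
  · have : ρ i ≠ ρ j := fun he =>
      h.ne' (hρ i (by simpa using hi) j (by simpa using hj) he)
    rcases lt_or_ge (ρ i) (ρ j) with h' | h'
    · simp [h, h', h'.le, h.not_ge, h.not_gt]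
    · simp [h, h.not_ge, h.not_gt, h'.not_gt, (lt_of_le_of_ne h' this.symm).not_ge]

/-- Additional cost of the sequence with threshold `k` and the jobs `M` in the renting period: jobs
outside `M` come before the renting period if their number is below `k`, and after it otherwise. -/
def thresholdPen (p w : ℕ → ℕ) (n k : ℕ) (M : ℕ → Bool) : ℤ :=
  ∑ j ∈ Finset.range n, if M j then 0 else
    if j < k then ∑ i ∈ Finset.range n, if i < j ∧ M i then (p j * w i - p i * w j : ℤ) else 0
    else ∑ i ∈ Finset.range n, if j < i ∧ M i then (p i * w j - p j * w i : ℤ) else 0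

/-- The part of the sequence that job `i` belongs to: before, in, or after the renting period. -/
def partOf (k : ℕ) (M : ℕ → Bool) (i : ℕ) : ℕ := if M i then 1 else if i < k then 0 else 2

theorem invCost_partOf (p w : ℕ → ℕ) (n k : ℕ) (M : ℕ → Bool) :
    invCost p w n (fun i j => classLt (partOf k M) j i) = thresholdPen p w n k M := by
  have h1 : invCost p w n (fun i j => classLt (partOf k M) j i) =
      (∑ i ∈ Finset.range n, ∑ j ∈ Finset.range n,
        if i < j ∧ M i = true ∧ M j = false ∧ j < k then (p j * w i - p i * w j : ℤ) else 0) +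
      ∑ i ∈ Finset.range n, ∑ j ∈ Finset.range n,
        if i < j ∧ M i = false ∧ M j = true ∧ k ≤ i then (p j * w i - p i * w j : ℤ) else 0 := by
    simp only [invCost, ← Finset.sum_add_distrib]
    refine Finset.sum_congr rfl fun i _ => Finset.sum_congr rfl fun j _ => ?_
    by_cases hij : i < j
    · unfold classLt partOf
      rcases Bool.eq_false_or_eq_true (M i) with hMi | hMi <;>
        rcases Bool.eq_false_or_eq_true (M j) with hMj | hMj <;>
        by_cases hi : i < k <;> by_cases hj : j < k <;>
        first | omega | simp [hij, hi, hj, hMi, hMj, hij.not_gt]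
    · simp [hij]
  rw [h1, Finset.sum_comm, ← Finset.sum_add_distrib]
  refine Finset.sum_congr rfl fun j _ => ?_
  cases hj : M j
  · by_cases hk : j < k
    · have : ¬ k ≤ j := by omega
      simp [hk, this]
    · have : k ≤ j := by omega
      simp [hk, this]
  · simp

/-- The cost of a threshold sequence splits into the contributions of the two sides. -/
theorem thresholdPen_eq (p w : ℕ → ℕ) {n k : ℕ} (hk : k ≤ n) (M : ℕ → Bool) :
    thresholdPen p w n k M = sidePen p w M k -
      sidePen (fun i => p (n - 1 - i)) (fun i => w (n - 1 - i)) (fun i => M (n - 1 - i))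
        (n - k) := by
  have cut : ∀ (g : ℕ → ℤ) (j : ℕ), j ≤ n →
      ∑ i ∈ Finset.range j, g i = ∑ i ∈ Finset.range n, if i < j then g i else 0 := by
    intro g j hj
    rw [← Finset.sum_filter]
    refine Finset.sum_congr ?_ fun _ _ => rfl
    ext i; simp only [Finset.mem_range, Finset.mem_filter]; omega
  have h1 : sidePen p w M k = ∑ j ∈ Finset.range n, if j < k then if M j then 0 else
      ∑ i ∈ Finset.range n, if i < j ∧ M i then (p j * w i - p i * w j : ℤ) else 0 else 0 := by
    rw [sidePen, cut _ k hk]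
    refine Finset.sum_congr rfl fun j hj => ?_
    rw [cut _ j (by simp at hj; omega)]
    simp only [ite_and]
  have h2 : sidePen (fun i => p (n - 1 - i)) (fun i => w (n - 1 - i)) (fun i => M (n - 1 - i))
      (n - k) = ∑ j ∈ Finset.range n, if k ≤ j then if M j then 0 else
      ∑ i ∈ Finset.range n, if j < i ∧ M i then (p j * w i - p i * w j : ℤ) else 0 else 0 := by
    rw [sidePen, cut _ (n - k) (by omega), ← Finset.sum_range_reflect _ n]
    refine Finset.sum_congr rfl fun j hj => ?_
    have hj : j < n := by simpa using hj
    rw [cut _ _ (by omega), ← Finset.sum_range_reflect _ n]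
    have e1 : n - 1 - (n - 1 - j) = j := by omega
    rw [e1]
    by_cases hjk : k ≤ j
    · rw [if_pos (by omega), if_pos hjk]
      congr 1
      refine Finset.sum_congr rfl fun i hi => ?_
      have hi : i < n := by simpa using hi
      have e2 : n - 1 - (n - 1 - i) = i := by omega
      have e3 : n - 1 - i < n - 1 - j ↔ j < i := by omega
      rw [e2, ite_and]
      simp only [e3]
    · rw [if_neg (by omega), if_neg hjk]
  rw [h1, h2, thresholdPen, ← Finset.sum_sub_distrib]
  refine Finset.sum_congr rfl fun j _ => ?_
  cases M j
  · by_cases hjk : j < k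
    · simp [hjk, hjk.not_ge]
    · simp only [hjk, not_lt.1 hjk, if_false, if_true, Bool.false_eq_true, zero_sub,
        ← Finset.sum_neg_distrib]
      refine Finset.sum_congr rfl fun i _ => ?_
      split <;> simp
  · simp

/-- Threshold sequences suffice: if the jobs are numbered in Smith's order, then the jobs outside
a contiguous part `M` of a sequence are best moved before or after `M` according to their ratio
compared with that of `M` as a whole, with all parts sorted. -/
theorem exists_thresholdPen_le {p w : ℕ → ℕ} {n : ℕ} (hp : ∀ i < n, 0 < p i)
    (hs : ∀ i j, i < j → j < n → w j * p i ≤ w i * p j) {M : ℕ → Bool} {ρ : ℕ → ℕ}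
    (hM : ∀ j < n, M j = false → (∀ i < n, M i = true → ρ j < ρ i) ∨
      ∀ i < n, M i = true → ρ i < ρ j) :
    ∃ k ≤ n, thresholdPen p w n k M ≤ invCost p w n (fun i j => ρ j < ρ i) := by
  classical
  set g : ℕ → ℤ := fun j => ∑ i ∈ Finset.range n,
    if M i then (p j * w i - p i * w j : ℤ) else 0 with hg
  set PM : ℤ := ∑ i ∈ Finset.range n, if M i then (p i : ℤ) else 0 with hPM
  set WM : ℤ := ∑ i ∈ Finset.range n, if M i then (w i : ℤ) else 0 with hWM
  have hPM0 : 0 ≤ PM := Finset.sum_nonneg fun i _ => by split <;> positivity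
  have hgE : ∀ j, g j = p j * WM - w j * PM := fun j => by
    rw [hWM, hPM, Finset.mul_sum, Finset.mul_sum, ← Finset.sum_sub_distrib]
    refine Finset.sum_congr rfl fun i _ => ?_
    split <;> simp [mul_comm]
  have hmono : ∀ i j, i < j → j < n → g j ≤ 0 → g i ≤ 0 := by
    intro i j hij hj h
    rw [hgE] at h ⊢
    have h1 : (w j * p i : ℤ) ≤ w i * p j := by exact_mod_cast hs i j hij hj
    have h2 : (0 : ℤ) < p j := by exact_mod_cast hp j hj
    have h3 : (0 : ℤ) < p i := by exact_mod_cast hp i (by omega)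
    have h4 : (p j : ℤ) * (p i * WM - w i * PM) ≤ 0 := by nlinarith
    exact nonpos_of_mul_nonpos_right h4 h2
  have hex : ∃ k, n ≤ k ∨ 0 < g k := ⟨n, Or.inl le_rfl⟩
  set k := Nat.find hex with hk
  have hkn : k ≤ n := Nat.find_min' hex (Or.inl le_rfl)
  have hlow : ∀ j < k, g j ≤ 0 := fun j hj => by
    have := Nat.find_min hex hj
    push Not at this
    exact this.2
  have hhigh : ∀ j, k ≤ j → j < n → 0 ≤ g j := fun j hkj hj => by
    by_contra hneg
    rcases Nat.find_spec hex with h | h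
    · omega
    · rcases Nat.eq_or_lt_of_le hkj with rfl | hlt
      · exact hneg h.le
      · exact absurd (hmono k j hlt hj (by omega)) (not_le.2 h)
  refine ⟨k, hkn, ?_⟩
  have hδ : ∀ i j, i < j → j < n → (0 : ℤ) ≤ p j * w i - p i * w j := fun i j hij hj => by
    have : (w j * p i : ℤ) ≤ w i * p j := by exact_mod_cast hs i j hij hj
    nlinarith
  -- Only inversions between `M` and its complement are counted; the others cost nothing less.
  have h1 : (∑ j ∈ Finset.range n, ∑ i ∈ Finset.range n,
        if i < j ∧ ρ j < ρ i ∧ M i = true ∧ M j = false then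
          (p j * w i - p i * w j : ℤ) else 0) +
      (∑ j ∈ Finset.range n, ∑ i ∈ Finset.range n,
        if j < i ∧ ρ i < ρ j ∧ M i = true ∧ M j = false then
          (p i * w j - p j * w i : ℤ) else 0) ≤ invCost p w n (fun i j => ρ j < ρ i) := by
    rw [Finset.sum_comm]
    simp only [invCost, ← Finset.sum_add_distrib]
    refine Finset.sum_le_sum fun i hi => Finset.sum_le_sum fun j hj => ?_
    by_cases hij : i < j
    · have := hδ i j hij (by simpa using hj)
      by_cases hr : ρ j < ρ i
      · cases M i <;> cases M j <;> simp [hij, hr] <;> linarith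
      · simp [hr]
    · simp [hij]
  refine le_trans ?_ h1
  rw [thresholdPen, ← Finset.sum_add_distrib]
  refine Finset.sum_le_sum fun j hj => ?_
  have hj : j < n := by simpa using hj
  cases hMj : M j
  swap
  · simp
  -- `g j` is the difference of the costs of placing `j` before and after all of `M`.
  have hdiff : (∑ i ∈ Finset.range n, if i < j ∧ M i then (p j * w i - p i * w j : ℤ) else 0) -
      (∑ i ∈ Finset.range n, if j < i ∧ M i then (p i * w j - p j * w i : ℤ) else 0) = g j := by
    rw [← Finset.sum_sub_distrib]
    refine Finset.sum_congr rfl fun i _ => ?_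
    rcases lt_trichotomy i j with h | rfl | h
    · simp [h, h.not_gt]
    · simp [hMj]
    · simp only [h, h.not_gt, true_and, false_and, if_false]
      split <;> simp
  rcases hM j hj hMj with hb | hb
  · have e1 : (∑ i ∈ Finset.range n, if i < j ∧ ρ j < ρ i ∧ M i = true ∧ false = false then
          (p j * w i - p i * w j : ℤ) else 0) =
        ∑ i ∈ Finset.range n, if i < j ∧ M i then (p j * w i - p i * w j : ℤ) else 0 := by
      refine Finset.sum_congr rfl fun i hi => ?_
      have := hb i (by simpa using hi)
      refine if_congr ?_ rfl rfl
      tauto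
    have e2 : (∑ i ∈ Finset.range n, if j < i ∧ ρ i < ρ j ∧ M i = true ∧ false = false then
          (p i * w j - p j * w i : ℤ) else 0) = 0 := by
      refine Finset.sum_eq_zero fun i hi => if_neg ?_
      have := hb i (by simpa using hi)
      rintro ⟨_, h2, h3, _⟩
      exact absurd (this h3) h2.not_gt
    rw [e1, e2, add_zero]
    by_cases hjk : j < k
    · simp [hjk]
    · have := hhigh j (by omega) hj
      simp only [hjk, if_false, Bool.false_eq_true]
      linarith
  · have e1 : (∑ i ∈ Finset.range n, if i < j ∧ ρ j < ρ i ∧ M i = true ∧ false = false then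
          (p j * w i - p i * w j : ℤ) else 0) = 0 := by
      refine Finset.sum_eq_zero fun i hi => if_neg ?_
      have := hb i (by simpa using hi)
      rintro ⟨_, h2, h3, _⟩
      exact absurd (this h3) h2.not_gt
    have e2 : (∑ i ∈ Finset.range n, if j < i ∧ ρ i < ρ j ∧ M i = true ∧ false = false then
          (p i * w j - p j * w i : ℤ) else 0) =
        ∑ i ∈ Finset.range n, if j < i ∧ M i then (p i * w j - p j * w i : ℤ) else 0 := by
      refine Finset.sum_congr rfl fun i hi => ?_
      have := hb i (by simpa using hi)
      refine if_congr ?_ rfl rfl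
      tauto
    rw [e1, e2, zero_add]
    by_cases hjk : j < k
    · have := hlow j hjk
      simp only [hjk, if_true, if_false, Bool.false_eq_true]
      linarith
    · simp [hjk]

namespace ERInstance

variable (I : ERInstance)

theorem completion_eq (σ : Equiv.Perm (Fin I.n)) (j : Fin I.n) :
    I.completion σ j = ∑ i, if σ.symm i ≤ σ.symm j then I.p i else 0 := by
  rw [completion, Finset.sum_filter, ← Equiv.sum_comp σ.symm]
  simp

/-- The cost of a sequence, summed over pairs of jobs numbered by `π`. -/
theorem twc_eq (σ : Equiv.Perm (Fin I.n)) (π : Fin I.n ≃ Fin I.n) {p w ρ : ℕ → ℕ}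
    (hp : ∀ i : Fin I.n, p i = I.p (π i)) (hw : ∀ i : Fin I.n, w i = I.w (π i))
    (hρ : ∀ i : Fin I.n, ρ i = (σ.symm (π i) : ℕ)) :
    (I.twc σ : ℤ) = baseCost p w I.n + invCost p w I.n (fun i j => ρ j < ρ i) := by
  rw [← sum_pairs_eq]
  · rw [twc, ← Equiv.sum_comp π, Finset.sum_comm, Finset.sum_range]
    push_cast
    refine Finset.sum_congr rfl fun j _ => ?_
    rw [completion_eq, ← Equiv.sum_comp π, Finset.sum_range]
    push_cast
    rw [Finset.mul_sum]
    refine Finset.sum_congr rfl fun i _ => ?_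
    rw [hρ, hρ, hp, hw]
    by_cases h : σ.symm (π i) ≤ σ.symm (π j)
    · rw [if_pos h, if_pos (Fin.val_fin_le.2 h), mul_comm]
    · rw [if_neg h, if_neg (fun h' => h (Fin.val_fin_le.1 h')), mul_zero]
  · intro i hi j hj h
    have hi' := hρ ⟨i, hi⟩
    have hj' := hρ ⟨j, hj⟩
    simp only at hi' hj'
    rw [hi', hj'] at h
    have := π.injective (σ.symm.injective (Fin.ext h))
    simpa using this

/-- Job `j` is processed within the renting period. -/
def InRent (σ : Equiv.Perm (Fin I.n)) (j : Fin I.n) : Prop :=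
  ∃ a ∈ I.R, ∃ b ∈ I.R, σ.symm a ≤ σ.symm j ∧ σ.symm j ≤ σ.symm b

open Classical in
theorem sum_inRent_le (σ : Equiv.Perm (Fin I.n)) :
    (∑ j, if I.InRent σ j then I.p j else 0) ≤ I.rentLength σ := by
  by_cases h : I.R.Nonempty
  swap
  · refine (Finset.sum_eq_zero fun j _ => if_neg ?_).trans_le (Nat.zero_le _)
    rintro ⟨a, ha, _⟩
    exact h ⟨a, ha⟩
  obtain ⟨a, ha, hamin⟩ := I.R.exists_min_image (fun j => σ.symm j) h
  obtain ⟨b, hb, hbmax⟩ := I.R.exists_max_image (fun j => σ.symm j) h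
  rw [rentLength, dif_pos h]
  have h1 : I.completion σ b ≤ I.R.sup' h (fun j => I.completion σ j) :=
    Finset.le_sup' (fun j => I.completion σ j) hb
  have h2 : I.R.inf' h (fun j => I.completion σ j - I.p j) ≤ I.completion σ a - I.p a :=
    Finset.inf'_le (fun j => I.completion σ j - I.p j) ha
  have h3 : (∑ j, if I.InRent σ j then I.p j else 0) + (I.completion σ a - I.p a) ≤
      I.completion σ b := by
    have : I.completion σ a - I.p a = ∑ i, if σ.symm i < σ.symm a then I.p i else 0 := by
      have hpa : I.p a = ∑ i, if i = a then I.p i else 0 := by simp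
      rw [completion_eq, hpa, Nat.sub_eq_iff_eq_add, ← Finset.sum_add_distrib]
      · refine Finset.sum_congr rfl fun i _ => ?_
        rcases eq_or_ne i a with rfl | hne
        · simp
        · have : σ.symm i ≠ σ.symm a := fun h => hne (σ.symm.injective h)
          simp only [hne, if_false, add_zero, this.le_iff_lt]
      · refine Finset.sum_le_sum fun i _ => ?_
        rcases eq_or_ne i a with rfl | hne
        · simp
        · simp [hne]
    rw [this, completion_eq, ← Finset.sum_add_distrib]
    refine Finset.sum_le_sum fun i _ => ?_
    by_cases hi : σ.symm i < σ.symm a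
    · have : ¬ I.InRent σ i := by
        rintro ⟨a', ha', _, _, h', _⟩
        exact absurd (hi.trans_le (hamin a' ha')) h'.not_gt
      simp [hi, this, (hi.trans_le (hamin b hb)).le]
    · simp only [hi, if_false, add_zero]
      split
      · rename_i hr
        obtain ⟨_, _, b', hb', _, h'⟩ := hr
        simp [h'.trans (hbmax b' hb')]
      · exact Nat.zero_le _
  omega

/-- If all jobs that need the resource belong to a part of the sequence, then the renting period is
no longer than this part. -/
theorem rentLength_le (σ : Equiv.Perm (Fin I.n)) (c : Fin I.n → ℕ)
    (hc : ∀ i j, c i < c j → σ.symm i < σ.symm j) (hR : ∀ j ∈ I.R, c j = 1) :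
    I.rentLength σ ≤ ∑ j, if c j = 1 then I.p j else 0 := by
  unfold rentLength
  split
  swap
  · exact Nat.zero_le _
  rename_i h
  have hle : ∀ i j, σ.symm i ≤ σ.symm j → c i ≤ c j := fun i j hij => by
    by_contra hlt
    exact absurd (hc j i (by omega)) hij.not_gt
  have h1 : I.R.sup' h (fun j => I.completion σ j) ≤
      (∑ j, if c j = 1 then I.p j else 0) + ∑ j, if c j < 1 then I.p j else 0 := by
    refine Finset.sup'_le _ _ fun j hj => ?_
    rw [completion_eq, ← Finset.sum_add_distrib]
    refine Finset.sum_le_sum fun i _ => ?_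
    split
    · rename_i hij
      have := hle i j hij
      rw [hR j hj] at this
      rcases Nat.eq_or_lt_of_le this with h | h
      · simp [h]
      · simp [h]
    · exact Nat.zero_le _
  have h2 : (∑ j, if c j < 1 then I.p j else 0) ≤
      I.R.inf' h (fun j => I.completion σ j - I.p j) := by
    refine Finset.le_inf' _ _ fun j hj => ?_
    have : (∑ i, if c i < 1 then I.p i else 0) + I.p j ≤ I.completion σ j := by
      have hpj : I.p j = ∑ i, if i = j then I.p i else 0 := by simp
      rw [completion_eq, hpj, ← Finset.sum_add_distrib]
      refine Finset.sum_le_sum fun i _ => ?_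
      rcases eq_or_ne i j with rfl | hne
      · simp [hR i hj]
      · by_cases hi : c i < 1
        · have := hc i j (by rw [hR j hj]; exact hi)
          simp [hi, hne, this.le]
        · simp [hi, hne]
    omega
  omega

end ERInstance

/-! ### The dynamic programs solve the scheduling problem -/

theorem sum_range_add_reflect {A : Type*} [AddCommMonoid A] (g : ℕ → A) {n k : ℕ} (hk : k ≤ n) :
    ∑ i ∈ Finset.range k, g i + ∑ i ∈ Finset.range (n - k), g (n - 1 - i) =
      ∑ i ∈ Finset.range n, g i := by
  obtain ⟨d, rfl⟩ := Nat.exists_eq_add_of_le hk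
  rw [Finset.sum_range_add, Nat.add_sub_cancel_left,
    ← Finset.sum_range_reflect (fun i => g (k + i)) d]
  congr 1
  refine Finset.sum_congr rfl fun i hi => ?_
  have : i < d := by simpa using hi
  congr 1
  omega

theorem sum_range_add_back {q q' : ℕ → ℕ} {n k : ℕ} (h : ∀ i < n, q' i = q (n - 1 - i))
    (hk : k ≤ n) : ∑ i ∈ Finset.range k, q i + ∑ i ∈ Finset.range (n - k), q' i =
      ∑ i ∈ Finset.range n, q i := by
  rw [← sum_range_add_reflect q hk]
  congr 1
  exact Finset.sum_congr rfl fun i hi => h i (by simp at hi; omega)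

theorem sidePen_congr {p w p' w' : ℕ → ℕ} {M M' : ℕ → Bool} {k : ℕ}
    (hp : ∀ i < k, p i = p' i) (hw : ∀ i < k, w i = w' i) (hM : ∀ i < k, M i = M' i) :
    sidePen p w M k = sidePen p' w' M' k := by
  refine Finset.sum_congr rfl fun j hj => ?_
  have hj : j < k := by simpa using hj
  rw [hM j hj]
  split
  · rfl
  · refine Finset.sum_congr rfl fun i hi => ?_
    have hi : i < k := lt_trans (by simpa using hi) hj
    rw [hM i hi, hp i hi, hp j hj, hw i hi, hw j hj]

theorem invCost_congr {p w : ℕ → ℕ} {n : ℕ} {inv inv' : ℕ → ℕ → Prop}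
    (h : ∀ i < n, ∀ j < n, inv i j ↔ inv' i j) : invCost p w n inv = invCost p w n inv' := by
  classical
  refine Finset.sum_congr rfl fun i hi => Finset.sum_congr rfl fun j hj => ?_
  refine if_congr ?_ rfl rfl
  rw [h i (by simpa using hi) j (by simpa using hj)]

namespace ERInstance

/-- The functions `p`, `w`, `r` list the data of the jobs in Smith's order, which is given by `π`;
`p'`, `w'`, `r'` list them backwards.  The second state component of the dynamic programs is bounded
by the smaller one of `P` and `W`, and `f` says which one that is. -/
structure Prepared (I : ERInstance) (p w r p' w' r' : ℕ → ℕ) (π : Fin I.n ≃ Fin I.n)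
    (f Q : ℕ) : Prop where
  p_eq : ∀ i : Fin I.n, p i = I.p (π i)
  w_eq : ∀ i : Fin I.n, w i = I.w (π i)
  r_iff : ∀ i : Fin I.n, r i ≠ 0 ↔ π i ∈ I.R
  p'_eq : ∀ i < I.n, p' i = p (I.n - 1 - i)
  w'_eq : ∀ i < I.n, w' i = w (I.n - 1 - i)
  r'_eq : ∀ i < I.n, r' i = r (I.n - 1 - i)
  pos : ∀ j, 0 < I.p j
  smith : ∀ i j, i < j → j < I.n → w j * p i ≤ w i * p j
  mode : f = 0 ∧ Q = I.W ∧ I.W ≤ I.P ∨ f = 1 ∧ Q = I.P ∧ I.P ≤ I.W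

variable {I : ERInstance} {p w r p' w' r' : ℕ → ℕ} {π : Fin I.n ≃ Fin I.n} {f Q : ℕ}

namespace Prepared

variable (H : I.Prepared p w r p' w' r' π f Q)
include H

theorem p_pos {i : ℕ} (hi : i < I.n) : 0 < p i := by
  have := H.p_eq ⟨i, hi⟩
  simp only at this
  rw [this]; exact H.pos _

theorem p'_pos {i : ℕ} (hi : i < I.n) : 0 < p' i := by
  rw [H.p'_eq i hi]; exact H.p_pos (by omega)

theorem w_le {i : ℕ} (hi : i < I.n) : w i ≤ I.W := by
  have := H.w_eq ⟨i, hi⟩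
  simp only at this
  rw [this]
  exact Finset.single_le_sum (f := I.w) (fun _ _ => Nat.zero_le _) (Finset.mem_univ _)

theorem w'_le {i : ℕ} (hi : i < I.n) : w' i ≤ I.W := by
  rw [H.w'_eq i hi]; exact H.w_le (by omega)

theorem sum_p : ∑ i ∈ Finset.range I.n, p i = I.P := by
  rw [Finset.sum_range, P, ← Equiv.sum_comp π I.p]
  exact Finset.sum_congr rfl fun i _ => H.p_eq i

theorem sum_w : ∑ i ∈ Finset.range I.n, w i = I.W := by
  rw [Finset.sum_range, W, ← Equiv.sum_comp π I.w]
  exact Finset.sum_congr rfl fun i _ => H.w_eq i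

theorem sum_p' : ∑ i ∈ Finset.range I.n, p' i = I.P := by
  have := sum_range_add_back H.p'_eq (Nat.zero_le _)
  rw [← H.sum_p, ← this]; simp

theorem sum_w' : ∑ i ∈ Finset.range I.n, w' i = I.W := by
  have := sum_range_add_back H.w'_eq (Nat.zero_le _)
  rw [← H.sum_w, ← this]; simp

/-- The dynamic program for the jobs before the renting period. -/
abbrev near (_ : I.Prepared p w r p' w' r' π f Q) : DP := sideDP true f Q (I.W * I.P) p w r

/-- The dynamic program for the jobs after the renting period. -/
abbrev far (_ : I.Prepared p w r p' w' r' π f Q) : DP := sideDP false f Q (I.W * I.P) p' w' r'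

theorem mS_add {M : ℕ → Bool} {k : ℕ} (hk : k ≤ I.n) :
    H.near.mS M k + H.far.mS (fun i => M (I.n - 1 - i)) (I.n - k) =
      ∑ i ∈ Finset.range I.n, if M i then p i else 0 := by
  rw [← sum_range_add_reflect _ hk]
  congr 1
  refine Finset.sum_congr rfl fun i hi => ?_
  simp only [sideDP]
  rw [H.p'_eq i (by simp at hi; omega)]

/-- The costs of the two sides add up to the cost of the sequence, up to constants. -/
theorem cS_add {M : ℕ → Bool} {k q₁ q₂ : ℕ} (hk : k ≤ I.n) (h1 : q₁ ≤ f * Q) (h2 : q₂ ≤ f * Q)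
    (hm1 : H.near.mS M k ≤ I.P) (hm2 : H.far.mS (fun i => M (I.n - 1 - i)) (I.n - k) ≤ I.P)
    (hq1 : H.near.qS M q₁ k ≤ Q) (hq1' : f * Q ≤ H.near.qS M q₁ k)
    (hq2 : H.far.qS (fun i => M (I.n - 1 - i)) q₂ (I.n - k) ≤ Q)
    (hq2' : f * Q ≤ H.far.qS (fun i => M (I.n - 1 - i)) q₂ (I.n - k)) :
    (H.near.cS M q₁ k + H.far.cS (fun i => M (I.n - 1 - i)) q₂ (I.n - k) : ℤ) =
      I.W * I.P * I.P + thresholdPen p w I.n k M := by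
  have hf : f = 0 ∨ f = 1 := H.mode.imp (·.1) (·.1)
  have hQP : Q ≤ I.P := by rcases H.mode with h | h <;> omega
  have hQW : Q ≤ I.W := by rcases H.mode with h | h <;> omega
  rw [sideDP_cS (n := I.n) hf h1 hQP hQW (fun _ => H.p_pos) (fun _ => H.w_le) hk hm1 hq1 hq1',
    sideDP_cS (n := I.n) hf h2 hQP hQW (fun _ => H.p'_pos) (fun _ => H.w'_le) (Nat.sub_le _ _)
      hm2 hq2 hq2', thresholdPen_eq p w hk M,
    sidePen_congr (p := p') (w := w') (k := I.n - k) (fun i hi => H.p'_eq i (by omega))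
      (fun i hi => H.w'_eq i (by omega)) (fun _ _ => rfl)]
  have hs : (I.P : ℤ) = ∑ i ∈ Finset.range k, (p i : ℤ) +
      ∑ i ∈ Finset.range (I.n - k), (p' i : ℤ) := by
    rw [← H.sum_p, ← sum_range_add_back H.p'_eq hk]; push_cast; rfl
  rw [hs]
  simp only [if_true, Bool.false_eq_true, if_false]
  ring

/-- Every feasible sequence is matched by table entries of the two sides. -/
theorem exists_entries {τ : Equiv.Perm (Fin I.n)} (hτ : I.Feasible τ) :
    ∃ k ≤ I.n, ∃ m₁ m₂ q₁ q₂, m₁ + m₂ ≤ min I.K I.P ∧ f * Q ≤ q₁ ∧ q₁ ≤ Q ∧ f * Q ≤ q₂ ∧ q₂ ≤ Q ∧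
      H.near.T k m₁ q₁ ≠ 0 ∧ H.far.T (I.n - k) m₂ q₂ ≠ 0 ∧
      (H.near.T k m₁ q₁ + H.far.T (I.n - k) m₂ q₂ + baseCost p w I.n : ℤ) ≤
        I.W * I.P * I.P + 2 + I.twc τ := by
  classical
  set M : ℕ → Bool := fun i => if h : i < I.n then decide (I.InRent τ (π ⟨i, h⟩)) else false with hM
  set ρ : ℕ → ℕ := fun i => if h : i < I.n then (τ.symm (π ⟨i, h⟩) : ℕ) else 0 with hρ
  have hMi : ∀ i : Fin I.n, M i = true ↔ I.InRent τ (π i) := fun i => by simp [hM]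
  have hρi : ∀ i : Fin I.n, ρ i = (τ.symm (π i) : ℕ) := fun i => by simp [hρ]
  obtain ⟨k, hk, hpen⟩ := exists_thresholdPen_le (ρ := ρ) (M := M) (fun i hi => H.p_pos hi)
    H.smith (by
      intro j hj hMj
      lift j to Fin I.n using hj with j
      have hj' : ¬ I.InRent τ (π j) := fun h => by
        rw [(hMi j).2 h] at hMj; cases hMj
      by_cases hb : ∃ a ∈ I.R, τ.symm a ≤ τ.symm (π j)
      · obtain ⟨a, ha, haj⟩ := hb
        refine Or.inr fun i hi hMi' => ?_
        lift i to Fin I.n using hi with i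
        obtain ⟨_, _, b, hb, _, hib⟩ := (hMi i).1 hMi'
        rw [hρi, hρi]
        refine Fin.lt_def.1 (lt_of_le_of_lt hib (not_le.1 fun h => hj' ⟨a, ha, b, hb, haj, h⟩))
      · push Not at hb
        refine Or.inl fun i hi hMi' => ?_
        lift i to Fin I.n using hi with i
        obtain ⟨a, ha, _, _, hai, _⟩ := (hMi i).1 hMi'
        rw [hρi, hρi]
        exact Fin.lt_def.1 ((hb a ha).trans_le hai))
  have htwc := I.twc_eq τ π H.p_eq H.w_eq hρi
  have hsum : ∑ i ∈ Finset.range I.n, (if M i then p i else 0) ≤ I.rentLength τ := by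
    refine le_trans (le_of_eq ?_) (I.sum_inRent_le τ)
    rw [Finset.sum_range, ← Equiv.sum_comp π fun j => if I.InRent τ j then I.p j else 0]
    refine Finset.sum_congr rfl fun i _ => ?_
    rw [H.p_eq]
    exact if_congr (hMi i) rfl rfl
  have hsum' : ∑ i ∈ Finset.range I.n, (if M i then p i else 0) ≤ I.P := by
    rw [← H.sum_p]
    exact Finset.sum_le_sum fun i _ => by split <;> omega
  have hms := H.mS_add (M := M) hk
  have hR : ∀ i < I.n, r i ≠ 0 → M i = true := by
    intro i hi hr
    lift i to Fin I.n using hi with i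
    have := (H.r_iff i).1 hr
    exact (hMi i).2 ⟨_, this, _, this, le_rfl, le_rfl⟩
  obtain ⟨q₁, hq1, hq1u, hq1l⟩ := sideDP_exists_start (fwd := true) (f := f) (Q := Q) (n := I.n)
    (p := p) (w := w) (r := r) (M := M)
    (H.mode.imp (fun h => ⟨h.1, by rw [H.sum_w]; omega⟩) fun h => ⟨h.1, by rw [H.sum_p]; omega⟩)
    hk (I.W * I.P)
  obtain ⟨q₂, hq2, hq2u, hq2l⟩ := sideDP_exists_start (fwd := false) (f := f) (Q := Q) (n := I.n)
    (p := p') (w := w') (r := r') (M := fun i => M (I.n - 1 - i))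
    (H.mode.imp (fun h => ⟨h.1, by rw [H.sum_w']; omega⟩) fun h => ⟨h.1, by rw [H.sum_p']; omega⟩)
    (Nat.sub_le I.n k) (I.W * I.P)
  have hc := H.cS_add hk hq1 hq2 (by omega) (by omega) hq1u hq1l hq2u hq2l
  obtain ⟨t1, t1'⟩ := H.near.T_le (M := M) (q₀ := q₁) (k := k) hq1
    (fun i hi => hR i (by omega))
  obtain ⟨t2, t2'⟩ := H.far.T_le (M := fun i => M (I.n - 1 - i)) (q₀ := q₂) (k := I.n - k) hq2
    (fun i hi hr => hR _ (by omega) (by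
      have : r' i ≠ 0 := hr
      rwa [H.r'_eq i (by omega)] at this))
  refine ⟨k, hk, _, _, _, _, ?_, hq1l, hq1u, hq2l, hq2u, t1, t2, ?_⟩
  · rw [hms]; exact le_min (hsum.trans hτ) hsum'
  · have t1z : (H.near.T k (H.near.mS M k) (H.near.qS M q₁ k) : ℤ) ≤ H.near.cS M q₁ k + 1 := by
      exact_mod_cast t1'
    have t2z : (H.far.T (I.n - k) (H.far.mS (fun i => M (I.n - 1 - i)) (I.n - k))
        (H.far.qS (fun i => M (I.n - 1 - i)) q₂ (I.n - k)) : ℤ) ≤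
        H.far.cS (fun i => M (I.n - 1 - i)) q₂ (I.n - k) + 1 := by
      exact_mod_cast t2'
    rw [htwc]
    linarith

/-- The sequence read off from decisions on the two sides is feasible, and its cost is given by the
table entries. -/
theorem feasible_of_attains {c : ℕ → ℕ} {k m₁ m₂ s₁ s₂ q₁ q₂ : ℕ} (hk : k ≤ I.n)
    (h1 : H.near.Attains (fun i => decide (c i = 1)) q₁ k m₁ s₁)
    (h2 : H.far.Attains (fun i => decide (c (I.n - 1 - i) = 1)) q₂ (I.n - k) m₂ s₂)
    (hc1 : ∀ i < k, c i = 1 ∨ c i = 0) (hc2 : ∀ i, k ≤ i → i < I.n → c i = 1 ∨ c i = 2)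
    (hm : m₁ + m₂ ≤ min I.K I.P) (hs1 : f * Q ≤ s₁) (hs1' : s₁ ≤ Q) (hs2 : f * Q ≤ s₂)
    (hs2' : s₂ ≤ Q) {σ : Equiv.Perm (Fin I.n)}
    (hσ : ∀ i : Fin I.n, (σ.symm (π i) : ℕ) = rankOf (classLt c) I.n i) :
    I.Feasible σ ∧ (I.twc σ + (I.W * I.P * I.P + 2) : ℤ) =
      H.near.T k m₁ s₁ + H.far.T (I.n - k) m₂ s₂ + baseCost p w I.n := by
  set M : ℕ → Bool := fun i => decide (c i = 1) with hM
  have hlt : ∀ i < I.n, ∀ j < I.n,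
      (rankOf (classLt c) I.n j < rankOf (classLt c) I.n i ↔ classLt c j i) := fun i hi j hj =>
    rankOf_lt_iff (classLt_strictBelow c I.n) hj hi
  have hpart : ∀ i < I.n, partOf k M i = c i := by
    intro i hi
    by_cases h1 : c i = 1
    · simp [partOf, hM, h1]
    · by_cases hik : i < k
      · simp [partOf, hM, hik, (hc1 i hik).resolve_left h1]
      · simp [partOf, hM, hik, (hc2 i (by omega) hi).resolve_left h1]
  obtain ⟨a1, a2, a3, a4, a5⟩ := h1
  obtain ⟨b1, b2, b3, b4, b5⟩ := h2
  have hms := H.mS_add (M := M) hk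
  have hle : m₁ + m₂ ≤ I.P := hm.trans (min_le_right _ _)
  constructor
  · refine le_trans (I.rentLength_le σ (fun j => c (π.symm j)) ?_ ?_)
      (le_trans (le_of_eq ?_) (hm.trans (min_le_left _ _)))
    · intro i j hij
      have hi := hσ (π.symm i)
      have hj := hσ (π.symm j)
      rw [Equiv.apply_symm_apply] at hi hj
      rw [Fin.lt_def, hi, hj, hlt _ (Fin.is_lt _) _ (Fin.is_lt _)]
      exact Or.inl hij
    · intro j hj
      have hr := (H.r_iff (π.symm j)).2 (by rwa [Equiv.apply_symm_apply])
      rcases lt_or_ge (π.symm j : ℕ) k with h | h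
      · simpa [hM] using a5 _ h hr
      · have h' : I.n - 1 - (I.n - 1 - (π.symm j : ℕ)) = (π.symm j : ℕ) := by
          have := (π.symm j).2
          omega
        have := b5 (I.n - 1 - (π.symm j : ℕ)) (by have := (π.symm j).2; omega) (by
          change r' _ ≠ 0
          rw [H.r'_eq _ (by have := (π.symm j).2; omega), h']
          exact hr)
        simpa [hM, h'] using this
    · rw [← a2, ← b2, hms, Finset.sum_range, ← Equiv.sum_comp π]
      refine Finset.sum_congr rfl fun i _ => ?_
      simp [hM, H.p_eq]
  · have hcost := H.cS_add (M := M) hk a1 b1 (by omega) (by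
        change H.far.mS (fun i => decide (c (I.n - 1 - i) = 1)) (I.n - k) ≤ I.P; omega)
      (by rw [a3]; exact hs1') (by rw [a3]; exact hs1)
      (by change H.far.qS (fun i => decide (c (I.n - 1 - i) = 1)) q₂ (I.n - k) ≤ Q; omega)
      (by change f * Q ≤ H.far.qS (fun i => decide (c (I.n - 1 - i) = 1)) q₂ (I.n - k); omega)
    rw [I.twc_eq σ π (ρ := rankOf (classLt c) I.n) H.p_eq H.w_eq (fun i => (hσ i).symm),
      invCost_congr (inv' := fun i j => classLt (partOf k M) j i) (fun i hi j hj => by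
        rw [hlt i hi j hj]
        unfold classLt
        rw [hpart i hi, hpart j hj]), invCost_partOf, ← a4, ← b4]
    push_cast
    linarith

end Prepared

end ERInstance

/-! ### Building blocks of the program -/

namespace WordRAM

local infixl:65 " +ₑ " => Expr.add
local infixl:65 " -ₑ " => Expr.sub
local infixl:70 " *ₑ " => Expr.mul
local infix:40 " ≔ " => Cmd.assign
local infixr:30 " ;; " => Cmd.seq
local prefix:max "#" => Expr.var
local prefix:max "♯" => Expr.lit

-- Scalar variables.  `vN`, `vK` and `vRes` are `n`, `K` and the answer; `vP`, `vW` are the total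
-- processing time and weight; `vQ`, `vF`, `vE = f * Q` and `vY = W * P` are the parameters of
-- `sideDP`; `vKc = min K P`; `vN1`, …, `vE1` exceed `vN`, `vP`, `vQ`, `vKc`, `vE` by one.
-- `vJ`, `vM`, `vS` are an item and a state `(m, q)`.  `vT` is a threshold, `vC` a budget for the
-- far side, `vB2`, `vM2`, `vS2` the best far-side entry and its state, `vBest`, …, `vBs2` the best
-- combination: its value, its threshold and the states on both sides.
-- Arrays.  0-2: the input; 3: the output; 4-6: processing times, weights and resource indicators in
-- Smith's order; 7: job numbers in this order; 8-10: as 4-6 in reverse; 11, 12: the tables of the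
-- near and the far side; 13: the part of the sequence for each job.
local notation "vN" => (0 : ℕ)
local notation "vK" => (1 : ℕ)
local notation "vRes" => (2 : ℕ)
local notation "vP" => (3 : ℕ)
local notation "vW" => (4 : ℕ)
local notation "vQ" => (5 : ℕ)
local notation "vF" => (6 : ℕ)
local notation "vE" => (7 : ℕ)
local notation "vY" => (8 : ℕ)
local notation "vKc" => (9 : ℕ)
local notation "vN1" => (10 : ℕ)
local notation "vP1" => (11 : ℕ)
local notation "vQ1" => (12 : ℕ)
local notation "vK1" => (13 : ℕ)
local notation "vE1" => (14 : ℕ)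
local notation "vI" => (20 : ℕ)
local notation "vL" => (21 : ℕ)
local notation "vCnt" => (22 : ℕ)
local notation "vJ" => (23 : ℕ)
local notation "vM" => (24 : ℕ)
local notation "vS" => (25 : ℕ)
local notation "vOut" => (26 : ℕ)
local notation "vIn" => (27 : ℕ)
local notation "vT" => (30 : ℕ)
local notation "vC" => (31 : ℕ)
local notation "vB2" => (32 : ℕ)
local notation "vM2" => (33 : ℕ)
local notation "vS2" => (34 : ℕ)
local notation "vBest" => (35 : ℕ)
local notation "vBt" => (36 : ℕ)
local notation "vBm1" => (37 : ℕ)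
local notation "vBs1" => (38 : ℕ)
local notation "vBm2" => (39 : ℕ)
local notation "vBs2" => (40 : ℕ)
local notation "vLen" => (41 : ℕ)

/-- Run `body` for every job `vI`, with its position in the order decided by `e` in `vCnt`. -/
def rankC (e : Expr) (body : Cmd) : Cmd :=
  forC vI vN (vCnt ≔ ♯0 ;; forC vL vN (.cond e (vCnt ≔ #vCnt +ₑ ♯1) .skip) ;; body)

/-- Rule for `rankC`: `body` may rely on `vCnt` holding the rank of `vI` under the order decided by
`e`. -/
theorem rankC_tri {X n G : ℕ} (hX : 2 ≤ X) {e : Expr} {body : Cmd} {s : State}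
    {lt : ℕ → ℕ → Prop} [DecidableRel lt] (Inv : ℕ → State → Prop) (hn : s.var vN = n)
    (hG : (n + 1) * (n + 1) ≤ G) (he : e.deg ≤ 20) (hb : body.degOK = true) (hwv : body.wv = [])
    (hlt : ∀ s', Frame [vI, vCnt, vL] body.wa s s' →
      (e.val s' ≠ 0 ↔ lt (s'.var vL) (s'.var vI)))
    (hI : ∀ i s' s'', Frame [vI, vCnt, vL] [] s' s'' → Inv i s' → Inv i s'')
    (h0 : Inv 0 s)
    (hs : ∀ i s', i < n → Frame [vI, vCnt, vL] body.wa s s' → s'.var vI = i →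
      s'.var vCnt = rankOf lt n i → Inv i s' → s'.Bounded X → body.wp X (Inv (i + 1)) s') :
    Tri X G (rankC e body) s (Inv n) := by
  have hset : ∀ (s : State) v, Frame [vI, vCnt, vL] [] s (s.setVar vI v) := fun s v =>
    ⟨fun x hx => by simp at hx; simp [hx], fun _ _ => rfl⟩
  have hc : (vCnt ≔ ♯0 ;; forC vL vN (.cond e (vCnt ≔ #vCnt +ₑ ♯1) .skip) ;; body).wv =
      [vCnt, vL, vCnt, vL] := by simp [Cmd.wv, forC, hwv]
  have hc' : (vCnt ≔ ♯0 ;; forC vL vN (.cond e (vCnt ≔ #vCnt +ₑ ♯1) .skip) ;; body).wa =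
      body.wa := by simp [Cmd.wa, forC]
  refine Tri.for_le hX (F := n + 1) Inv (by simp [hc]) (by simp [hc]) (by simp) hn (by omega) hG
    (hI 0 _ _ (hset s 0) h0) ?_ fun s' _ h => h
  intro i s' hi hf hvi hInv
  rw [hc, hc'] at hf
  replace hf : Frame [vI, vCnt, vL] body.wa s s' := hf.mono (by simp) (by simp)
  refine Tri.seq (Tri.wp hX (by omega) rfl fun _ => ⟨by simp [Expr.val], ?_⟩)
  have hf1 : Frame [vI, vCnt, vL] [] s' (s'.setVar vCnt 0) :=
    ⟨fun x hx => by simp at hx; simp [hx], fun _ _ => rfl⟩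
  refine Tri.seq (Tri.for_le hX (F := 1) (H := n)
    (fun l s'' => s''.var vCnt = ((Finset.range l).filter fun a => lt a i).card)
    (by simp [Cmd.wv]) (by simp [Cmd.wv]) (by simp) ?_ le_rfl (by omega) (by simp [Expr.val])
    ?_ ?_)
  · simp [← hn, hf.1 vN (by simp)]
  · intro l t hl hft htl hcnt
    have hft' : Frame [vI, vCnt, vL] [] s' t := hf1.trans (hft.mono (by simp [Cmd.wv])
      (by simp [Cmd.wa]))
    have hti : t.var vI = i := by rw [hft.1 vI (by simp [Cmd.wv])]; simpa using hvi
    have hlt' := hlt t (hf.trans (hft'.mono (by simp) (by simp)))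
    rw [htl, hti] at hlt'
    refine Tri.wp hX le_rfl (by simp [Cmd.degOK, he, Expr.deg]) fun hbd => ?_
    rw [Finset.range_add_one, Finset.filter_insert]
    simp only [Cmd.wp]
    split
    · rename_i h
      have hcard : ((Finset.range l).filter fun a => lt a i).card ≤ l :=
        (Finset.card_filter_le _ _).trans (by simp)
      have hnX : n ≤ X := by
        have := hbd.1 vN
        rw [hft'.1 vN (by simp), hf.1 vN (by simp), hn] at this
        exact this
      rw [if_pos (hlt'.1 h), Finset.card_insert_of_notMem (by simp)]
      simp only [Expr.val, hcnt]
      exact ⟨by omega, by simp⟩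
    · rename_i h
      rw [if_neg (fun h' => h (hlt'.2 h'))]
      simp [hcnt]
  · intro t hft hcnt
    have hft' : Frame [vI, vCnt, vL] [] s' t := hf1.trans (hft.mono (by simp [Cmd.wv])
      (by simp [Cmd.wa]))
    have hti : t.var vI = i := by rw [hft.1 vI (by simp [Cmd.wv])]; simpa using hvi
    refine Tri.mono (Tri.wp hX (by omega) hb fun hbd =>
      hs i t hi (hf.trans (hft'.mono (by simp) (by simp))) hti hcnt (hI i s' t hft' hInv) hbd)
      le_rfl fun s'' h => hI _ _ _ (hset s'' _) h

theorem eq_val_ne {s : State} {a b : Expr} : (Expr.eq a b).val s ≠ 0 ↔ a.val s = b.val s := by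
  simp [Expr.val]

theorem lt_val_ne {s : State} {a b : Expr} : (Expr.lt a b).val s ≠ 0 ↔ a.val s < b.val s := by
  simp [Expr.val]

theorem not_lt_val_ne {s : State} {a b : Expr} :
    (♯1 -ₑ .lt a b).val s ≠ 0 ↔ b.val s ≤ a.val s := by
  simp only [Expr.val]; split <;> simp <;> omega

theorem mul_val_ne {s : State} {a b : Expr} :
    (a *ₑ b).val s ≠ 0 ↔ a.val s ≠ 0 ∧ b.val s ≠ 0 := mul_ne_zero_iff

theorem add_val_ne {s : State} {a b : Expr} :
    (a +ₑ b).val s ≠ 0 ↔ a.val s ≠ 0 ∨ b.val s ≠ 0 := by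
  simp only [Expr.val]; omega

/-- Position of the table entry `(j, m, q)`, where `m` and `q` are at most `P`. -/
def enc (P j m q : ℕ) : ℕ := (j * (P + 1) + m) * (P + 1) + q

theorem enc_inj {P j m q j' m' q' : ℕ} (hm : m ≤ P) (hq : q ≤ P) (hm' : m' ≤ P) (hq' : q' ≤ P)
    (h : enc P j m q = enc P j' m' q') : j = j' ∧ m = m' ∧ q = q' := by
  have aux : ∀ {a b c d : ℕ}, b ≤ P → d ≤ P → a * (P + 1) + b = c * (P + 1) + d →
      a = c ∧ b = d := by
    intro a b c d hb hd h
    have h1 : (a * (P + 1) + b) / (P + 1) = a := by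
      rw [mul_comm, Nat.mul_add_div (by omega), Nat.div_eq_of_lt (by omega), add_zero]
    have h2 : (c * (P + 1) + d) / (P + 1) = c := by
      rw [mul_comm, Nat.mul_add_div (by omega), Nat.div_eq_of_lt (by omega), add_zero]
    have : a = c := by rw [← h1, ← h2, h]
    subst this
    exact ⟨rfl, by omega⟩
  obtain ⟨h1, h2⟩ := aux hq hq' h
  obtain ⟨h3, h4⟩ := aux hm hm' h1
  exact ⟨h3, h4, h2⟩

/-- The table cell for the state `(j, m, q)`. -/
def cellE (j m q : Expr) : Expr := (j *ₑ #vP1 +ₑ m) *ₑ #vP1 +ₑ q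

theorem cellE_val {P : ℕ} {s : State} (h : s.var vP1 = P + 1) (j m q : Expr) :
    (cellE j m q).val s = enc P (j.val s) (m.val s) (q.val s) := by
  simp [cellE, Expr.val, enc, h]

section side

variable (fwd : Bool) (ap aw ar aT : ℕ)

/-- The dynamic program whose data are found in the given arrays. -/
def State.dp (s : State) : DP :=
  sideDP fwd (s.var vF) (s.var vQ) (s.var vY) (s.arr ap) (s.arr aw) (s.arr ar)

/-- `dout` of the current item. -/
def doutE : Expr := #vF *ₑ .arr ap #vJ

/-- `din` of the current item. -/
def dinE : Expr := (♯1 -ₑ #vF) *ₑ .arr aw #vJ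

/-- Cost of leaving the current item out in the state `(m, q)`. -/
def coutE (m q : Expr) : Expr :=
  if fwd then #vY *ₑ .arr ap #vJ +ₑ (♯1 -ₑ #vF) *ₑ .arr ap #vJ *ₑ q -ₑ .arr aw #vJ *ₑ m
  else #vY *ₑ .arr ap #vJ +ₑ .arr aw #vJ *ₑ m -ₑ (♯1 -ₑ #vF) *ₑ .arr ap #vJ *ₑ q

/-- Cost of putting the current item in in a state with second component `q`. -/
def cinE (q : Expr) : Expr :=
  if fwd then #vY *ₑ .arr ap #vJ +ₑ #vF *ₑ .arr aw #vJ *ₑ (#vQ -ₑ q)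
  else #vY *ₑ .arr ap #vJ -ₑ #vF *ₑ .arr aw #vJ *ₑ (#vQ -ₑ q)

/-- The entry from which leaving the current item out leads to `(vM, vS)`. -/
def outSrcE : Expr := .arr aT (cellE #vJ #vM (#vS -ₑ doutE ap))

/-- The entry from which putting the current item in leads to `(vM, vS)`. -/
def inSrcE : Expr := .arr aT (cellE #vJ (#vM -ₑ .arr ap #vJ) (#vS -ₑ dinE aw))

/-- Nonzero if the current item can be left out on the way to `(vM, vS)`. -/
def outOkE : Expr :=
  .eq (.arr ar #vJ) ♯0 *ₑ (♯1 -ₑ .lt #vS (doutE ap)) *ₑ .lt ♯0 (outSrcE ap aT)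

/-- Nonzero if the current item can be put in on the way to `(vM, vS)`. -/
def inOkE : Expr :=
  (♯1 -ₑ .lt #vM (.arr ap #vJ)) *ₑ (♯1 -ₑ .lt #vS (dinE aw)) *ₑ .lt ♯0 (inSrcE ap aw aT)

/-- Compute the table entry `(vJ + 1, vM, vS)`. -/
def cellC : Cmd :=
  vOut ≔ ♯0 ;; vIn ≔ ♯0 ;;
  .cond (outOkE ap ar aT)
    (vOut ≔ outSrcE ap aT +ₑ coutE fwd ap aw #vM (#vS -ₑ doutE ap)) .skip ;;
  .cond (inOkE ap aw aT)
    (vIn ≔ inSrcE ap aw aT +ₑ cinE fwd ap aw (#vS -ₑ dinE aw)) .skip ;;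
  .cond (.lt ♯0 #vIn *ₑ (.eq #vOut ♯0 +ₑ .lt #vIn #vOut)) (vOut ≔ #vIn) .skip ;;
  .store aT (cellE (#vJ +ₑ ♯1) #vM #vS) #vOut

/-- Fill the table of the dynamic program. -/
def tableC : Cmd :=
  forC vS vE1 (.store aT #vS ♯1) ;;
  forC vJ vN (forC vM vP1 (forC vS vQ1 (cellC fwd ap aw ar aT)))

variable {fwd ap aw ar aT}

variable {s : State} {P : ℕ}

theorem doutE_val : (doutE ap).val s = (s.dp fwd ap aw ar).dout (s.var vJ) := rfl

theorem dinE_val : (dinE aw).val s = (s.dp fwd ap aw ar).din (s.var vJ) := rfl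

theorem coutE_val (m q : Expr) : (coutE fwd ap aw m q).val s =
    (s.dp fwd ap aw ar).cout (s.var vJ) (m.val s) (q.val s) := by
  cases fwd <;> rfl

theorem cinE_val (q : Expr) (m : ℕ) : (cinE fwd ap aw q).val s =
    (s.dp fwd ap aw ar).cin (s.var vJ) m (q.val s) := by
  cases fwd <;> rfl

theorem outSrcE_val (h : s.var vP1 = P + 1) : (outSrcE ap aT).val s =
    s.arr aT (enc P (s.var vJ) (s.var vM)
      (s.var vS - (s.dp fwd ap aw ar).dout (s.var vJ))) := by
  rw [outSrcE, Expr.val, cellE_val h]; rfl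

theorem inSrcE_val (h : s.var vP1 = P + 1) : (inSrcE ap aw aT).val s =
    s.arr aT (enc P (s.var vJ) (s.var vM - (s.dp fwd ap aw ar).p (s.var vJ))
      (s.var vS - (s.dp fwd ap aw ar).din (s.var vJ))) := by
  rw [inSrcE, Expr.val, cellE_val h]; rfl

theorem outOkE_val (h : s.var vP1 = P + 1) : (outOkE ap ar aT).val s ≠ 0 ↔
    (s.dp fwd ap aw ar).r (s.var vJ) = 0 ∧ (s.dp fwd ap aw ar).dout (s.var vJ) ≤ s.var vS ∧
    s.arr aT (enc P (s.var vJ) (s.var vM)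
      (s.var vS - (s.dp fwd ap aw ar).dout (s.var vJ))) ≠ 0 := by
  rw [← outSrcE_val h]
  simp only [outOkE, mul_val_ne, eq_val_ne, lt_val_ne, not_lt_val_ne, and_assoc]
  simp only [Expr.val, Nat.pos_iff_ne_zero]
  rfl

theorem inOkE_val (h : s.var vP1 = P + 1) : (inOkE ap aw aT).val s ≠ 0 ↔
    (s.dp fwd ap aw ar).p (s.var vJ) ≤ s.var vM ∧
    (s.dp fwd ap aw ar).din (s.var vJ) ≤ s.var vS ∧
    s.arr aT (enc P (s.var vJ) (s.var vM - (s.dp fwd ap aw ar).p (s.var vJ))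
      (s.var vS - (s.dp fwd ap aw ar).din (s.var vJ))) ≠ 0 := by
  rw [← inSrcE_val h]
  simp only [inOkE, mul_val_ne, lt_val_ne, not_lt_val_ne, and_assoc]
  simp only [Expr.val, Nat.pos_iff_ne_zero]
  rfl

theorem cellC_wv : (cellC fwd ap aw ar aT).wv = [vOut, vIn, vOut, vIn, vOut] := by
  simp [cellC, Cmd.wv]

theorem cellC_wa : (cellC fwd ap aw ar aT).wa = [aT] := by
  simp [cellC, Cmd.wa]

theorem cellC_degOK : (cellC fwd ap aw ar aT).degOK = true := by
  cases fwd <;> simp [cellC, Cmd.degOK, Expr.deg, outOkE, inOkE, outSrcE, inSrcE, coutE, cinE,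
    cellE, doutE, dinE]

theorem dp_congr {s s' : State} (h1 : s'.var vF = s.var vF) (h2 : s'.var vQ = s.var vQ)
    (h3 : s'.var vY = s.var vY) (h4 : s'.arr ap = s.arr ap) (h5 : s'.arr aw = s.arr aw)
    (h6 : s'.arr ar = s.arr ar) : s'.dp fwd ap aw ar = s.dp fwd ap aw ar := by
  simp [State.dp, h1, h2, h3, h4, h5, h6]

theorem cellC_tri {X Q C : ℕ} (hX : 2 ≤ X) (hP1 : s.var vP1 = P + 1)
    (hm : s.var vM ≤ P) (hq : s.var vS ≤ Q)
    (hin : ∀ j, ∀ m ≤ P, ∀ q ≤ Q, (s.dp fwd ap aw ar).cin j m q ≤ C)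
    (hout : ∀ j, ∀ m ≤ P, ∀ q ≤ Q, (s.dp fwd ap aw ar).cout j m q ≤ C)
    (hCX : 1 + s.var vJ * C + C ≤ X)
    (hT : ∀ m ≤ P, ∀ q ≤ Q, s.arr aT (enc P (s.var vJ) m q) =
      (s.dp fwd ap aw ar).T (s.var vJ) m q) :
    Tri X 1 (cellC fwd ap aw ar aT) s (fun s' => s'.arr aT =
      Function.update (s.arr aT) (enc P (s.var vJ + 1) (s.var vM) (s.var vS))
        ((s.dp fwd ap aw ar).T (s.var vJ + 1) (s.var vM) (s.var vS))) := by
  set D := s.dp fwd ap aw ar with hD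
  set j := s.var vJ with hj
  set m := s.var vM with hmd
  set q := s.var vS with hqd
  have hTb : ∀ m ≤ P, ∀ q ≤ Q, D.T j m q ≤ 1 + j * C := fun m hm q hq =>
    DP.T_bound hin hout hm hq
  have hov : D.outVal (D.T j) j m q ≤ X := le_trans (DP.outVal_le
    (fun q' h' => hTb m hm q' (h'.trans hq)) fun q' h' => hout j m hm q' (h'.trans hq)) hCX
  have hiv : D.inVal (D.T j) j m q ≤ X := le_trans (DP.inVal_le
    (fun m' hm' q' hq' => hTb m' (hm'.trans hm) q' (hq'.trans hq))
    fun m' hm' q' hq' => hin j m' (hm'.trans hm) q' (hq'.trans hq)) hCX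
  -- The three conditionals compute `outVal`, `inVal` and the better of the two.
  refine Tri.seq (Tri.wp hX le_rfl (by simp [Cmd.degOK, Expr.deg]) fun _ =>
    ⟨by simp [Expr.val], ?_⟩)
  refine Tri.seq (Tri.wp hX le_rfl (by simp [Cmd.degOK, Expr.deg]) fun _ =>
    ⟨by simp [Expr.val], ?_⟩)
  have hdeg := cellC_degOK (fwd := fwd) (ap := ap) (aw := aw) (ar := ar) (aT := aT)
  simp only [cellC, Cmd.degOK, Bool.and_eq_true] at hdeg
  simp only [Expr.val]
  set s1 := (s.setVar vOut 0).setVar vIn 0 with hs1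
  have e1 : s1.dp fwd ap aw ar = D := dp_congr (by simp [hs1]) (by simp [hs1]) (by simp [hs1])
    rfl rfl rfl
  refine Tri.seq (Tri.mono (Q := fun s' => s' = s1.setVar vOut (D.outVal (D.T j) j m q))
    (Tri.wp hX le_rfl (by simp only [Cmd.degOK, Bool.and_eq_true]; exact hdeg.2.2.1)
      fun _ => ?_) le_rfl ?_)
  · have hok := outOkE_val (s := s1) (fwd := fwd) (ap := ap) (aw := aw) (ar := ar) (aT := aT)
      (P := P) (by simp [hs1, hP1])
    have hsrc := outSrcE_val (s := s1) (fwd := fwd) (ap := ap) (aw := aw) (ar := ar) (aT := aT)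
      (P := P) (by simp [hs1, hP1])
    rw [e1] at hok hsrc
    simp only [Cmd.wp]
    have a1 : s1.arr = s.arr := rfl
    have a2 : s1.var vJ = j := by simp [hs1, hj]
    have a3 : s1.var vM = m := by simp [hs1, hmd]
    have a4 : s1.var vS = q := by simp [hs1, hqd]
    rw [a1, a2, a3, a4, hT m hm _ ((Nat.sub_le _ _).trans hq)] at hok hsrc
    by_cases h : (outOkE ap ar aT).val s1 ≠ 0
    · have hv : D.outVal (D.T j) j m q =
          (outSrcE ap aT +ₑ coutE fwd ap aw #vM (#vS -ₑ doutE ap)).val s1 := by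
        rw [DP.outVal, if_pos (hok.1 h)]
        simp only [Expr.val, hsrc, coutE_val (ar := ar), doutE_val (fwd := fwd) (aw := aw)
          (ar := ar), e1, a2, a3, a4]
      rw [if_pos h, ← hv]
      exact ⟨hov, rfl⟩
    · have hv : D.outVal (D.T j) j m q = 0 := by
        rw [DP.outVal, if_neg fun h' => h (hok.2 h')]
      rw [if_neg h, hv]
      simp only [hs1, State.setVar]
      congr 1
      ext x
      simp only [Function.update_apply]
      split_ifs <;> simp_all
  rintro _ rfl
  set s2 := s1.setVar vOut (D.outVal (D.T j) j m q) with hs2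
  have e2 : s2.dp fwd ap aw ar = D := e1 ▸ dp_congr (by simp [hs2]) (by simp [hs2]) (by simp [hs2])
    rfl rfl rfl
  refine Tri.seq (Tri.mono (Q := fun s' => s' = s2.setVar vIn (D.inVal (D.T j) j m q))
    (Tri.wp hX le_rfl (by simp only [Cmd.degOK, Bool.and_eq_true]; exact hdeg.2.2.2.1)
      fun _ => ?_) le_rfl ?_)
  · have hok := inOkE_val (s := s2) (fwd := fwd) (ap := ap) (aw := aw) (ar := ar) (aT := aT)
      (P := P) (by simp [hs2, hs1, hP1])
    have hsrc := inSrcE_val (s := s2) (fwd := fwd) (ap := ap) (aw := aw) (ar := ar) (aT := aT)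
      (P := P) (by simp [hs2, hs1, hP1])
    rw [e2] at hok hsrc
    simp only [Cmd.wp]
    have a1 : s2.arr = s.arr := rfl
    have a2 : s2.var vJ = j := by simp [hs2, hs1, hj]
    have a3 : s2.var vM = m := by simp [hs2, hs1, hmd]
    have a4 : s2.var vS = q := by simp [hs2, hs1, hqd]
    rw [a1, a2, a3, a4, hT _ ((Nat.sub_le _ _).trans hm) _ ((Nat.sub_le _ _).trans hq)] at hok hsrc
    by_cases h : (inOkE ap aw aT).val s2 ≠ 0
    · have hv : D.inVal (D.T j) j m q =
          (inSrcE ap aw aT +ₑ cinE fwd ap aw (#vS -ₑ dinE aw)).val s2 := by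
        rw [DP.inVal, if_pos (hok.1 h)]
        simp only [Expr.val, hsrc, cinE_val (ar := ar) _ (m - D.p j), dinE_val (fwd := fwd)
          (ap := ap) (ar := ar), e2, a2, a4]
      rw [if_pos h, ← hv]
      exact ⟨hiv, rfl⟩
    · have hv : D.inVal (D.T j) j m q = 0 := by
        rw [DP.inVal, if_neg fun h' => h (hok.2 h')]
      rw [if_neg h, hv]
      simp only [hs2, hs1, State.setVar]
      congr 1
      ext x
      simp only [Function.update_apply]
      split_ifs <;> simp_all
  rintro _ rfl
  have hst : ∀ s4 : State, s4.arr = s.arr → s4.var vP1 = P + 1 → s4.var vJ = j → s4.var vM = m →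
      s4.var vS = q → s4.var vOut = D.T (j + 1) m q → s4.var vOut ≤ X →
      (Cmd.store aT (cellE (#vJ +ₑ ♯1) #vM #vS) #vOut).wp X (fun s' => s'.arr aT =
        Function.update (s.arr aT) (enc P (j + 1) m q) (D.T (j + 1) m q)) s4 := by
    intro s4 h1 h2 h3 h4 h5 h6 h7
    refine ⟨h7, ?_⟩
    rw [cellE_val h2]
    simp [Expr.val, h1, h3, h4, h5, h6]
  refine Tri.wp hX le_rfl (by simp only [Cmd.degOK, Bool.and_eq_true]; exact hdeg.2.2.2.2)
      fun _ => ?_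
  simp only [Cmd.wp]
  split
  · rename_i h
    simp only [mul_val_ne, add_val_ne, eq_val_ne, lt_val_ne] at h
    have hT' : D.T (j + 1) m q = D.inVal (D.T j) j m q := by
      refine if_pos ⟨?_, ?_⟩
      · simpa [Expr.val, Nat.pos_iff_ne_zero] using h.1
      · simpa [Expr.val, hs2] using h.2
    refine ⟨by simpa [Expr.val] using hiv, hst _ rfl ?_ ?_ ?_ ?_ ?_ ?_⟩ <;>
      simp [Expr.val, hs2, hs1, hP1, ← hj, ← hmd, ← hqd, hT', hiv]
  · rename_i h
    have hT' : D.T (j + 1) m q = D.outVal (D.T j) j m q := by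
      refine if_neg fun hc => h ?_
      simp only [mul_val_ne, add_val_ne, eq_val_ne, lt_val_ne]
      exact ⟨by simpa [Expr.val, Nat.pos_iff_ne_zero] using hc.1,
        by simpa [Expr.val, hs2] using hc.2⟩
    refine hst _ rfl ?_ ?_ ?_ ?_ ?_ ?_ <;>
      simp [hs2, hs1, hP1, ← hj, ← hmd, ← hqd, hT', hov]

end side

/-! ### Filling a table -/

section side

variable {fwd : Bool} {ap aw ar aT : ℕ} {s : State} {P : ℕ}

/-- The table in array `aT` is right in all layers up to `j`, and in layer `j + 1` before
`(m, q)`. -/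
def Filled (D : DP) (aT P Q j m q : ℕ) (s : State) : Prop :=
  ∀ j' m' q', m' ≤ P → q' ≤ Q → (j' ≤ j ∨ j' = j + 1 ∧ (m' < m ∨ m' = m ∧ q' < q)) →
    s.arr aT (enc P j' m' q') = D.T j' m' q'

theorem tableC_tri {X n Q C G : ℕ} (hX : 2 ≤ X) (hn : s.var vN = n) (hP1 : s.var vP1 = P + 1)
    (hQ1 : s.var vQ1 = Q + 1) (hE1 : s.var vE1 = (s.dp fwd ap aw ar).e + 1) (hQP : Q ≤ P)
    (heQ : (s.dp fwd ap aw ar).e ≤ Q)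
    (hap : ap ≠ aT) (haw : aw ≠ aT) (har : ar ≠ aT)
    (hin : ∀ j, ∀ m ≤ P, ∀ q ≤ Q, (s.dp fwd ap aw ar).cin j m q ≤ C)
    (hout : ∀ j, ∀ m ≤ P, ∀ q ≤ Q, (s.dp fwd ap aw ar).cout j m q ≤ C)
    (hCX : 1 + n * C ≤ X) (hG : (n + 1) * ((P + 2) * (Q + 2)) ≤ G) (h0 : ∀ i, s.arr aT i = 0) :
    Tri X G (tableC fwd ap aw ar aT) s (fun s' => ∀ j ≤ n, ∀ m ≤ P, ∀ q ≤ Q,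
      s'.arr aT (enc P j m q) = (s.dp fwd ap aw ar).T j m q) := by
  set D := s.dp fwd ap aw ar with hD
  have hG1 : (P + 2) * (Q + 2) ≤ G := le_trans (Nat.le_mul_of_pos_left _ (by omega)) hG
  have hG2 : Q + 2 ≤ G := le_trans (Nat.le_mul_of_pos_left _ (by omega)) hG1
  -- The first layer.
  refine Tri.seq (Tri.for_le hX (F := 1)
    (fun i s' => ∀ a, s'.arr aT a = if a < i then 1 else 0)
    (by simp [Cmd.wv]) (by simp [Cmd.wv]) (by simp) hE1 le_rfl (by omega) (by simpa using h0) ?_ ?_)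
  · intro i s' _ _ hi hI
    refine Tri.wp hX le_rfl (by simp [Cmd.degOK, Expr.deg]) fun _ => ?_
    simp only [Cmd.wp, Expr.val, hi]
    refine ⟨by omega, fun a => ?_⟩
    simp only [State.setVar_arr, State.setArr_arr, if_true, Function.update_apply, hI]
    by_cases ha : a = i
    · simp [ha]
    · have : a < i + 1 ↔ a < i := by omega
      simp [ha, this]
  intro s1 hf1 hI1
  replace hf1 : Frame [vS] [aT] s s1 := hf1
  have hbase : Filled D aT P Q 0 0 0 s1 := by
    intro j' m' q' hm' hq' h
    obtain rfl : j' = 0 := by omega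
    rw [hI1, DP.T]
    refine if_congr ?_ rfl rfl
    simp only [enc, zero_mul, zero_add]
    constructor
    · intro h
      rcases Nat.eq_zero_or_pos m' with rfl | hpos
      · exact ⟨rfl, by omega⟩
      · have : 1 * (P + 1) ≤ m' * (P + 1) := Nat.mul_le_mul_right _ hpos
        omega
    · rintro ⟨rfl, h⟩; omega
  have hframe : ∀ s', Frame [vJ, vM, vS, vOut, vIn] [aT] s s' →
      s'.dp fwd ap aw ar = D ∧ s'.var vN = n ∧ s'.var vP1 = P + 1 ∧ s'.var vQ1 = Q + 1 := by
    intro s' hf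
    refine ⟨dp_congr (hf.1 _ (by simp)) (hf.1 _ (by simp)) (hf.1 _ (by simp))
      (hf.2 _ (by simpa using hap)) (hf.2 _ (by simpa using haw)) (hf.2 _ (by simpa using har)),
      ?_, ?_, ?_⟩
    · rw [hf.1 _ (by simp), hn]
    · rw [hf.1 _ (by simp), hP1]
    · rw [hf.1 _ (by simp), hQ1]
  have hF1 : Frame [vJ, vM, vS, vOut, vIn] [aT] s s1 := hf1.mono (by simp) (by simp)
  -- The remaining layers.
  refine Tri.for_le hX (F := (P + 2) * (Q + 2)) (fun j => Filled D aT P Q j 0 0)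
    (by simp [Cmd.wv, forC, cellC_wv]) (by simp [Cmd.wv, forC, cellC_wv]) (by simp)
    (hframe s1 hF1).2.1 (Nat.mul_pos (by omega) (by omega)) (by rw [mul_comm]; exact hG) hbase ?_ ?_
  · intro j s2 hj hf2 hvj hI2
    have hF2 : Frame [vJ, vM, vS, vOut, vIn] [aT] s s2 := hF1.trans (hf2.mono
      (by simp [Cmd.wv, forC, cellC_wv]) (by simp [Cmd.wa, forC, cellC_wa]))
    refine Tri.for_le hX (F := Q + 2) (fun m => Filled D aT P Q j m 0)
      (by simp [Cmd.wv, forC, cellC_wv]) (by simp [Cmd.wv, forC, cellC_wv]) (by simp)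
      (hframe s2 hF2).2.2.1 (by omega) (by rw [mul_comm]) hI2 ?_ ?_
    · intro m s3 hm hf3 hvm hI3
      have hF3 : Frame [vJ, vM, vS, vOut, vIn] [aT] s s3 := hF2.trans (hf3.mono
        (by simp [Cmd.wv, forC, cellC_wv]) (by simp [Cmd.wa, forC, cellC_wa]))
      have hvj3 : s3.var vJ = j := by
        rw [hf3.1 _ (by simp [Cmd.wv, forC, cellC_wv]), hvj]
      refine Tri.for_le hX (F := 1) (fun q => Filled D aT P Q j m q)
        (by simp [cellC_wv]) (by simp [cellC_wv]) (by simp)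
        (hframe s3 hF3).2.2.2 (by omega) (by omega) hI3 ?_ ?_
      · intro q s4 hq hf4 hvq hI4
        have hF4 : Frame [vJ, vM, vS, vOut, vIn] [aT] s s4 := hF3.trans (hf4.mono
          (by simp [cellC_wv]) (by simp [cellC_wa]))
        have hvj4 : s4.var vJ = j := by rw [hf4.1 _ (by simp [cellC_wv]), hvj3]
        have hvm4 : s4.var vM = m := by rw [hf4.1 _ (by simp [cellC_wv]), hvm]
        have hd := (hframe s4 hF4).1
        have hjC : (j + 1) * C ≤ n * C := Nat.mul_le_mul_right _ hj
        rw [add_mul, one_mul] at hjC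
        refine Tri.mono (cellC_tri (Q := Q) (C := C) hX (hframe s4 hF4).2.2.1 (by omega)
          (by omega) (by rw [hd]; exact hin) (by rw [hd]; exact hout) (by rw [hvj4]; omega)
          ?_) le_rfl ?_
        · intro m' hm' q' hq'
          rw [hd, hvj4]
          exact hI4 j m' q' hm' hq' (Or.inl le_rfl)
        · intro s5 h5 j' m' q' hm' hq' h
          rw [hd, hvj4, hvm4, hvq] at h5
          rw [State.setVar_arr, h5, Function.update_apply]
          split
          · rename_i he
            obtain ⟨rfl, rfl, rfl⟩ := enc_inj hm' (by omega) (by omega) (by omega) he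
            rfl
          · rename_i hne
            refine hI4 j' m' q' hm' hq' ?_
            by_contra hc
            have : j' = j + 1 ∧ m' = m ∧ q' = q := by omega
            exact hne (by rw [this.1, this.2.1, this.2.2])
      · intro s4 _ h4 j' m' q' hm' hq' h
        exact h4 j' m' q' hm' hq' (by omega)
    · intro s3 _ h3 j' m' q' hm' hq' h
      exact h3 j' m' q' hm' hq' (by omega)
  · intro s2 _ h2 j hj m hm q hq
    exact h2 j m q hm hq (Or.inl hj)

end side

/-! ### Combining the two sides -/

/-- The table entry for the current amount of processing time on the far side. -/
def src2E : Expr := .arr 12 (cellE (#vN -ₑ #vT) #vC #vS)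

/-- The table entry for the complementary amount of processing time on the near side. -/
def src1E : Expr := .arr 11 (cellE #vT (#vKc -ₑ #vC) #vS)

/-- Update the best choice for the far side. -/
def pick2C : Cmd :=
  .cond ((♯1 -ₑ .lt #vS #vE) *ₑ .lt ♯0 src2E *ₑ (.eq #vB2 ♯0 +ₑ .lt src2E #vB2))
    (vB2 ≔ src2E ;; vM2 ≔ #vC ;; vS2 ≔ #vS) .skip

/-- Update the best choice for both sides. -/
def pick1C : Cmd :=
  .cond ((♯1 -ₑ .lt #vS #vE) *ₑ .lt ♯0 src1E *ₑ .lt ♯0 #vB2 *ₑ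
      (.eq #vBest ♯0 +ₑ .lt (src1E +ₑ #vB2) #vBest))
    (vBest ≔ src1E +ₑ #vB2 ;; vBt ≔ #vT ;; vBm1 ≔ #vKc -ₑ #vC ;; vBs1 ≔ #vS ;;
      vBm2 ≔ #vM2 ;; vBs2 ≔ #vS2) .skip

/-- Find the best threshold and table entries for the two sides.  For each threshold, `vC` runs
through the processing time left for the far side, the rest of the budget being used up on the
near side. -/
def combineC : Cmd :=
  vBest ≔ ♯0 ;;
  forC vT vN1 (vB2 ≔ ♯0 ;; forC vC vK1 (forC vS vQ1 pick2C ;; forC vS vQ1 pick1C))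

/-- `vB2` is the least nonzero value of `t` on `S`, attained at `(vM2, vS2)`, or `0`. -/
structure Best2 (t : ℕ → ℕ → ℕ) (S : ℕ → ℕ → Prop) (s : State) : Prop where
  low : ∀ c q, S c q → t c q ≠ 0 → s.var vB2 ≠ 0 ∧ s.var vB2 ≤ t c q
  att : s.var vB2 ≠ 0 → S (s.var vM2) (s.var vS2) ∧ s.var vB2 = t (s.var vM2) (s.var vS2)

/-- `vBest` is the least sum of nonzero values on the two sides, for thresholds, budgets and
near-side states in `S`, or `0`. -/
structure BestAll (t₁ t₂ : ℕ → ℕ → ℕ → ℕ) (n e Q K : ℕ) (S : ℕ → ℕ → ℕ → Prop) (s : State) :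
    Prop where
  low : ∀ k c q, S k c q → e ≤ q → q ≤ Q → t₁ k (K - c) q ≠ 0 → ∀ m₂ ≤ c, ∀ q₂, e ≤ q₂ → q₂ ≤ Q →
    t₂ (n - k) m₂ q₂ ≠ 0 →
    s.var vBest ≠ 0 ∧ s.var vBest ≤ t₁ k (K - c) q + t₂ (n - k) m₂ q₂
  att : s.var vBest ≠ 0 → s.var vBt ≤ n ∧ s.var vBm1 + s.var vBm2 ≤ K ∧
    (e ≤ s.var vBs1 ∧ s.var vBs1 ≤ Q) ∧ (e ≤ s.var vBs2 ∧ s.var vBs2 ≤ Q) ∧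
    t₁ (s.var vBt) (s.var vBm1) (s.var vBs1) ≠ 0 ∧
    t₂ (n - s.var vBt) (s.var vBm2) (s.var vBs2) ≠ 0 ∧
    s.var vBest = t₁ (s.var vBt) (s.var vBm1) (s.var vBs1) +
      t₂ (n - s.var vBt) (s.var vBm2) (s.var vBs2)

theorem Best2.congr {t : ℕ → ℕ → ℕ} {S S' : ℕ → ℕ → Prop} {s s' : State} (h : Best2 t S s)
    (hS : ∀ c q, S c q ↔ S' c q) (h1 : s'.var vB2 = s.var vB2) (h2 : s'.var vM2 = s.var vM2)
    (h3 : s'.var vS2 = s.var vS2) : Best2 t S' s' := by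
  refine ⟨fun c q hs ht => ?_, fun hb => ?_⟩
  · rw [h1]; exact h.low c q ((hS c q).2 hs) ht
  · rw [h1] at hb
    rw [h1, h2, h3, ← hS]; exact h.att hb

theorem BestAll.congr {t₁ t₂ : ℕ → ℕ → ℕ → ℕ} {n e Q K : ℕ} {S S' : ℕ → ℕ → ℕ → Prop}
    {s s' : State} (h : BestAll t₁ t₂ n e Q K S s)
    (hS : ∀ k c q, q ≤ Q → S' k c q → S k c q)
    (hv : ∀ x, 35 ≤ x → x ≤ 40 → s'.var x = s.var x) : BestAll t₁ t₂ n e Q K S' s' := by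
  refine ⟨fun k c q hs h1 h2 => ?_, fun hb => ?_⟩
  · rw [hv 35 (by norm_num) (by norm_num)]; exact h.low k c q (hS k c q h2 hs) h1 h2
  · rw [hv 35 (by norm_num) (by norm_num)] at hb ⊢
    rw [hv 36 (by norm_num) (by norm_num), hv 37 (by norm_num) (by norm_num),
      hv 38 (by norm_num) (by norm_num), hv 39 (by norm_num) (by norm_num),
      hv 40 (by norm_num) (by norm_num)]
    exact h.att hb

theorem pick2C_wv : pick2C.wv = [vB2, vM2, vS2] := rfl
theorem pick1C_wv : pick1C.wv = [vBest, vBt, vBm1, vBs1, vBm2, vBs2] := rfl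
theorem pick2C_wa : pick2C.wa = [] := rfl
theorem pick1C_wa : pick1C.wa = [] := rfl

theorem pick2C_tri {X e c q : ℕ} (hX : 2 ≤ X) {s : State} {t : ℕ → ℕ → ℕ} {S : ℕ → ℕ → Prop}
    (he : s.var vE = e) (hc : s.var vC = c) (hq : s.var vS = q)
    (ht : src2E.val s = t c q) (hB : Best2 t S s) :
    Tri X 1 pick2C s (Best2 t (fun c' q' => S c' q' ∨ c' = c ∧ q' = q ∧ e ≤ q)) := by
  refine Tri.wp hX le_rfl (by simp [pick2C, Cmd.degOK, Expr.deg, src2E, cellE]) fun hb => ?_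
  have htX : t c q ≤ X := ht ▸ hb.2 _ _
  simp only [pick2C, Cmd.wp]
  simp only [mul_val_ne, add_val_ne, eq_val_ne, lt_val_ne, not_lt_val_ne, ht]
  simp only [Expr.val, he, hc, hq, State.setVar_var]
  have hcX : c ≤ X := hc ▸ hb.1 _
  have hqX : q ≤ X := hq ▸ hb.1 _
  split
  · rename_i h
    refine ⟨htX, by simpa using hcX, by simpa using hqX, ⟨fun c' q' hs ht' => ?_, fun _ => ?_⟩⟩
    · simp only [State.setVar_var]
      simp only [show (32 : ℕ) ≠ 34 by norm_num, show (32 : ℕ) ≠ 33 by norm_num, if_false, if_true]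
      refine ⟨by omega, ?_⟩
      rcases hs with hs | ⟨rfl, rfl, _⟩
      · obtain ⟨h1, h2⟩ := hB.low c' q' hs ht'
        omega
      · exact le_rfl
    · simp [h.1.1]
  · rename_i h
    refine ⟨fun c' q' hs ht' => ?_, fun hb => ?_⟩
    · rcases hs with hs | ⟨rfl, rfl, heq⟩
      · exact hB.low c' q' hs ht'
      · by_contra hcon
        refine h ⟨⟨heq, by omega⟩, by omega⟩
    · exact ⟨Or.inl (hB.att hb).1, (hB.att hb).2⟩

theorem pick1C_tri {X n e Q K k c q Z : ℕ} (hX : 2 ≤ X) {s : State} {t₁ t₂ : ℕ → ℕ → ℕ → ℕ}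
    {S : ℕ → ℕ → ℕ → Prop} (he : s.var vE = e) (hc : s.var vC = c) (hq : s.var vS = q)
    (hK : s.var vKc = K) (hk : s.var vT = k) (hkn : k ≤ n) (hcK : c ≤ K) (hqQ : q ≤ Q)
    (ht : src1E.val s = t₁ k (K - c) q) (hZ : 2 * Z ≤ X) (h1Z : t₁ k (K - c) q ≤ Z)
    (h2Z : ∀ c' ≤ c, ∀ q' ≤ Q, t₂ (n - k) c' q' ≤ Z)
    (h2 : Best2 (t₂ (n - k)) (fun c' q' => c' ≤ c ∧ e ≤ q' ∧ q' ≤ Q) s)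
    (hB : BestAll t₁ t₂ n e Q K S s) :
    Tri X 1 pick1C s
      (BestAll t₁ t₂ n e Q K (fun k' c' q' => S k' c' q' ∨ k' = k ∧ c' = c ∧ q' = q)) := by
  refine Tri.wp hX le_rfl (by simp [pick1C, Cmd.degOK, Expr.deg, src1E, cellE]) fun hb => ?_
  simp only [pick1C, Cmd.wp]
  simp only [mul_val_ne, add_val_ne, eq_val_ne, lt_val_ne, not_lt_val_ne]
  have hsum : (src1E +ₑ #vB2).val s = t₁ k (K - c) q + s.var vB2 := by rw [Expr.val, ht]; rfl
  rw [ht, hsum]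
  simp only [Expr.val, he, hc, hq, hk, hK, State.setVar_var]
  split
  · rename_i h
    have hb2 : s.var vB2 ≠ 0 := by omega
    obtain ⟨⟨a1, a2, a3⟩, a4⟩ := h2.att hb2
    have hb2Z := h2Z _ a1 _ a3
    rw [← a4] at hb2Z
    have hkX : k ≤ X := hk ▸ hb.1 _
    have hKX : K ≤ X := hK ▸ hb.1 _
    have hqX : q ≤ X := hq ▸ hb.1 _
    have hmX := hb.1 33
    have hsX := hb.1 34
    simp only [Nat.reduceEqDiff, if_false]
    refine ⟨by omega, hkX, by omega, hqX, hmX, hsX,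
      ⟨fun k' c' q' hs e1 e2 ht1 m2 hm2 q2 e3 e4 ht2 => ?_, fun _ => ?_⟩⟩
    · simp only [State.setVar_var, Nat.reduceEqDiff, if_false, if_true]
      refine ⟨by omega, ?_⟩
      rcases hs with hs | ⟨rfl, rfl, rfl⟩
      · obtain ⟨h3, h4⟩ := hB.low k' c' q' hs e1 e2 ht1 m2 hm2 q2 e3 e4 ht2
        omega
      · have := (h2.low m2 q2 ⟨hm2, e3, e4⟩ ht2).2
        omega
    · simp only [State.setVar_var, Nat.reduceEqDiff, if_false, if_true, ← a4]
      exact ⟨hkn, by omega, ⟨h.1.1.1, hqQ⟩, ⟨a2, a3⟩, by omega, hb2, trivial⟩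
  · rename_i h
    refine ⟨fun k' c' q' hs e1 e2 ht1 m2 hm2 q2 e3 e4 ht2 => ?_, hB.att⟩
    rcases hs with hs | ⟨rfl, rfl, rfl⟩
    · exact hB.low k' c' q' hs e1 e2 ht1 m2 hm2 q2 e3 e4 ht2
    · have := h2.low m2 q2 ⟨hm2, e3, e4⟩ ht2
      by_contra hcon
      exact h ⟨⟨⟨e1, by omega⟩, by omega⟩, by omega⟩

/-- What the search over both sides finds. -/
structure Combined (t₁ t₂ : ℕ → ℕ → ℕ → ℕ) (n e Q K : ℕ) (s : State) : Prop where
  low : ∀ k ≤ n, ∀ m₁ m₂ q₁ q₂, m₁ + m₂ ≤ K → e ≤ q₁ → q₁ ≤ Q → e ≤ q₂ → q₂ ≤ Q →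
    t₁ k m₁ q₁ ≠ 0 → t₂ (n - k) m₂ q₂ ≠ 0 →
    s.var vBest ≠ 0 ∧ s.var vBest ≤ t₁ k m₁ q₁ + t₂ (n - k) m₂ q₂
  att : s.var vBest ≠ 0 → s.var vBt ≤ n ∧ s.var vBm1 + s.var vBm2 ≤ K ∧
    (e ≤ s.var vBs1 ∧ s.var vBs1 ≤ Q) ∧ (e ≤ s.var vBs2 ∧ s.var vBs2 ≤ Q) ∧
    t₁ (s.var vBt) (s.var vBm1) (s.var vBs1) ≠ 0 ∧
    t₂ (n - s.var vBt) (s.var vBm2) (s.var vBs2) ≠ 0 ∧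
    s.var vBest = t₁ (s.var vBt) (s.var vBm1) (s.var vBs1) +
      t₂ (n - s.var vBt) (s.var vBm2) (s.var vBs2)

theorem combineC_tri {X n P Q K e Z G : ℕ} (hX : 2 ≤ X) {s : State} {t₁ t₂ : ℕ → ℕ → ℕ → ℕ}
    (hn : s.var vN = n) (hN1 : s.var vN1 = n + 1) (hP1 : s.var vP1 = P + 1)
    (hQ1 : s.var vQ1 = Q + 1) (hK1 : s.var vK1 = K + 1) (hK : s.var vKc = K) (he : s.var vE = e)
    (hKP : K ≤ P) (hZ : 2 * Z ≤ X)
    (ht1 : ∀ j ≤ n, ∀ m ≤ P, ∀ q ≤ Q, s.arr 11 (enc P j m q) = t₁ j m q)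
    (ht2 : ∀ j ≤ n, ∀ m ≤ P, ∀ q ≤ Q, s.arr 12 (enc P j m q) = t₂ j m q)
    (h1Z : ∀ j ≤ n, ∀ m ≤ P, ∀ q ≤ Q, t₁ j m q ≤ Z)
    (h2Z : ∀ j ≤ n, ∀ m ≤ P, ∀ q ≤ Q, t₂ j m q ≤ Z)
    (hG : (n + 2) * ((P + 2) * (Q + 2)) ≤ G) :
    Tri X G combineC s (Combined t₁ t₂ n e Q K) := by
  have hframe : ∀ s',
      Frame [vT, vB2, vC, vS, vM2, vS2, vBest, vBt, vBm1, vBs1, vBm2, vBs2] [] s s' →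
      s'.var vN = n ∧ s'.var vN1 = n + 1 ∧ s'.var vP1 = P + 1 ∧ s'.var vQ1 = Q + 1 ∧
      s'.var vK1 = K + 1 ∧ s'.var vKc = K ∧ s'.var vE = e ∧ s'.arr 11 = s.arr 11 ∧
      s'.arr 12 = s.arr 12 := by
    intro s' hf
    refine ⟨?_, ?_, ?_, ?_, ?_, ?_, ?_, hf.2 _ (by simp), hf.2 _ (by simp)⟩ <;>
      rw [hf.1 _ (by simp)] <;> assumption
  have hpos : 0 < (P + 2) * (Q + 2) := by positivity
  refine Tri.seq (Tri.wp hX (by nlinarith) rfl fun _ => ⟨by simp [Expr.val], ?_⟩)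
  set s0 := s.setVar vBest ((♯0 : Expr).val s) with hs0
  have hF0 : Frame [vT, vB2, vC, vS, vM2, vS2, vBest, vBt, vBm1, vBs1, vBm2, vBs2] [] s s0 :=
    ⟨fun x hx => by simp at hx; simp [hs0, hx], fun _ _ => rfl⟩
  refine Tri.for_le hX (F := (P + 2) * (Q + 2))
    (fun k => BestAll t₁ t₂ n e Q K (fun k' c' _ => k' < k ∧ c' ≤ K))
    (by simp [Cmd.wv, forC, pick1C_wv, pick2C_wv]) (by simp [Cmd.wv, forC, pick1C_wv, pick2C_wv])
    (by simp) (hframe s0 hF0).2.1 hpos (by rw [mul_comm]; exact hG)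
    ⟨fun k c q h => by omega, fun h => absurd (by simp [hs0, Expr.val]) h⟩ ?_ ?_
  · intro k s1 hk hf1 hvk hI1
    have hF1 := hF0.trans (hf1.mono
      (ys := [vT, vB2, vC, vS, vM2, vS2, vBest, vBt, vBm1, vBs1, vBm2, vBs2]) (Bs := [])
      (by simp [Cmd.wv, forC, pick1C_wv, pick2C_wv])
      (by simp [Cmd.wa, forC, pick1C_wa, pick2C_wa]))
    refine Tri.seq (Tri.wp hX (by omega) rfl fun _ => ⟨by simp [Expr.val], ?_⟩)
    set s2 := s1.setVar vB2 ((♯0 : Expr).val s1) with hs2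
    have hF2 : Frame [vT, vB2, vC, vS, vM2, vS2, vBest, vBt, vBm1, vBs1, vBm2, vBs2] [] s s2 :=
      hF1.trans ⟨fun x hx => by simp at hx; simp [hs2, hx], fun _ _ => rfl⟩
    have hKb : (Q + 2) * (K + 2) ≤ (P + 2) * (Q + 2) := by
      rw [mul_comm]; exact Nat.mul_le_mul_right _ (by omega)
    refine Tri.for_le hX (F := Q + 2)
      (fun c s' => BestAll t₁ t₂ n e Q K (fun k' c' _ => (k' < k ∧ c' ≤ K) ∨ k' = k ∧ c' < c) s' ∧
        Best2 (t₂ (n - k)) (fun c' q' => c' < c ∧ e ≤ q' ∧ q' ≤ Q) s')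
      (by simp [Cmd.wv, forC, pick1C_wv, pick2C_wv]) (by simp [Cmd.wv, forC, pick1C_wv, pick2C_wv])
      (by simp) (hframe s2 hF2).2.2.2.2.1 (by omega) hKb
      ⟨hI1.congr (fun k' c' _ _ h => by omega) (fun x hx hx' => by
        simp [hs2, show x ≠ 31 by omega, show x ≠ 32 by omega]),
        fun c q h => by omega, fun h => absurd (by simp [hs2, Expr.val]) h⟩ ?_ ?_
    · rintro c s3 hc hf3 hvc ⟨hI3, hB3⟩
      have hF3 := hF2.trans (hf3.mono
        (ys := [vT, vB2, vC, vS, vM2, vS2, vBest, vBt, vBm1, vBs1, vBm2, vBs2]) (Bs := [])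
        (by simp [Cmd.wv, forC, pick1C_wv, pick2C_wv])
        (by simp [Cmd.wa, forC, pick1C_wa, pick2C_wa]))
      have hvk3 : s3.var vT = k := by
        rw [hf3.1 _ (by simp [Cmd.wv, forC, pick1C_wv, pick2C_wv])]; simpa [hs2] using hvk
      refine Tri.seq (Tri.for_le hX (F := 1)
        (fun q s' => BestAll t₁ t₂ n e Q K (fun k' c' _ => (k' < k ∧ c' ≤ K) ∨ k' = k ∧ c' < c) s' ∧
          Best2 (t₂ (n - k)) (fun c' q' => (c' < c ∨ c' = c ∧ q' < q) ∧ e ≤ q' ∧ q' ≤ Q) s')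
        (by simp [pick2C_wv]) (by simp [pick2C_wv]) (by simp) (hframe s3 hF3).2.2.2.1 le_rfl
        (by omega) ⟨hI3.congr (fun k' c' _ _ h => h) (fun x hx hx' => by
            simp [show x ≠ 25 by omega]),
          hB3.congr (fun c' q' => by omega) (by simp) (by simp) (by simp)⟩ ?_ ?_)
      · rintro q s4 hq hf4 hvq ⟨hI4, hB4⟩
        have hF4 := hF3.trans (hf4.mono
          (ys := [vT, vB2, vC, vS, vM2, vS2, vBest, vBt, vBm1, vBs1, vBm2, vBs2]) (Bs := [])
          (by simp [pick2C_wv]) (by simp [pick2C_wa]))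
        obtain ⟨f1, -, f3, -, -, -, f7, -, f9⟩ := hframe s4 hF4
        have hvc4 : s4.var vC = c := by rw [hf4.1 _ (by simp [pick2C_wv]), hvc]
        have hvk4 : s4.var vT = k := by rw [hf4.1 _ (by simp [pick2C_wv]), hvk3]
        have hsrc : src2E.val s4 = t₂ (n - k) c q := by
          rw [src2E, Expr.val, cellE_val f3, f9]
          simp only [Expr.val, f1, hvk4, hvc4, hvq]
          exact ht2 _ (by omega) _ (by omega) _ (by omega)
        refine (pick2C_tri hX f7 hvc4 hvq hsrc hB4).framed.mono le_rfl ?_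
        rintro s5 ⟨h5, hf5⟩
        refine ⟨hI4.congr (fun k' c' _ _ h => h) (fun x hx hx' => ?_),
          h5.congr (fun c' q' => by omega) (by simp) (by simp) (by simp)⟩
        rw [State.setVar_var, if_neg (by omega), hf5.1 _ (by simp [pick2C_wv]; omega)]
      · rintro s4 hf4 ⟨hI4, hB4⟩
        have hF4 := hF3.trans (hf4.mono
          (ys := [vT, vB2, vC, vS, vM2, vS2, vBest, vBt, vBm1, vBs1, vBm2, vBs2]) (Bs := [])
          (by simp [pick2C_wv]) (by simp [pick2C_wa]))
        have hvc4 : s4.var vC = c := by rw [hf4.1 _ (by simp [pick2C_wv]), hvc]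
        have hvk4 : s4.var vT = k := by rw [hf4.1 _ (by simp [pick2C_wv]), hvk3]
        have hB4' : Best2 (t₂ (n - k)) (fun c' q' => c' ≤ c ∧ e ≤ q' ∧ q' ≤ Q) s4 :=
          hB4.congr (fun c' q' => by omega) rfl rfl rfl
        refine Tri.for_le hX (F := 1)
          (fun q => BestAll t₁ t₂ n e Q K
            (fun k' c' q' => (k' < k ∧ c' ≤ K) ∨ k' = k ∧ (c' < c ∨ c' = c ∧ q' < q)))
          (by simp [pick1C_wv]) (by simp [pick1C_wv]) (by simp) (hframe s4 hF4).2.2.2.1 le_rfl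
          (by omega) (hI4.congr (fun k' c' _ _ h => by omega) (fun x hx hx' => by
            simp [show x ≠ 25 by omega])) ?_ ?_
        · intro q s5 hq hf5 hvq hI5
          have hF5 := hF4.trans (hf5.mono
            (ys := [vT, vB2, vC, vS, vM2, vS2, vBest, vBt, vBm1, vBs1, vBm2, vBs2]) (Bs := [])
            (by simp [pick1C_wv]) (by simp [pick1C_wa]))
          obtain ⟨f1, -, f3, -, -, f6, f7, f8, -⟩ := hframe s5 hF5
          have hvc5 : s5.var vC = c := by rw [hf5.1 _ (by simp [pick1C_wv]), hvc4]
          have hvk5 : s5.var vT = k := by rw [hf5.1 _ (by simp [pick1C_wv]), hvk4]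
          have hsrc : src1E.val s5 = t₁ k (K - c) q := by
            rw [src1E, Expr.val, cellE_val f3, f8]
            simp only [Expr.val, hvk5, hvc5, hvq, f6]
            exact ht1 _ (by omega) _ (by omega) _ (by omega)
          refine (pick1C_tri hX f7 hvc5 hvq f6 hvk5 (by omega) (by omega) (by omega) hsrc hZ
            (h1Z _ (by omega) _ (by omega) _ (by omega))
            (fun c' hc' q' hq' => h2Z _ (by omega) _ (by omega) _ (by omega))
            (hB4'.congr (fun _ _ => Iff.rfl) (hf5.1 _ (by simp [pick1C_wv]))
              (hf5.1 _ (by simp [pick1C_wv])) (hf5.1 _ (by simp [pick1C_wv]))) hI5).mono le_rfl ?_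
          intro s6 h6
          exact h6.congr (fun k' c' q' _ h => by omega) (fun x hx hx' => by
            simp [show x ≠ 25 by omega])
        · intro s5 hf5 h5
          refine ⟨h5.congr (fun k' c' q' _ h => by omega) (fun x hx hx' => by
            simp [show x ≠ 31 by omega]), hB4'.congr (fun c' q' => by omega) ?_ ?_ ?_⟩ <;>
          simp [hf5.1 _ _, pick1C_wv]
    · rintro s3 hf3 ⟨hI3, -⟩
      exact hI3.congr (fun k' c' q' _ h => by omega) (fun x hx hx' => by
            simp [show x ≠ 30 by omega])
  · intro s1 _ h1
    refine ⟨fun k hk m₁ m₂ q₁ q₂ hm e1 e2 e3 e4 h3 h4 => ?_, h1.att⟩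
    have hm1 : K - (K - m₁) = m₁ := by omega
    have := h1.low k (K - m₁) q₁ ⟨by omega, by omega⟩ e1 e2 (by rw [hm1]; exact h3) m₂ (by omega)
      q₂ e3 e4 h4
    rwa [hm1] at this

/-! ### Reading off the decisions -/

section side

variable (fwd : Bool) (ap aw ar aT : ℕ)

/-- Sorted number of item `j` of a side with `fwd`. -/
def sortedIdx (n j : ℕ) : ℕ := if fwd then j else n - 1 - j

/-- Sorted number of the current item. -/
def sortedIdxE : Expr := if fwd then #vJ else #vN -ₑ ♯1 -ₑ #vJ

/-- Nonzero if the entry `(vJ + 1, vM, vS)` is attained by leaving the current item out. -/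
def leftOutE : Expr :=
  outOkE ap ar aT *ₑ .eq (outSrcE ap aT +ₑ coutE fwd ap aw #vM (#vS -ₑ doutE ap))
    (.arr aT (cellE (#vJ +ₑ ♯1) #vM #vS))

/-- Follow the table back from the entry `(vJ, vM, vS)`, where `vLen` equals `vJ`.  Cell `i` of
array `13` receives the part of the sequence that job `i` belongs to. -/
def traceC : Cmd :=
  forC vI vLen (vJ ≔ #vJ -ₑ ♯1 ;;
    .cond (leftOutE fwd ap aw ar aT)
      (.store 13 (sortedIdxE fwd) (if fwd then ♯0 else ♯2) ;; vS ≔ #vS -ₑ doutE ap)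
      (.store 13 (sortedIdxE fwd) ♯1 ;; vM ≔ #vM -ₑ .arr ap #vJ ;; vS ≔ #vS -ₑ dinE aw))

variable {fwd ap aw ar aT}

theorem sortedIdx_inj {n i j : ℕ} (hi : i < n) (hj : j < n)
    (h : sortedIdx fwd n i = sortedIdx fwd n j) : i = j := by
  cases fwd <;> simp only [sortedIdx, if_true, Bool.false_eq_true, if_false] at h <;> omega

theorem sortedIdxE_val {s : State} :
    (sortedIdxE fwd).val s = sortedIdx fwd (s.var vN) (s.var vJ) := by
  cases fwd <;> rfl

theorem leftOutE_val {s : State} {P Q n : ℕ} (hP1 : s.var vP1 = P + 1) (hj : s.var vJ + 1 ≤ n)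
    (hm : s.var vM ≤ P) (hq : s.var vS ≤ Q)
    (hT : ∀ j ≤ n, ∀ m ≤ P, ∀ q ≤ Q,
      s.arr aT (enc P j m q) = (s.dp fwd ap aw ar).T j m q) :
    (leftOutE fwd ap aw ar aT).val s ≠ 0 ↔
      (s.dp fwd ap aw ar).OutOK (s.var vJ) (s.var vM) (s.var vS) := by
  rw [leftOutE, mul_val_ne, eq_val_ne, outOkE_val (fwd := fwd) (aw := aw) hP1]
  simp only [Expr.val]
  rw [cellE_val hP1, outSrcE_val (fwd := fwd) (aw := aw) (ar := ar) hP1, coutE_val (ar := ar)]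
  simp only [Expr.val]
  rw [doutE_val (fwd := fwd) (aw := aw) (ar := ar),
    hT _ (by omega) _ hm _ ((Nat.sub_le _ _).trans hq), hT _ hj _ hm _ hq]
  simp only [DP.OutOK, and_assoc]

theorem traceC_tri {X n P Q k m₀ s₀ G : ℕ} (hX : 2 ≤ X) {s : State} {D : DP}
    (hD : s.dp fwd ap aw ar = D) (hn : s.var vN = n)
    (hP1 : s.var vP1 = P + 1) (hk : k ≤ n) (hj : s.var vJ = k) (hl : s.var vLen = k)
    (hm : s.var vM = m₀) (hs : s.var vS = s₀) (hmP : m₀ ≤ P) (hsQ : s₀ ≤ Q)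
    (hap : ap ≠ 13) (haw : aw ≠ 13) (har : ar ≠ 13) (haT : aT ≠ 13)
    (hT : ∀ j ≤ n, ∀ m ≤ P, ∀ q ≤ Q, s.arr aT (enc P j m q) = D.T j m q)
    (h0 : D.T k m₀ s₀ ≠ 0) (hG : n + 1 ≤ G) :
    Tri X G (traceC fwd ap aw ar aT) s (fun s' =>
      (∃ q₀, ∀ M : ℕ → Bool, (∀ i < k, M i = decide (s'.arr 13 (sortedIdx fwd n i) = 1)) →
        D.Attains M q₀ k m₀ s₀) ∧
      (∀ i < k, s'.arr 13 (sortedIdx fwd n i) = 1 ∨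
        s'.arr 13 (sortedIdx fwd n i) = if fwd then 0 else 2) ∧
      ∀ a, (∀ i < k, a ≠ sortedIdx fwd n i) → s'.arr 13 a = s.arr 13 a) := by
  subst hD
  set D := s.dp fwd ap aw ar with hD
  -- Whatever decisions attain the current entry, continued by those already stored, attain the
  -- final one.
  refine Tri.for_le hX (F := 1) (fun i s' => s'.var vJ = k - i ∧ s'.var vM ≤ P ∧ s'.var vS ≤ Q ∧
      D.T (k - i) (s'.var vM) (s'.var vS) ≠ 0 ∧
      (∀ x, k - i ≤ x → x < k → s'.arr 13 (sortedIdx fwd n x) = 1 ∨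
        s'.arr 13 (sortedIdx fwd n x) = if fwd then 0 else 2) ∧
      (∀ a, (∀ x < k, a ≠ sortedIdx fwd n x) → s'.arr 13 a = s.arr 13 a) ∧
      ∀ M q₀, (∀ x, k - i ≤ x → x < k → M x = decide (s'.arr 13 (sortedIdx fwd n x) = 1)) →
        D.Attains M q₀ (k - i) (s'.var vM) (s'.var vS) → D.Attains M q₀ k m₀ s₀)
    (by simp [Cmd.wv]) (by simp [Cmd.wv]) (by simp) hl le_rfl (by omega) ?_ ?_ ?_
  · simp only [State.setVar_var, State.setVar_arr, Nat.reduceEqDiff, if_false, Nat.sub_zero, hj,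
      hm, hs]
    exact ⟨trivial, hmP, hsQ, h0, fun x h1 h2 => by omega, fun _ _ => trivial,
      fun M q₀ _ h => h⟩
  · rintro i s1 hi hf hvi ⟨i1, i2, i3, i4, i5, i6, i7⟩
    replace hf : Frame [vI, vJ, vS, vM] [13] s s1 := hf.mono (by simp [Cmd.wv]) (by simp [Cmd.wa])
    refine Tri.wp hX le_rfl (by
      cases fwd <;> simp [Cmd.degOK, Expr.deg, leftOutE, sortedIdxE, outOkE, outSrcE, coutE, cellE,
        doutE, dinE]) fun hb => ?_
    obtain ⟨j, hjk⟩ : ∃ j, k - i = j + 1 := ⟨k - i - 1, by omega⟩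
    have hjk' : k - (i + 1) = j := by omega
    rw [hjk] at i1 i4 i5 i7
    rw [hjk']
    refine ⟨(Nat.sub_le _ _).trans (hb.1 vJ), ?_⟩
    set s2 := s1.setVar vJ ((#vJ -ₑ ♯1 : Expr).val s1) with hs2
    have hv2 : s2.var vJ = j := by simp [hs2, Expr.val, i1]
    have hm2 : s2.var vM = s1.var vM := by simp [hs2]
    have hq2 : s2.var vS = s1.var vS := by simp [hs2]
    have hf2 : Frame [vI, vJ, vS, vM] [13] s s2 := hf.trans
      ⟨fun x hx => by simp at hx; simp [hs2, hx], fun _ _ => rfl⟩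
    have hd2 : s2.dp fwd ap aw ar = D := dp_congr (hf2.1 _ (by simp)) (hf2.1 _ (by simp))
      (hf2.1 _ (by simp)) (hf2.2 _ (by simpa using hap)) (hf2.2 _ (by simpa using haw))
      (hf2.2 _ (by simpa using har))
    have hn2 : s2.var vN = n := by rw [hf2.1 _ (by simp), hn]
    have hidx : (sortedIdxE fwd).val s2 = sortedIdx fwd n j := by rw [sortedIdxE_val, hn2, hv2]
    have harr2 : s2.arr 13 = s1.arr 13 := rfl
    have hleft := leftOutE_val (s := s2) (fwd := fwd) (ap := ap) (aw := aw) (ar := ar) (aT := aT)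
      (P := P) (Q := Q) (n := n) (by rw [hf2.1 _ (by simp), hP1]) (by omega) (by rw [hm2]; exact i2)
      (by rw [hq2]; exact i3) (by rw [hf2.2 _ (by simpa using haT), hd2]; exact hT)
    rw [hd2, hv2, hm2, hq2] at hleft
    have hne : ∀ x, j + 1 ≤ x → x < k → sortedIdx fwd n x ≠ sortedIdx fwd n j :=
      fun x h1 h2 he => by have := sortedIdx_inj (by omega) (by omega) he; omega
    have hdout : (doutE ap).val s2 = D.dout j := by
      rw [doutE_val (fwd := fwd) (aw := aw) (ar := ar), hd2, hv2]
    have hdin : (dinE aw).val s2 = D.din j := by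
      rw [dinE_val (fwd := fwd) (ap := ap) (ar := ar), hd2, hv2]
    have hpj : s2.arr ap j = D.p j := by
      rw [← hd2]; rfl
    -- Effect of storing the label `v` for item `j` and moving to the entry `(m, q)`.
    have hstep : ∀ (s3 : State) (v m q : ℕ), s3.arr 13 =
        Function.update (s1.arr 13) (sortedIdx fwd n j) v → s3.var vJ = j → s3.var vM = m →
        s3.var vS = q → (v = 1 ∨ v = if fwd then 0 else 2) → m ≤ P → q ≤ Q → D.T j m q ≠ 0 →
        (∀ M q₀, M j = decide (v = 1) → D.Attains M q₀ j m q →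
          D.Attains M q₀ (j + 1) (s1.var vM) (s1.var vS)) →
        s3.var vJ = j ∧ s3.var vM ≤ P ∧ s3.var vS ≤ Q ∧
        D.T j (s3.var vM) (s3.var vS) ≠ 0 ∧
        (∀ x, j ≤ x → x < k → s3.arr 13 (sortedIdx fwd n x) = 1 ∨
          s3.arr 13 (sortedIdx fwd n x) = if fwd then 0 else 2) ∧
        (∀ a, (∀ x < k, a ≠ sortedIdx fwd n x) → s3.arr 13 a = s.arr 13 a) ∧
        ∀ M q₀, (∀ x, j ≤ x → x < k → M x = decide (s3.arr 13 (sortedIdx fwd n x) = 1)) →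
          D.Attains M q₀ j (s3.var vM) (s3.var vS) → D.Attains M q₀ k m₀ s₀ := by
      intro s3 v m q h1 h2 h3 h4 h5 h6 h7 h8 h9
      rw [h1, h2, h3, h4]
      refine ⟨rfl, h6, h7, h8, fun x hx hxk => ?_, fun a ha => ?_, fun M q₀ hM hA => ?_⟩
      · rcases Nat.eq_or_lt_of_le hx with rfl | hx
        · simpa using h5
        · rw [Function.update_of_ne (hne x hx hxk)]
          exact i5 x hx hxk
      · rw [Function.update_of_ne (ha j (by omega))]
        exact i6 a ha
      · refine i7 M q₀ (fun x hx hxk => ?_) (h9 M q₀ ?_ hA)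
        · rw [hM x (by omega) hxk, Function.update_of_ne (hne x hx hxk)]
        · simpa using hM j le_rfl (by omega)
    simp only [Cmd.wp]
    split
    · rename_i h
      have ho := hleft.1 h
      refine ⟨by cases fwd <;> simp [Expr.val]; omega, ?_, ?_⟩
      · refine (Nat.sub_le _ _).trans ?_
        simpa [Expr.val, hq2] using hb.1 vS
      · refine hstep _ (if fwd then 0 else 2) (s1.var vM) (s1.var vS - D.dout j) ?_ ?_ ?_ ?_
          (Or.inr rfl) i2 ((Nat.sub_le _ _).trans i3) ho.2.2.1 ?_
        · simp only [State.setVar_arr, State.setArr_arr, if_true, hidx, harr2]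
          cases fwd <;> rfl
        · simp [hv2]
        · simp [hm2]
        · have e : (doutE ap).val (s2.setArr 13 ((sortedIdxE fwd).val s2)
              (((if fwd then ♯0 else ♯2) : Expr).val s2)) = (doutE ap).val s2 := by
            simp [doutE, Expr.val, hap]
          simp only [State.setVar_var, Nat.reduceEqDiff, if_false, if_true]
          rw [Expr.val, e, hdout]
          simp [Expr.val, hq2]
        · intro M q₀ hM hA
          exact DP.Attains.succ_out ho (by rw [hM]; cases fwd <;> simp) hA
    · rename_i h
      have ho : ¬ D.OutOK j (s1.var vM) (s1.var vS) := fun h' => h (hleft.2 h')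
      have hin := DP.in_of_not_outOK ho i4
      refine ⟨by simp [Expr.val]; omega, ?_, ?_, ?_⟩
      · refine (Nat.sub_le _ _).trans ?_
        simpa [Expr.val, hm2] using hb.1 vM
      · refine (Nat.sub_le _ _).trans ?_
        simpa [Expr.val, hq2] using hb.1 vS
      · refine hstep _ 1 (s1.var vM - D.p j) (s1.var vS - D.din j) ?_ ?_ ?_ ?_
          (Or.inl rfl) ((Nat.sub_le _ _).trans i2) ((Nat.sub_le _ _).trans i3) hin.2.2.1 ?_
        · simp only [State.setVar_arr, State.setArr_arr, if_true, hidx, harr2, Expr.val]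
        · simp [hv2]
        · simp [Expr.val, hm2, hap, hv2, hpj]
        · simp only [State.setVar_var, Nat.reduceEqDiff, if_false, if_true]
          have e : ∀ (t : State) v, t.arr aw = s2.arr aw → t.var vF = s2.var vF →
              t.var vJ = s2.var vJ → (dinE aw).val (t.setVar vM v) = (dinE aw).val s2 := by
            intro t v h1 h2 h3
            simp [dinE, Expr.val, h1, h2, h3]
          change State.var _ 25 - Expr.val _ (dinE aw) = _
          rw [e _ _ (by simp [haw]) (by simp) (by simp), hdin]
          simp [hq2]
        · intro M q₀ hM hA
          exact DP.Attains.succ_in ho i4 (by simp [hM]) hA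
  · rintro s1 _ ⟨-, -, -, i4, i5, i6, i7⟩
    rw [Nat.sub_self] at i4 i5 i7
    exact ⟨⟨_, fun M hM => i7 _ _ (fun x _ hx => hM x hx) (DP.Attains.zero i4)⟩,
      fun x hx => i5 x (Nat.zero_le _) hx, i6⟩

end side

/-! ### Preparing the input -/

/-- Compute the total processing time and the total weight. -/
def sumC : Cmd :=
  forC vI vN (vP ≔ #vP +ₑ .arr 0 #vI ;; vW ≔ #vW +ₑ .arr 1 #vI)

/-- Compute the parameters of the dynamic programs and the loop bounds. -/
def setupC : Cmd :=
  .cond (.lt #vW #vP) (vQ ≔ #vW ;; vF ≔ ♯0 ;; vE ≔ ♯0) (vQ ≔ #vP ;; vF ≔ ♯1 ;; vE ≔ #vP) ;;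
  .cond (.lt #vK #vP) (vKc ≔ #vK) (vKc ≔ #vP) ;;
  vY ≔ #vW *ₑ #vP ;; vN1 ≔ #vN +ₑ ♯1 ;; vP1 ≔ #vP +ₑ ♯1 ;; vQ1 ≔ #vQ +ₑ ♯1 ;;
  vK1 ≔ #vKc +ₑ ♯1 ;; vE1 ≔ #vE +ₑ ♯1

/-- Nonzero if job `vL` precedes job `vI` in Smith's order. -/
def smithE : Expr :=
  .lt (.arr 1 #vI *ₑ .arr 0 #vL) (.arr 1 #vL *ₑ .arr 0 #vI) +ₑ
    .eq (.arr 1 #vI *ₑ .arr 0 #vL) (.arr 1 #vL *ₑ .arr 0 #vI) *ₑ .lt #vL #vI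

/-- Sort the jobs: arrays `4`, `5`, `6` and `7` receive processing times, weights, resource
indicators and job numbers in Smith's order, arrays `8`, `9` and `10` the first three of these in
reverse order. -/
def sortC : Cmd :=
  rankC smithE
    (.store 4 #vCnt (.arr 0 #vI) ;; .store 5 #vCnt (.arr 1 #vI) ;; .store 6 #vCnt (.arr 2 #vI) ;;
      .store 7 #vCnt #vI ;; .store 8 (#vN -ₑ ♯1 -ₑ #vCnt) (.arr 0 #vI) ;;
      .store 9 (#vN -ₑ ♯1 -ₑ #vCnt) (.arr 1 #vI) ;; .store 10 (#vN -ₑ ♯1 -ₑ #vCnt) (.arr 2 #vI))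

/-- Nonzero if the job with sorted number `vL` precedes the one with sorted number `vI` in the
output. -/
def classE : Expr :=
  .lt (.arr 13 #vL) (.arr 13 #vI) +ₑ .eq (.arr 13 #vL) (.arr 13 #vI) *ₑ .lt #vL #vI

/-- Write the jobs to array `3`, in the order given by their parts of the sequence. -/
def outputC : Cmd := rankC classE (.store 3 #vCnt (.arr 7 #vI))

theorem sumC_tri {X n G Z : ℕ} (hX : 2 ≤ X) {s : State} (hn : s.var vN = n) (hp : s.var vP = 0)
    (hw : s.var vW = 0) (hZp : ∑ i ∈ Finset.range n, s.arr 0 i ≤ Z)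
    (hZw : ∑ i ∈ Finset.range n, s.arr 1 i ≤ Z) (hZ : Z ≤ X) (hG : n + 1 ≤ G) :
    Tri X G sumC s (fun s' => s'.var vP = ∑ i ∈ Finset.range n, s.arr 0 i ∧
      s'.var vW = ∑ i ∈ Finset.range n, s.arr 1 i) := by
  refine Tri.for_le hX (F := 1) (fun i s' => s'.var vP = ∑ i ∈ Finset.range i, s.arr 0 i ∧
      s'.var vW = ∑ i ∈ Finset.range i, s.arr 1 i)
    (by simp [Cmd.wv]) (by simp [Cmd.wv]) (by simp) hn le_rfl (by omega) (by simp [hp, hw]) ?_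
    fun s' _ h => h
  rintro i s' hi hf hvi ⟨h1, h2⟩
  refine Tri.wp hX le_rfl (by simp [Cmd.degOK, Expr.deg]) fun _ => ?_
  have ha : s'.arr = s.arr := funext fun A => hf.2 A (by simp [Cmd.wa])
  have hsub : ∀ g : ℕ → ℕ, ∑ j ∈ Finset.range (i + 1), g j ≤ ∑ j ∈ Finset.range n, g j := fun g =>
    Finset.sum_le_sum_of_subset (Finset.range_subset_range.2 hi)
  have e1 := hsub (s.arr 0)
  have e2 := hsub (s.arr 1)
  rw [Finset.sum_range_succ] at e1 e2
  simp only [Cmd.wp, Expr.val, State.setVar_var, State.setVar_arr, Nat.reduceEqDiff, if_false,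
    if_true, ha, hvi, h1, h2, Finset.sum_range_succ]
  exact ⟨by omega, by omega, trivial, trivial⟩

theorem setupC_tri {X P W K n : ℕ} (hX : 2 ≤ X) {s : State} (hn : s.var vN = n)
    (hK : s.var vK = K) (hP : s.var vP = P) (hW : s.var vW = W) (hnX : n + 1 ≤ X)
    (hPX : P + 1 ≤ X) (hWX : W ≤ X) (hWP : W * P ≤ X) :
    Tri X 1 setupC s (fun s' => ∃ f Q, (f = 0 ∧ Q = W ∧ W ≤ P ∨ f = 1 ∧ Q = P ∧ P ≤ W) ∧
      s'.var vF = f ∧ s'.var vQ = Q ∧ s'.var vE = f * Q ∧ s'.var vKc = min K P ∧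
      s'.var vY = W * P ∧ s'.var vN1 = n + 1 ∧ s'.var vP1 = P + 1 ∧ s'.var vQ1 = Q + 1 ∧
      s'.var vK1 = min K P + 1 ∧ s'.var vE1 = f * Q + 1) := by
  refine Tri.wp hX le_rfl (by simp [setupC, Cmd.degOK, Expr.deg]) fun _ => ?_
  by_cases h1 : W < P <;> by_cases h2 : K < P <;>
    simp [setupC, Cmd.wp, Expr.val, hn, hK, hP, hW, h1, h2] <;>
    omega

/-- The sorted arrays are filled in for the jobs numbered below `m`, where `rk` gives the sorted
numbers. -/
def SortedUpTo (a : ℕ → ℕ → ℕ) (rk : ℕ → ℕ) (n Zp Zw m : ℕ) (s : State) : Prop :=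
  (∀ i < m, s.arr 4 (rk i) = a 0 i ∧ s.arr 5 (rk i) = a 1 i ∧ s.arr 6 (rk i) = a 2 i ∧
    s.arr 7 (rk i) = i ∧ s.arr 8 (n - 1 - rk i) = a 0 i ∧ s.arr 9 (n - 1 - rk i) = a 1 i ∧
    s.arr 10 (n - 1 - rk i) = a 2 i) ∧
  ∀ i, s.arr 4 i ≤ Zp ∧ s.arr 5 i ≤ Zw ∧ s.arr 8 i ≤ Zp ∧ s.arr 9 i ≤ Zw

theorem update_le {g : ℕ → ℕ} {a v Z : ℕ} (hg : ∀ i, g i ≤ Z) (hv : v ≤ Z) (i : ℕ) :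
    Function.update g a v i ≤ Z := by
  rw [Function.update_apply]; split
  · exact hv
  · exact hg i

theorem sortC_tri {X n Zp Zw G : ℕ} (hX : 2 ≤ X) {s : State} (hn : s.var vN = n)
    (hp : ∀ i < n, 0 < s.arr 0 i) (hZp : ∀ i < n, s.arr 0 i ≤ Zp) (hZw : ∀ i < n, s.arr 1 i ≤ Zw)
    (h0 : ∀ A i, 4 ≤ A → s.arr A i = 0) (hG : (n + 1) * (n + 1) ≤ G) :
    Tri X G sortC s (SortedUpTo s.arr (rankOf (smithLt (s.arr 0) (s.arr 1)) n) n Zp Zw n) := by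
  have hlt : StrictBelow (smithLt (s.arr 0) (s.arr 1)) n := smithLt_strictBelow hp
  refine rankC_tri hX (lt := smithLt (s.arr 0) (s.arr 1)) _ hn hG
    (by simp [smithE, Expr.deg]) (by simp [Cmd.degOK, Expr.deg]) rfl ?_ ?_ ?_ ?_
  · intro s' hf
    have e0 : s'.arr 0 = s.arr 0 := hf.2 0 (by simp [Cmd.wa])
    have e1 : s'.arr 1 = s.arr 1 := hf.2 1 (by simp [Cmd.wa])
    rw [smithE, add_val_ne, mul_val_ne, eq_val_ne, lt_val_ne, lt_val_ne]
    simp only [Expr.val, e0, e1, smithLt]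
  · intro i s' s'' hf h
    have e : s''.arr = s'.arr := funext fun A => hf.2 A (by simp)
    simpa only [SortedUpTo, e] using h
  · exact ⟨fun i hi => by omega, fun i => by
      simp [h0 4 i (by norm_num), h0 5 i (by norm_num), h0 8 i (by norm_num),
        h0 9 i (by norm_num)]⟩
  · rintro i s' hi hf hvi hcnt ⟨h1, h2⟩ hb
    set rk := rankOf (smithLt (s.arr 0) (s.arr 1)) n with hrk
    have e0 : s'.arr 0 = s.arr 0 := hf.2 0 (by simp [Cmd.wa])
    have e1 : s'.arr 1 = s.arr 1 := hf.2 1 (by simp [Cmd.wa])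
    have e2 : s'.arr 2 = s.arr 2 := hf.2 2 (by simp [Cmd.wa])
    have hn' : s'.var vN = n := by rw [hf.1 _ (by simp), hn]
    have b0 : s.arr 0 i ≤ X := e0 ▸ hb.2 0 i
    have b1 : s.arr 1 i ≤ X := e1 ▸ hb.2 1 i
    have b2 : s.arr 2 i ≤ X := e2 ▸ hb.2 2 i
    have bi : i ≤ X := hvi ▸ hb.1 vI
    simp only [Cmd.wp, Expr.val, State.setArr_arr, State.setArr_var, Nat.reduceEqDiff, if_false,
      hvi, hcnt, hn', e0, e1, e2]
    refine ⟨b0, b1, b2, bi, b0, b1, b2, fun x hx => ?_, fun x => ?_⟩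
    · simp only [State.setArr_arr, Nat.reduceEqDiff, if_false, if_true]
      rcases Nat.lt_succ_iff_lt_or_eq.1 hx with hx | rfl
      · have hne : rk x ≠ rk i := fun h => hx.ne (rankOf_inj hlt (by omega) hi h)
        have hne' : n - 1 - rk x ≠ n - 1 - rk i := by
          have r1 : rk i < n := rankOf_lt hlt hi
          have r2 : rk x < n := rankOf_lt hlt (by omega)
          omega
        simp only [Function.update_of_ne hne, Function.update_of_ne hne']
        exact h1 x hx
      · simp
    · simp only [State.setArr_arr, Nat.reduceEqDiff, if_false, if_true]
      exact ⟨update_le (fun i => (h2 i).1) (hZp i hi) x,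
        update_le (fun i => (h2 i).2.1) (hZw i hi) x,
        update_le (fun i => (h2 i).2.2.1) (hZp i hi) x,
        update_le (fun i => (h2 i).2.2.2) (hZw i hi) x⟩

theorem outputC_tri {X n G : ℕ} (hX : 2 ≤ X) {s : State} (hn : s.var vN = n)
    (hG : (n + 1) * (n + 1) ≤ G) :
    Tri X G outputC s (fun s' => ∀ i < n,
      s'.arr 3 (rankOf (classLt (s.arr 13)) n i) = s.arr 7 i) := by
  refine rankC_tri hX (lt := classLt (s.arr 13))
    (fun m s' => ∀ i < m, s'.arr 3 (rankOf (classLt (s.arr 13)) n i) = s.arr 7 i) hn hG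
    (by simp [classE, Expr.deg]) (by simp [Cmd.degOK, Expr.deg]) rfl ?_ ?_ (by simp) ?_
  · intro s' hf
    have e : s'.arr 13 = s.arr 13 := hf.2 13 (by simp [Cmd.wa])
    rw [classE, add_val_ne, mul_val_ne, eq_val_ne, lt_val_ne, lt_val_ne]
    simp only [Expr.val, e, classLt]
  · intro i s' s'' hf h
    have e : s''.arr = s'.arr := funext fun A => hf.2 A (by simp)
    simpa only [e] using h
  · intro i s' hi hf hvi hcnt h hb
    have e : s'.arr 7 = s.arr 7 := hf.2 7 (by simp [Cmd.wa])
    refine ⟨hb.2 _ _, fun x hx => ?_⟩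
    simp only [Expr.val, State.setArr_arr, if_true, hvi, hcnt, e]
    rcases Nat.lt_succ_iff_lt_or_eq.1 hx with hx | rfl
    · rw [Function.update_of_ne fun h' => hx.ne
        (rankOf_inj (classLt_strictBelow _ n) (by omega) hi h')]
      exact h x hx
    · simp

/-! ### The whole program -/

/-- Compute the parameters and sort the jobs. -/
def prepareC : Cmd := sumC ;; setupC ;; sortC

/-- Read off an optimal sequence from the best combination of table entries. -/
def finishC : Cmd :=
  (vJ ≔ #vBt ;; vLen ≔ #vBt ;; vM ≔ #vBm1 ;; vS ≔ #vBs1) ;; traceC true 4 5 6 11 ;;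
  (vJ ≔ #vN -ₑ #vBt ;; vLen ≔ #vN -ₑ #vBt ;; vM ≔ #vBm2 ;; vS ≔ #vBs2) ;;
  traceC false 8 9 10 12 ;; outputC ;; vRes ≔ ♯1

/-- The program that solves `1|er|∑ w_j C_j`. -/
def solveC : Cmd :=
  prepareC ;; tableC true 4 5 6 11 ;; tableC false 8 9 10 12 ;; combineC ;;
    .cond #vBest finishC .skip

/-- The parameters and the sorted data of the instance are in place. -/
structure Ready (I : ERInstance) (π : Fin I.n ≃ Fin I.n) (f Q : ℕ) (s : State) : Prop where
  prep : I.Prepared (s.arr 4) (s.arr 5) (s.arr 6) (s.arr 8) (s.arr 9) (s.arr 10) π f Q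
  n_eq : s.var vN = I.n
  f_eq : s.var vF = f
  Q_eq : s.var vQ = Q
  e_eq : s.var vE = f * Q
  K_eq : s.var vKc = min I.K I.P
  Y_eq : s.var vY = I.W * I.P
  N1_eq : s.var vN1 = I.n + 1
  P1_eq : s.var vP1 = I.P + 1
  Q1_eq : s.var vQ1 = Q + 1
  K1_eq : s.var vK1 = min I.K I.P + 1
  E1_eq : s.var vE1 = f * Q + 1
  res_eq : s.var vRes = 0
  id_eq : ∀ i : Fin I.n, s.arr 7 i = π i
  zero : ∀ i, s.arr 11 i = 0 ∧ s.arr 12 i = 0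
  le : ∀ i, s.arr 4 i ≤ I.P ∧ s.arr 5 i ≤ I.W ∧ s.arr 8 i ≤ I.P ∧ s.arr 9 i ≤ I.W

theorem input_arr0 {I : ERInstance} (i : Fin I.n) : I.input.arr 0 i = I.p i := by
  simp [ERInstance.input]

theorem input_arr1 {I : ERInstance} (i : Fin I.n) : I.input.arr 1 i = I.w i := by
  simp [ERInstance.input]

theorem input_arr2 {I : ERInstance} (i : Fin I.n) :
    I.input.arr 2 i = if i ∈ I.R then 1 else 0 := by
  simp [ERInstance.input]

theorem p_le_P {I : ERInstance} (i : Fin I.n) : I.p i ≤ I.P :=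
  Finset.single_le_sum (f := I.p) (fun _ _ => Nat.zero_le _) (Finset.mem_univ _)

theorem w_le_W {I : ERInstance} (i : Fin I.n) : I.w i ≤ I.W :=
  Finset.single_le_sum (f := I.w) (fun _ _ => Nat.zero_le _) (Finset.mem_univ _)

/-- The sorted arrays list the jobs in the order given by the inverse of the rank. -/
theorem prepared_of_sorted {I : ERInstance} {s : State} {f Q : ℕ} (hpos : ∀ j, 0 < I.p j)
    (hlt : StrictBelow (smithLt (I.input.arr 0) (I.input.arr 1)) I.n)
    (hmode : f = 0 ∧ Q = I.W ∧ I.W ≤ I.P ∨ f = 1 ∧ Q = I.P ∧ I.P ≤ I.W)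
    (hs : SortedUpTo I.input.arr (rankOf (smithLt (I.input.arr 0) (I.input.arr 1)) I.n) I.n
      I.P I.W I.n s) :
    I.Prepared (s.arr 4) (s.arr 5) (s.arr 6) (s.arr 8) (s.arr 9) (s.arr 10)
      (rankEquiv hlt).symm f Q ∧ ∀ i : Fin I.n, s.arr 7 i = ((rankEquiv hlt).symm i : ℕ) := by
  obtain ⟨h1, -⟩ := hs
  have hrank : ∀ i : Fin I.n, rankOf (smithLt (I.input.arr 0) (I.input.arr 1)) I.n
      ((rankEquiv hlt).symm i) = i := fun i => by
    rw [← rankEquiv_val hlt, Equiv.apply_symm_apply]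
  have h2 : ∀ i : Fin I.n, _ := fun i => h1 ((rankEquiv hlt).symm i) (Fin.is_lt _)
  simp only [hrank, input_arr0, input_arr1, input_arr2] at h2
  have hrev : ∀ i < I.n, ∃ j : Fin I.n, (j : ℕ) = I.n - 1 - i ∧ I.n - 1 - (j : ℕ) = i :=
    fun i hi => ⟨⟨I.n - 1 - i, by omega⟩, rfl, by simp only; omega⟩
  refine ⟨⟨fun i => (h2 i).1, fun i => (h2 i).2.1, fun i => ?_, fun i hi => ?_, fun i hi => ?_,
    fun i hi => ?_, hpos, fun i j hij hj => ?_, hmode⟩, fun i => (h2 i).2.2.2.1⟩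
  · rw [(h2 i).2.2.1]; simp
  · obtain ⟨j, e1, e2⟩ := hrev i hi
    have := (h2 j).2.2.2.2.1
    rw [e2, ← (h2 j).1, e1] at this
    exact this
  · obtain ⟨j, e1, e2⟩ := hrev i hi
    have := (h2 j).2.2.2.2.2.1
    rw [e2, ← (h2 j).2.1, e1] at this
    exact this
  · obtain ⟨j, e1, e2⟩ := hrev i hi
    have := (h2 j).2.2.2.2.2.2
    rw [e2, ← (h2 j).2.2.1, e1] at this
    exact this
  · have hi : i < I.n := hij.trans hj
    have hsl := (rankOf_lt_iff hlt ((rankEquiv hlt).symm ⟨i, hi⟩).2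
      ((rankEquiv hlt).symm ⟨j, hj⟩).2).1 (by rw [hrank, hrank]; exact hij)
    simp only [smithLt, input_arr0, input_arr1] at hsl
    have e1 := h2 ⟨i, hi⟩
    have e2 := h2 ⟨j, hj⟩
    simp only at e1 e2
    rw [e1.1, e1.2.1, e2.1, e2.2.1]
    omega

theorem prepareC_tri {I : ERInstance} {X G : ℕ} (hX : 2 ≤ X) (hpos : ∀ j, 0 < I.p j)
    (hnX : I.n + 1 ≤ X) (hPX : I.P + 1 ≤ X) (hWX : I.W ≤ X) (hWP : I.W * I.P ≤ X)
    (hG : (I.n + 1) * (I.n + 1) ≤ G) :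
    Tri X G prepareC I.input (fun s => ∃ f Q π, Ready I π f Q s) := by
  have hsum0 : ∑ i ∈ Finset.range I.n, I.input.arr 0 i = I.P := by
    rw [Finset.sum_range]; exact Finset.sum_congr rfl fun i _ => input_arr0 i
  have hsum1 : ∑ i ∈ Finset.range I.n, I.input.arr 1 i = I.W := by
    rw [Finset.sum_range]; exact Finset.sum_congr rfl fun i _ => input_arr1 i
  have hn : I.input.var vN = I.n := rfl
  have hzero : ∀ A i, 4 ≤ A → I.input.arr A i = 0 := fun A i hA => by
    simp [ERInstance.input, show A ≠ 0 by omega, show A ≠ 1 by omega, show A ≠ 2 by omega]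
  have hGn : I.n + 1 ≤ G := le_trans (Nat.le_mul_of_pos_left _ (by omega)) hG
  refine Tri.seq ((sumC_tri (Z := max I.P I.W) hX hn rfl rfl (by rw [hsum0]; exact le_max_left _ _)
    (by rw [hsum1]; exact le_max_right _ _) (max_le (by omega) hWX) hGn).framed.mono le_rfl ?_)
  rintro s1 ⟨⟨hP, hW⟩, hf1⟩
  rw [hsum0] at hP
  rw [hsum1] at hW
  refine Tri.seq ((setupC_tri hX ((hf1.1 vN (by decide)).trans hn)
    (hf1.1 vK (by decide)) hP hW hnX hPX hWX hWP).framed.mono (by omega) ?_)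
  rintro s2 ⟨⟨f, Q, hmode, h⟩, hf2⟩
  have ha : s2.arr = I.input.arr := funext fun A => by
    rw [hf2.2 A (by simp [setupC, Cmd.wa]), hf1.2 A (by simp [sumC, forC, Cmd.wa])]
  have hn2 : s2.var vN = I.n := by rw [hf2.1 _ (by decide), hf1.1 _ (by decide), hn]
  have hres2 : s2.var vRes = 0 := by rw [hf2.1 _ (by decide), hf1.1 _ (by decide)]; rfl
  have hppos : ∀ i < I.n, 0 < I.input.arr 0 i := fun i hi => by
    rw [input_arr0 ⟨i, hi⟩]; exact hpos _
  refine (sortC_tri (Zp := I.P) (Zw := I.W) hX hn2 (by rw [ha]; exact hppos)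
    (fun i hi => by rw [ha, input_arr0 ⟨i, hi⟩]; exact p_le_P _)
    (fun i hi => by rw [ha, input_arr1 ⟨i, hi⟩]; exact w_le_W _)
    (by rw [ha]; exact hzero) hG).framed.mono le_rfl ?_
  rintro s3 ⟨hs, hf3⟩
  rw [ha] at hs
  have hlt := smithLt_strictBelow (w := I.input.arr 1) hppos
  obtain ⟨hprep, hid⟩ := prepared_of_sorted hpos hlt hmode hs
  obtain ⟨k1, k2, k3, k4, k5, k6, k7, k8, k9, k10⟩ := h
  refine ⟨f, Q, _, hprep, ?_, ?_, ?_, ?_, ?_, ?_, ?_, ?_, ?_, ?_, ?_, ?_, hid, fun i => ?_, hs.2⟩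
  case refine_13 =>
    rw [hf3.2 11 (by decide), hf3.2 12 (by decide), ha]
    exact ⟨hzero _ _ (by norm_num), hzero _ _ (by norm_num)⟩
  all_goals rw [hf3.1 _ (by decide)]; assumption

section finish

variable {I : ERInstance} {π : Fin I.n ≃ Fin I.n} {f Q : ℕ}

/-- Reading off the sequence, from a state `s` in which both tables are filled and the best
combination has been found; the sorted data are those of the state `s₀`. -/
theorem finishC_tri {X G : ℕ} (hX : 2 ≤ X) {s₀ s : State} (h : Ready I π f Q s₀)
    (hv : ∀ x < 15, s.var x = s₀.var x) (ha : ∀ A < 11, s.arr A = s₀.arr A)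
    (ht1 : ∀ j ≤ I.n, ∀ m ≤ I.P, ∀ q ≤ Q, s.arr 11 (enc I.P j m q) = h.prep.near.T j m q)
    (ht2 : ∀ j ≤ I.n, ∀ m ≤ I.P, ∀ q ≤ Q, s.arr 12 (enc I.P j m q) = h.prep.far.T j m q)
    (hc : Combined h.prep.near.T h.prep.far.T I.n (f * Q) Q (min I.K I.P) s)
    (hb : s.var vBest ≠ 0) (hG : (I.n + 1) * (I.n + 1) ≤ G) :
    Tri X G finishC s I.Solved := by
  obtain ⟨c1, c2, ⟨c3, c3'⟩, ⟨c4, c4'⟩, c5, c6, c7⟩ := hc.att hb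
  set k := s.var vBt with hk
  set m₁ := s.var vBm1 with hm₁
  set m₂ := s.var vBm2 with hm₂
  set s₁ := s.var vBs1 with hs₁
  set s₂ := s.var vBs2 with hs₂
  have hGn : I.n + 1 ≤ G := le_trans (Nat.le_mul_of_pos_left _ (by omega)) hG
  have hmP : m₁ + m₂ ≤ I.P := c2.trans (min_le_right _ _)
  have hnear : ∀ t : State, (∀ x < 15, t.var x = s₀.var x) → (∀ A < 11, t.arr A = s₀.arr A) →
      t.dp true 4 5 6 = h.prep.near := fun t h1 h2 => by
    rw [State.dp, h1 6 (by norm_num), h1 5 (by norm_num), h1 8 (by norm_num), h2 4 (by norm_num),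
      h2 5 (by norm_num), h2 6 (by norm_num), h.f_eq, h.Q_eq, h.Y_eq]
  have hfar : ∀ t : State, (∀ x < 15, t.var x = s₀.var x) → (∀ A < 11, t.arr A = s₀.arr A) →
      t.dp false 8 9 10 = h.prep.far := fun t h1 h2 => by
    rw [State.dp, h1 6 (by norm_num), h1 5 (by norm_num), h1 8 (by norm_num), h2 8 (by norm_num),
      h2 9 (by norm_num), h2 10 (by norm_num), h.f_eq, h.Q_eq, h.Y_eq]
  have hstep : ∀ {t t' : State} {xs As : List ℕ}, Frame xs As t t' → (∀ x ∈ xs, 15 ≤ x) →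
      (∀ A ∈ As, 11 ≤ A) → (∀ x < 15, t.var x = s₀.var x) → (∀ A < 11, t.arr A = s₀.arr A) →
      (∀ x < 15, t'.var x = s₀.var x) ∧ ∀ A < 11, t'.arr A = s₀.arr A :=
    fun hf hx hA h1 h2 => ⟨fun x hlt => ((hf.below hx hA).1 x hlt).trans (h1 x hlt),
      fun A hlt => ((hf.below hx hA).2 A hlt).trans (h2 A hlt)⟩
  -- The near side.
  refine Tri.seq ((Tri.wp (Q := fun t => t.var vJ = k ∧ t.var vLen = k ∧ t.var vM = m₁ ∧
    t.var vS = s₁) hX (by omega) (by simp [Cmd.degOK, Expr.deg]) fun hbd => ?_).framed.mono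
    le_rfl ?_)
  · simp only [Cmd.wp, Expr.val, State.setVar_var, Nat.reduceEqDiff, if_false, if_true]
    exact ⟨hbd.1 _, hbd.1 _, hbd.1 _, hbd.1 _, rfl, rfl, rfl, rfl⟩
  rintro t1 ⟨⟨v1, v2, v3, v4⟩, hf1⟩
  obtain ⟨hv1, ha1⟩ := hstep hf1 (by simp [Cmd.wv]) (by simp [Cmd.wa]) hv ha
  refine Tri.seq ((traceC_tri (n := I.n) (P := I.P) (Q := Q) hX (hnear t1 hv1 ha1)
    (by rw [hv1 0 (by norm_num), h.n_eq])
    (by rw [hv1 11 (by norm_num), h.P1_eq]) c1 v1 v2 v3 v4 (by omega) c3' (by norm_num)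
    (by norm_num) (by norm_num) (by norm_num) (by rw [hf1.2 11 (by simp [Cmd.wa])]; exact ht1) c5
    hGn).framed.mono le_rfl ?_)
  rintro t2 ⟨⟨⟨q₁, hA1⟩, hl1, -⟩, hf2⟩
  obtain ⟨hv2, ha2⟩ := hstep hf2 (by simp [traceC, forC, Cmd.wv]) (by simp [traceC, forC, Cmd.wa])
    hv1 ha1
  -- The far side.
  have hn2 : t2.var vN = I.n := by rw [hv2 0 (by norm_num), h.n_eq]
  have hkeep : ∀ x, 35 ≤ x → x ≤ 40 → t2.var x = s.var x := fun x h1 h2 => by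
    rw [hf2.1 x (by simp [traceC, forC, Cmd.wv]; omega), hf1.1 x (by simp [Cmd.wv]; omega)]
  refine Tri.seq ((Tri.wp (Q := fun t => t.var vJ = I.n - k ∧ t.var vLen = I.n - k ∧
    t.var vM = m₂ ∧ t.var vS = s₂) hX (by omega) (by simp [Cmd.degOK, Expr.deg])
    fun hbd => ?_).framed.mono le_rfl ?_)
  · simp only [Cmd.wp, Expr.val, State.setVar_var, Nat.reduceEqDiff, if_false, if_true]
    have hbn := hbd.1 vN
    rw [hkeep 36 (by norm_num) (by norm_num), hkeep 39 (by norm_num) (by norm_num),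
      hkeep 40 (by norm_num) (by norm_num), hn2]
    rw [hn2] at hbn
    refine ⟨by omega, by omega, ?_, ?_, rfl, rfl, rfl, rfl⟩
    · rw [← hkeep 39 (by norm_num) (by norm_num)]; exact hbd.1 _
    · rw [← hkeep 40 (by norm_num) (by norm_num)]; exact hbd.1 _
  rintro t3 ⟨⟨w1, w2, w3, w4⟩, hf3⟩
  obtain ⟨hv3, ha3⟩ := hstep hf3 (by simp [Cmd.wv]) (by simp [Cmd.wa]) hv2 ha2
  refine Tri.seq ((traceC_tri (n := I.n) (P := I.P) (Q := Q) hX (hfar t3 hv3 ha3)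
    (by rw [hv3 0 (by norm_num), h.n_eq])
    (by rw [hv3 11 (by norm_num), h.P1_eq]) (Nat.sub_le _ _) w1 w2 w3 w4 (by omega) c4'
    (by norm_num) (by norm_num) (by norm_num) (by norm_num) (by
      rw [hf3.2 12 (by simp [Cmd.wa]), hf2.2 12 (by simp [traceC, forC, Cmd.wa]),
        hf1.2 12 (by simp [Cmd.wa])]
      exact ht2) c6 hGn).framed.mono le_rfl ?_)
  rintro t4 ⟨⟨⟨q₂, hA2⟩, hl2, hu2⟩, hf4⟩
  obtain ⟨hv4, ha4⟩ := hstep hf4 (by simp [traceC, forC, Cmd.wv]) (by simp [traceC, forC, Cmd.wa])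
    hv3 ha3
  have hc13 : ∀ i < k, t4.arr 13 i = t2.arr 13 i := fun i hi => by
    rw [hu2 i fun x hx => by simp [sortedIdx]; omega, hf3.2 13 (by simp [Cmd.wa])]
  -- The output.
  refine Tri.seq ((outputC_tri hX (by rw [hv4 0 (by norm_num), h.n_eq]) hG).framed.mono le_rfl ?_)
  rintro t5 ⟨hout, hf5⟩
  refine Tri.wp hX (by omega) rfl fun _ =>
    ⟨by simp [Expr.val]; omega, Or.inl ⟨by simp [Expr.val], ?_⟩⟩
  set c := t4.arr 13 with hcdef
  have hcl := classLt_strictBelow c I.n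
  have hσ : ∀ i : Fin I.n, (((rankEquiv hcl).symm.trans π).symm (π i) : ℕ) =
      rankOf (classLt c) I.n i := fun i => by simp [rankEquiv_val]
  obtain ⟨hfeas, hcost⟩ := h.prep.feasible_of_attains (c := c) (k := k) (m₁ := m₁) (m₂ := m₂)
    (s₁ := s₁) (s₂ := s₂) (q₁ := q₁) (q₂ := q₂) c1
    (hA1 _ fun i hi => congrArg (fun y => decide (y = 1)) (hc13 i hi))
    (hA2 _ fun i hi => by simp [sortedIdx])
    (fun i hi => by
      have := hl1 i hi
      simp only [sortedIdx, if_true] at this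
      rwa [hc13 i hi])
    (fun i hi hin => by
      have := hl2 (I.n - 1 - i) (by omega)
      simpa [sortedIdx, show I.n - 1 - (I.n - 1 - i) = i by omega] using this)
    c2 c3 c3' c4 c4' hσ
  refine ⟨(rankEquiv hcl).symm.trans π, ⟨hfeas, fun τ hτ => ?_⟩, fun x => ?_⟩
  · obtain ⟨k', hk', n₁, n₂, r₁, r₂, g1, g2, g3, g4, g5, g6, g7, g8⟩ := h.prep.exists_entries hτ
    obtain ⟨-, hlow⟩ := hc.low k' hk' n₁ n₂ r₁ r₂ g1 g2 g3 g4 g5 g6 g7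
    rw [c7] at hlow
    zify at hlow ⊢
    linarith
  · have := hout ((rankEquiv hcl).symm x) (Fin.is_lt _)
    rw [← rankEquiv_val hcl, Equiv.apply_symm_apply, ha4 7 (by norm_num), h.id_eq] at this
    simpa using this

/-- Correctness and running time of the program.  `C` bounds the cost of a single decision in the
dynamic programs, so that `X` bounds the sum of any two table entries. -/
theorem solveC_tri {I : ERInstance} {X C G : ℕ} (hX : 2 ≤ X) (hpos : ∀ j, 0 < I.p j)
    (hnX : I.n + 1 ≤ X) (hPX : I.P + 1 ≤ X) (hWX : I.W ≤ X) (hWP : I.W * I.P ≤ X)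
    (hC : I.W * I.P * I.P + I.W * I.P + I.P * I.P ≤ C) (hCX : 2 * (1 + I.n * C) ≤ X)
    (hnP : I.n ≤ I.P) (hG : (I.n + 2) * ((I.P + 2) * (min I.P I.W + 2)) ≤ G) :
    Tri X G solveC I.input I.Solved := by
  have hGnn : (I.n + 1) * (I.n + 1) ≤ G := by
    refine le_trans (Nat.mul_le_mul (Nat.le_succ _) ?_) hG
    exact le_trans (show I.n + 1 ≤ I.P + 2 by omega) (Nat.le_mul_of_pos_right _ (by omega))
  refine Tri.seq ((prepareC_tri hX hpos hnX hPX hWX hWP hGnn).mono le_rfl ?_)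
  rintro s ⟨f, Q, π, h⟩
  have hQmin : Q = min I.P I.W := by rcases h.prep.mode with h | h <;> omega
  have hQP : Q ≤ I.P := by omega
  have hQW : Q ≤ I.W := by omega
  have hf1 : f ≤ 1 := by rcases h.prep.mode with h | h <;> omega
  have heQ : f * Q ≤ Q := (Nat.mul_le_mul_right Q hf1).trans (one_mul Q).le
  have hGt : (I.n + 1) * ((I.P + 2) * (Q + 2)) ≤ G := by
    rw [hQmin]; exact (Nat.mul_le_mul_right _ (Nat.le_succ _)).trans hG
  have hin1 : ∀ j, ∀ m ≤ I.P, ∀ q ≤ Q, h.prep.near.cin j m q ≤ C := fun j m _ q _ =>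
    sideDP_cin_le hf1 (h.le j).1 (h.le j).2.1 hQP hC
  have hout1 : ∀ j, ∀ m ≤ I.P, ∀ q ≤ Q, h.prep.near.cout j m q ≤ C := fun j m hm q hq =>
    sideDP_cout_le (h.le j).1 (h.le j).2.1 (hq.trans hQP) hm hC
  have hin2 : ∀ j, ∀ m ≤ I.P, ∀ q ≤ Q, h.prep.far.cin j m q ≤ C := fun j m _ q _ =>
    sideDP_cin_le hf1 (h.le j).2.2.1 (h.le j).2.2.2 hQP hC
  have hout2 : ∀ j, ∀ m ≤ I.P, ∀ q ≤ Q, h.prep.far.cout j m q ≤ C := fun j m hm q hq =>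
    sideDP_cout_le (h.le j).2.2.1 (h.le j).2.2.2 (hq.trans hQP) hm hC
  have hd1 : s.dp true 4 5 6 = h.prep.near := by rw [State.dp, h.f_eq, h.Q_eq, h.Y_eq]
  refine Tri.seq ((tableC_tri (fwd := true) (ap := 4) (aw := 5) (ar := 6) (aT := 11) (Q := Q)
    (C := C) hX h.n_eq h.P1_eq h.Q1_eq (by rw [hd1]; exact h.E1_eq) hQP (by rw [hd1]; exact heQ)
    (by norm_num) (by norm_num) (by norm_num) (by rw [hd1]; exact hin1) (by rw [hd1]; exact hout1)
    (by omega) hGt fun i => (h.zero i).1).framed.mono le_rfl ?_)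
  rintro s1 ⟨ht1, hf1'⟩
  rw [hd1] at ht1
  obtain ⟨hv1, ha1⟩ := hf1'.below (a := 15) (b := 11) (by decide) (by decide)
  have hd2 : s1.dp false 8 9 10 = h.prep.far := by
    rw [State.dp, hv1 6 (by norm_num), hv1 5 (by norm_num), hv1 8 (by norm_num),
      ha1 8 (by norm_num), ha1 9 (by norm_num), ha1 10 (by norm_num), h.f_eq, h.Q_eq, h.Y_eq]
  refine Tri.seq ((tableC_tri (fwd := false) (ap := 8) (aw := 9) (ar := 10) (aT := 12) (Q := Q)
    (C := C) hX ((hv1 0 (by norm_num)).trans h.n_eq) ((hv1 11 (by norm_num)).trans h.P1_eq)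
    ((hv1 12 (by norm_num)).trans h.Q1_eq)
    (by rw [hd2]; exact (hv1 14 (by norm_num)).trans h.E1_eq) hQP (by rw [hd2]; exact heQ)
    (by norm_num) (by norm_num) (by norm_num) (by rw [hd2]; exact hin2) (by rw [hd2]; exact hout2)
    (by omega) hGt fun i => by rw [hf1'.2 12 (by decide)]; exact (h.zero i).2).framed.mono
    le_rfl ?_)
  rintro s2 ⟨ht2, hf2'⟩
  rw [hd2] at ht2
  obtain ⟨hv2, ha2⟩ := hf2'.below (a := 15) (b := 11) (by decide) (by decide)
  have hf12 : ∀ x < 15, s2.var x = s.var x := fun x hx => (hv2 x hx).trans (hv1 x hx)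
  have ha12 : ∀ A < 11, s2.arr A = s.arr A := fun A hA => (ha2 A hA).trans (ha1 A hA)
  have ht1' : ∀ j ≤ I.n, ∀ m ≤ I.P, ∀ q ≤ Q, s2.arr 11 (enc I.P j m q) = h.prep.near.T j m q := by
    rw [hf2'.2 11 (by decide)]; exact ht1
  have hbd1 : ∀ j ≤ I.n, ∀ m ≤ I.P, ∀ q ≤ Q, h.prep.near.T j m q ≤ 1 + I.n * C :=
    fun j hj m hm q hq => (DP.T_bound hin1 hout1 hm hq).trans
      (Nat.add_le_add_left (Nat.mul_le_mul_right _ hj) _)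
  have hbd2 : ∀ j ≤ I.n, ∀ m ≤ I.P, ∀ q ≤ Q, h.prep.far.T j m q ≤ 1 + I.n * C :=
    fun j hj m hm q hq => (DP.T_bound hin2 hout2 hm hq).trans
      (Nat.add_le_add_left (Nat.mul_le_mul_right _ hj) _)
  refine Tri.seq ((combineC_tri (n := I.n) (P := I.P) (Q := Q) (K := min I.K I.P) (e := f * Q)
    (Z := 1 + I.n * C) hX ((hf12 0 (by norm_num)).trans h.n_eq)
    ((hf12 10 (by norm_num)).trans h.N1_eq) ((hf12 11 (by norm_num)).trans h.P1_eq)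
    ((hf12 12 (by norm_num)).trans h.Q1_eq) ((hf12 13 (by norm_num)).trans h.K1_eq)
    ((hf12 9 (by norm_num)).trans h.K_eq) ((hf12 7 (by norm_num)).trans h.e_eq)
    (min_le_right _ _) hCX ht1' ht2 hbd1 hbd2 (by rw [hQmin]; exact hG)).framed.mono le_rfl ?_)
  rintro s3 ⟨hcomb, hf3'⟩
  have hf13 : ∀ x < 15, s3.var x = s.var x := fun x hx =>
    ((hf3'.below (a := 15) (b := 0) (by decide) (by simp)).1 x hx).trans (hf12 x hx)
  have ha13 : ∀ A, s3.arr A = s2.arr A := fun A =>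
    hf3'.2 A (by rw [show combineC.wa = [] from rfl]; exact List.not_mem_nil)
  refine Tri.cond hX (le_trans (Nat.succ_le_of_lt (by positivity)) hG) (by simp [Expr.deg])
    (fun hb => ?_) fun hb => ?_
  · exact finishC_tri hX h hf13 (fun A hA => (ha13 A).trans (ha12 A hA))
      (by rw [ha13]; exact ht1') (by rw [ha13]; exact ht2) hcomb hb hGnn
  · refine Tri.wp hX (le_trans (Nat.succ_le_of_lt (by positivity)) hG) rfl fun _ => Or.inr ⟨?_, ?_⟩
    · rw [hf13 2 (by norm_num), h.res_eq]
    · rintro ⟨τ, hτ⟩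
      obtain ⟨k', hk', n₁, n₂, r₁, r₂, g1, g2, g3, g4, g5, g6, g7, -⟩ := h.prep.exists_entries hτ
      exact (hcomb.low k' hk' n₁ n₂ r₁ r₂ g1 g2 g3 g4 g5 g6 g7).1 hb

end finish

theorem input_bounded (I : ERInstance) : I.input.Bounded (I.n + I.P + I.W + I.K + 2) := by
  refine ⟨fun x => ?_, fun A i => ?_⟩
  · simp only [ERInstance.input]
    split_ifs <;> omega
  · simp only [ERInstance.input]
    split_ifs with h
    · have := p_le_P (I := I) ⟨i, h⟩; omega
    · have := w_le_W (I := I) ⟨i, h⟩; omega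
    all_goals omega

end WordRAM

/-- One fixed program solves every instance of `1|er|∑ w_j C_j` with positive processing times and
positive total weight in at most `c * (n * P * min P W)` steps, on words that are polynomially
bounded in the input numbers. -/
theorem mainTheorem2 :
    ∃ (prog : WordRAM.Cmd) (c k : ℕ), ∀ I : ERInstance,
      (∀ j, 0 < I.p j) → 0 < I.W →
      ∃ (t : ℕ) (s : WordRAM.State),
        WordRAM.Exec ((I.n + I.P + I.W + I.K + 2) ^ k) prog I.input t s ∧
        I.Solved s ∧
        t ≤ c * (I.n * I.P * min I.P I.W) := by
  -- States hold numbers up to `N ^ 6`, and expressions stay below the twentieth power of that.  The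
  -- factor `27` absorbs the additive constants in the three loop bounds.
  refine ⟨WordRAM.solveC, WordRAM.solveC.size * 27, 120, fun I hp hW => ?_⟩
  set N := I.n + I.P + I.W + I.K + 2 with hN
  have hn : 0 < I.n := by
    rcases Nat.eq_zero_or_pos I.n with h | h
    · exfalso
      have : IsEmpty (Fin I.n) := by rw [h]; infer_instance
      rw [ERInstance.W, Finset.univ_eq_empty, Finset.sum_empty] at hW
      exact lt_irrefl _ hW
    · exact h
  have hnP : I.n ≤ I.P := by
    have : ∑ _j : Fin I.n, 1 ≤ I.P := Finset.sum_le_sum fun j _ => hp j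
    simpa using this
  have hN5 : 5 ≤ N := by omega
  have hpow : ∀ a b : ℕ, a ≤ b → N ^ a ≤ N ^ b := fun a b h =>
    Nat.pow_le_pow_right (by omega) h
  have h1 : N ≤ N ^ 6 := by simpa using hpow 1 6 (by norm_num)
  have hPN : I.P ≤ N := by omega
  have hWN : I.W ≤ N := by omega
  have hnN : I.n ≤ N := by omega
  have hWPP : I.W * I.P * I.P ≤ N ^ 3 :=
    (Nat.mul_le_mul (Nat.mul_le_mul hWN hPN) hPN).trans (by ring_nf; exact le_rfl)
  have hWP : I.W * I.P ≤ N ^ 2 :=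
    (Nat.mul_le_mul hWN hPN).trans (by ring_nf; exact le_rfl)
  have hPP : I.P * I.P ≤ N ^ 2 :=
    (Nat.mul_le_mul hPN hPN).trans (by ring_nf; exact le_rfl)
  have h23 := hpow 2 3 (by norm_num)
  have hCX : 2 * (1 + I.n * (3 * N ^ 3)) ≤ N ^ 6 := by
    have e1 : I.n * (3 * N ^ 3) ≤ 3 * N ^ 4 :=
      (Nat.mul_le_mul_right _ hnN).trans (by ring_nf; exact le_rfl)
    have e2 : 25 * N ^ 4 ≤ N ^ 6 := by
      have : 25 ≤ N ^ 2 := by nlinarith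
      calc 25 * N ^ 4 ≤ N ^ 2 * N ^ 4 := Nat.mul_le_mul_right _ this
        _ = N ^ 6 := by ring
    have e3 : 1 ≤ N ^ 4 := Nat.one_le_pow _ _ (by omega)
    omega
  obtain ⟨t, s, k1, k2, -, k4⟩ := WordRAM.solveC_tri (I := I) (X := N ^ 6) (C := 3 * N ^ 3)
    (G := 27 * (I.n * I.P * min I.P I.W)) (by omega) hp (by omega) (by omega) (by omega)
    (hWP.trans (hpow 2 6 (by norm_num))) (by omega) hCX hnP (by
      have hm : 0 < min I.P I.W := lt_min (hn.trans_le hnP) hW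
      calc (I.n + 2) * ((I.P + 2) * (min I.P I.W + 2))
          ≤ (3 * I.n) * ((3 * I.P) * (3 * min I.P I.W)) :=
            Nat.mul_le_mul (by omega) (Nat.mul_le_mul (by omega) (by omega))
        _ = 27 * (I.n * I.P * min I.P I.W) := by ring)
    (by
      have hb := WordRAM.input_bounded I
      exact ⟨fun x => (hb.1 x).trans h1, fun A i => (hb.2 A i).trans h1⟩)
  refine ⟨t, s, ?_, k4, ?_⟩
  · rw [← pow_mul] at k1; exact k1
  · rw [mul_assoc]; exact k2
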